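/- Let $(R,\mathfrak m)$ be a commutative noetherian local ring, let $\boldsymbol a = a_1,\dots,a_e$ ($e\ge 0$) be a list of elements of $\mathfrak m$, and let $K=K^R(\boldsymbol a)$ be the Koszul complex, viewed as a graded-commutative DG $R$-algebra via the wedge product. For an $R$-complex $X$, the complex $K\otimes_R X$ is a DG $K$-module via $u(v\otimes x)=(uv)\otimes x$. Write $\mathsf D(R)$ and $\mathsf D(K)$ for the derived categories of $R$-complexes and of DG $K$-modules. An $R$-complex $X$ is *semidualizing* if its homology is bounded and finitely generated over $R$ in each degree, and the homothety morphism $R\to \mathbf R\mathrm{Hom}_R(X,X)$ is an isomorphism in $\mathsf D(R)$. A DG $K$-module $M$ is *semidualizing* if its homology is bounded and finitely generated over $R$ in each degree, and the homothety morphism $K\to \mathbf R\mathrm{Hom}_K(M,M)$ is an isomorphism in $\mathsf D(K)$. Let $C$ and $C'$ be $R$-complexes (not assumed bounded) such that the $R$-modules $\mathrm H_n(C)$ and $\mathrm H_n(C')$ are finitely generated for every $n\in\mathbb Z$. Then: (a) The DG $K$-module $K\otimes_R C$ is semidualizing if and only if the $R$-complex $C$ is semidualizing. (b) If $C$ and $C'$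 are semidualizing $R$-complexes and $K\otimes_R C\simeq K\otimes_R C'$ in $\mathsf D(K)$, then $C\simeq C'$ in $\mathsf D(R)$. -/

import Mathlib

open CategoryTheory CochainComplex.HomComplex

universe w u

/-! Homological notation `M_n` is rendered by cochain complexes indexed by `ℤ` through the usual
convention `M_n = M^{-n}`. -/

section Complexes

variable {R : Type u} [CommRing R]

/-- Every homology module of the complex is finitely generated. -/
def HomologicallyDegreewiseFinite (M : CochainComplex (ModuleCat.{u} R) ℤ) : Prop :=
  ∀ n : ℤ, Module.Finite R (M.homology n)

/-- The homology vanishes in all but a bounded range of degrees. -/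
def HomologicallyBounded (M : CochainComplex (ModuleCat.{u} R) ℤ) : Prop :=
  ∃ b : ℤ, ∀ n : ℤ, b < |n| → Limits.IsZero (M.homology n)

/-- The homology is bounded and degreewise finitely generated. -/
def HomologicallyFinite (M : CochainComplex (ModuleCat.{u} R) ℤ) : Prop :=
  HomologicallyBounded M ∧ HomologicallyDegreewiseFinite M

/-- The complex of `R`-modules `Hom_R(M, N)`. In degree `n` it consists of the families of
`R`-linear maps `M^p → N^{p+n}`, and its differential is `f ↦ d f - (-1)^n f d`. -/
noncomputable def homCx (M N : CochainComplex (ModuleCat.{u} R) ℤ) :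
    CochainComplex (ModuleCat.{u} R) ℤ where
  X n := ModuleCat.of R (Cochain M N n)
  d i j := ModuleCat.ofHom (δ_hom R M N i j)
  shape i j h := by
    exact ModuleCat.hom_ext (LinearMap.ext fun f => δ_shape i j h f)
  d_comp_d' i j k _ _ := by
    exact ModuleCat.hom_ext (LinearMap.ext fun f => δ_δ i j k f)

/-- For a morphism `π : P ⟶ M`, the morphism `R ⟶ Hom_R(P, M)`, `r ↦ (p ↦ r π(p))`. It is the
composite of the homothety morphism `R ⟶ Hom_R(M, M)` with `Hom_R(π, M)`. -/
noncomputable def homothetyCx {P M : CochainComplex (ModuleCat.{u} R) ℤ} (π : P ⟶ M) :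
    (HomologicalComplex.single (ModuleCat.{u} R) (ComplexShape.up ℤ) 0).obj (ModuleCat.of R R) ⟶
      homCx P M :=
  HomologicalComplex.mkHomFromSingle
    (ModuleCat.ofHom (LinearMap.toSpanSingleton R (Cochain P M 0) (Cochain.ofHom π)))
    (fun j _ => by
      refine ModuleCat.hom_ext (LinearMap.ext fun r => ?_)
      change δ 0 j (r • Cochain.ofHom π) = 0
      simp)

/-- An `R`-complex `C` is semidualizing if it is homologically finite and the homothety morphism
`R ⟶ RHom_R(C, C)` is an isomorphism in the derived category, where `RHom_R(C, C) = Hom_R(P, C)`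
is computed by a K-projective resolution `π : P ⟶ C`. -/
def IsSemidualizing [HasDerivedCategory.{w} (ModuleCat.{u} R)]
    (C : CochainComplex (ModuleCat.{u} R) ℤ) : Prop :=
  HomologicallyFinite C ∧
    ∃ (P : CochainComplex (ModuleCat.{u} R) ℤ) (π : P ⟶ C),
      P.IsKProjective ∧ QuasiIso π ∧ IsIso (DerivedCategory.Q.map (homothetyCx π))

end Complexes

namespace ExteriorAlgebra
variable {R : Type u} [CommRing R] {M : Type u} [AddCommGroup M] [Module R M]

open CliffordAlgebra (contractLeft contractLeft_ι_mul contractLeft_contractLeft contractLeft_algebraMap)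

lemma mul_mem_power {m n : ℕ} {x y : ExteriorAlgebra R M} (hx : x ∈ ⋀[R]^m M)
    (hy : y ∈ ⋀[R]^n M) : x * y ∈ ⋀[R]^(m + n) M := by
  rw [exteriorPower, pow_add]
  exact Submodule.mul_mem_mul hx hy

lemma contractLeft_power_zero (d : Module.Dual R M) {x : ExteriorAlgebra R M}
    (hx : x ∈ ⋀[R]^0 M) : contractLeft d x = 0 := by
  rw [exteriorPower, pow_zero, Submodule.mem_one] at hx
  obtain ⟨r, rfl⟩ := hx
  exact contractLeft_algebraMap _ d r

lemma contractLeft_mem_power (d : Module.Dual R M) (m : ℕ) :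
    ∀ x ∈ ⋀[R]^(m + 1) M, contractLeft d x ∈ ⋀[R]^m M := by
  induction m with
  | zero =>
    intro x hx
    rw [exteriorPower, zero_add, pow_one] at hx
    obtain ⟨v, rfl⟩ := hx
    rw [CliffordAlgebra.contractLeft_ι, exteriorPower, pow_zero]
    exact Submodule.algebraMap_mem _
  | succ m ih =>
    intro x hx
    rw [exteriorPower, pow_succ'] at hx
    induction hx using Submodule.mul_induction_on' with
    | add x _ y _ hx hy => rw [map_add]; exact Submodule.add_mem _ hx hy
    | mem_mul_mem x hx y hy =>
      obtain ⟨v, rfl⟩ := hx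
      rw [contractLeft_ι_mul]
      refine Submodule.sub_mem _ (Submodule.smul_mem _ _ hy) ?_
      rw [exteriorPower, pow_succ']
      exact Submodule.mul_mem_mul ⟨v, rfl⟩ (ih y hy)

lemma contractLeft_mul (d : Module.Dual R M) (m : ℕ) (x y : ExteriorAlgebra R M)
    (hx : x ∈ ⋀[R]^m M) : contractLeft d (x * y) =
      contractLeft d x * y + (m : ℤ).negOnePow • (x * contractLeft d y) := by
  induction hx using Submodule.pow_induction_on_left' with
  | algebraMap r =>
    simp [CliffordAlgebra.contractLeft_algebraMap_mul]
  | add x z i hx hz ihx ihz =>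
    simp only [add_mul, map_add, ihx, ihz, smul_add]
    abel
  | mem_mul v hv i x hx ih =>
    obtain ⟨v, rfl⟩ := hv
    rw [mul_assoc, contractLeft_ι_mul, contractLeft_ι_mul, ih, Nat.cast_succ,
      Int.negOnePow_succ, Units.smul_def, Units.smul_def, Units.val_neg, mul_add, sub_mul,
      mul_smul_comm, smul_mul_assoc, neg_smul, mul_assoc, mul_assoc]
    abel

lemma ι_mul_comm (n : ℕ) (v : M) (y : ExteriorAlgebra R M) (hy : y ∈ ⋀[R]^n M) :
    ι R v * y = (n : ℤ).negOnePow • (y * ι R v) := by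
  induction hy using Submodule.pow_induction_on_left' with
  | algebraMap r => simp [Algebra.commutes]
  | add x z i hx hz ihx ihz => rw [mul_add, ihx, ihz, add_mul, smul_add]
  | mem_mul w hw i x hx ih =>
    obtain ⟨w, rfl⟩ := hw
    have h := eq_neg_of_add_eq_zero_left (ι_add_mul_swap (R := R) v w)
    rw [← mul_assoc, h, neg_mul, mul_assoc, ih, Nat.cast_succ,
      Int.negOnePow_succ, Units.smul_def, Units.smul_def, Units.val_neg, mul_smul_comm, neg_smul,
      mul_assoc]

lemma power_mul_comm (m n : ℕ) (x y : ExteriorAlgebra R M) (hx : x ∈ ⋀[R]^m M)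
    (hy : y ∈ ⋀[R]^n M) : x * y = ((m : ℤ) * n).negOnePow • (y * x) := by
  induction hx using Submodule.pow_induction_on_left' with
  | algebraMap r => simp [Algebra.commutes]
  | add x z i hx hz ihx ihz => rw [add_mul, mul_add, smul_add, ihx, ihz]
  | mem_mul v hv i x hx ih =>
    obtain ⟨v, rfl⟩ := hv
    rw [mul_assoc, ih, Nat.cast_succ, add_mul, one_mul, Int.negOnePow_add, Units.smul_def,
      Units.smul_def, Units.val_mul, mul_smul_comm, ← mul_assoc, ι_mul_comm n v y hy,
      Units.smul_def, smul_mul_assoc, mul_smul, mul_assoc]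

lemma power_mul_self (m : ℕ) (hm : Odd m) (x : ExteriorAlgebra R M) (hx : x ∈ ⋀[R]^m M) :
    x * x = 0 := by
  obtain ⟨k, rfl⟩ := hm
  rw [exteriorPower, pow_succ'] at hx
  have key : ∀ a b : ExteriorAlgebra R M, a ∈ ⋀[R]^(2 * k + 1) M → b ∈ ⋀[R]^(2 * k + 1) M →
      a * b + b * a = 0 := by
    intro a b ha hb
    rw [power_mul_comm _ _ a b ha hb, Int.negOnePow_odd]
    · simp
    · exact_mod_cast (odd_two_mul_add_one k).mul (odd_two_mul_add_one k)
  have hle : LinearMap.range (ι R : M →ₗ[R] ExteriorAlgebra R M) *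
    LinearMap.range (ι R : M →ₗ[R] ExteriorAlgebra R M) ^ (2 * k) = ⋀[R]^(2 * k + 1) M :=
    (pow_succ' _ _).symm
  induction hx using Submodule.mul_induction_on' with
  | add x hx y hy ihx ihy =>
    rw [mul_add, add_mul, add_mul, ihx, ihy, zero_add, add_zero]
    exact key y x (hle ▸ hy) (hle ▸ hx)
  | mem_mul_mem x hx y hy =>
    obtain ⟨v, rfl⟩ := hx
    rw [mul_assoc, ← mul_assoc y, power_mul_comm (2 * k) 1 y (ι R v) hy (by simp [exteriorPower]),
      Int.negOnePow_even _ (by simp), one_smul, mul_assoc, ← mul_assoc, ι_sq_zero, zero_mul]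
end ExteriorAlgebra

/-- A graded-commutative differential graded `R`-algebra. The elements of `cx.X i` have
homological degree `-i`. -/
structure DGAlgebra (R : Type u) [CommRing R] where
  /-- the underlying complex -/
  cx : CochainComplex (ModuleCat.{u} R) ℤ
  /-- the product of elements of degrees `i` and `j` -/
  mul (i j k : ℤ) (h : i + j = k) : cx.X i →ₗ[R] cx.X j →ₗ[R] cx.X k
  /-- the unit -/
  one : cx.X 0
  one_mul (i : ℤ) (x : cx.X i) : mul 0 i i (zero_add i) one x = x
  mul_one (i : ℤ) (x : cx.X i) : mul i 0 i (add_zero i) x one = x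
  mul_assoc (i j k ij jk ijk : ℤ) (hij : i + j = ij) (hjk : j + k = jk) (h : ij + k = ijk)
    (h' : i + jk = ijk) (x : cx.X i) (y : cx.X j) (z : cx.X k) :
    mul ij k ijk h (mul i j ij hij x y) z = mul i jk ijk h' x (mul j k jk hjk y z)
  leibniz (i j k : ℤ) (h : i + j = k) (x : cx.X i) (y : cx.X j) :
    cx.d k (k + 1) (mul i j k h x y) =
      mul (i + 1) j (k + 1) (by omega) (cx.d i (i + 1) x) y +
        i.negOnePow • mul i (j + 1) (k + 1) (by omega) x (cx.d j (j + 1) y)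
  mul_comm (i j k : ℤ) (h : i + j = k) (x : cx.X i) (y : cx.X j) :
    mul i j k h x y = (i * j).negOnePow • mul j i k (by omega) y x
  mul_self (i k : ℤ) (h : i + i = k) (x : cx.X i) (hi : Odd i) : mul i i k h x x = 0

/-- A (left) DG module over a DG algebra. -/
structure DGModule {R : Type u} [CommRing R] (A : DGAlgebra.{u} R) where
  /-- the underlying `R`-complex -/
  cx : CochainComplex (ModuleCat.{u} R) ℤ
  /-- the product of an algebra element of degree `i` and a module element of degree `j` -/
  smul (i j k : ℤ) (h : i + j = k) : A.cx.X i →ₗ[R] cx.X j →ₗ[R] cx.X k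
  one_smul (i : ℤ) (m : cx.X i) : smul 0 i i (zero_add i) A.one m = m
  mul_smul (i j k ij jk ijk : ℤ) (hij : i + j = ij) (hjk : j + k = jk) (h : ij + k = ijk)
    (h' : i + jk = ijk) (x : A.cx.X i) (y : A.cx.X j) (m : cx.X k) :
    smul ij k ijk h (A.mul i j ij hij x y) m = smul i jk ijk h' x (smul j k jk hjk y m)
  leibniz (i j k : ℤ) (h : i + j = k) (x : A.cx.X i) (m : cx.X j) :
    cx.d k (k + 1) (smul i j k h x m) =
      smul (i + 1) j (k + 1) (by omega) (A.cx.d i (i + 1) x) m +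
        i.negOnePow • smul i (j + 1) (k + 1) (by omega) x (cx.d j (j + 1) m)

section Koszul

variable {R : Type u} [CommRing R] {e : ℕ}

open CliffordAlgebra (contractLeft contractLeft_contractLeft)

/-- The component of cohomological degree `n` of the Koszul complex on `e` elements: the exterior
power `⋀^{-n} R^e` if `n ≤ 0`, and zero otherwise. -/
def koszulComponent (R : Type u) [CommRing R] (e : ℕ) (n : ℤ) :
    Submodule R (ExteriorAlgebra R (Fin e → R)) :=
  if n ≤ 0 then ⋀[R]^((-n).toNat) (Fin e → R) else ⊥

lemma mem_koszulComponent {n : ℤ} {x : ExteriorAlgebra R (Fin e → R)} :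
    x ∈ koszulComponent R e n ↔ x = 0 ∨ ∃ m : ℕ, n = -m ∧ x ∈ ⋀[R]^m (Fin e → R) := by
  rw [koszulComponent]
  split_ifs with h
  · constructor
    · exact fun hx => Or.inr ⟨_, by omega, hx⟩
    · rintro (rfl | ⟨m, rfl, hx⟩)
      · exact Submodule.zero_mem _
      · simpa using hx
  · constructor
    · exact fun hx => Or.inl hx
    · rintro (rfl | ⟨m, rfl, hx⟩)
      · exact Submodule.zero_mem _
      · omega

lemma one_mem_koszulComponent : (1 : ExteriorAlgebra R (Fin e → R)) ∈ koszulComponent R e 0 :=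
  mem_koszulComponent.2 (Or.inr ⟨0, by simp, by
    rw [ExteriorAlgebra.exteriorPower, pow_zero]
    exact Submodule.one_le.1 le_rfl⟩)

lemma mul_mem_koszulComponent {i j k : ℤ} (h : i + j = k) {x y : ExteriorAlgebra R (Fin e → R)}
    (hx : x ∈ koszulComponent R e i) (hy : y ∈ koszulComponent R e j) :
    x * y ∈ koszulComponent R e k := by
  obtain rfl | ⟨m, rfl, hx'⟩ := mem_koszulComponent.1 hx
  · simp
  obtain rfl | ⟨n, rfl, hy'⟩ := mem_koszulComponent.1 hy
  · simp
  exact mem_koszulComponent.2 (Or.inr ⟨m + n, by omega, ExteriorAlgebra.mul_mem_power hx' hy'⟩)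

/-- The Koszul differential on the exterior algebra, as a map from degree `i` to degree `j`: the
contraction `v₁ ∧ ⋯ ∧ vₙ ↦ ∑ₛ (-1)^{s+1} f(vₛ) v₁ ∧ ⋯ v̂ₛ ⋯ ∧ vₙ` with the linear form
`f : R^e → R` with `f(εₛ) = aₛ`, if `j = i + 1`, and zero otherwise. -/
noncomputable def koszulD (a : Fin e → R) (i j : ℤ) :
    ExteriorAlgebra R (Fin e → R) →ₗ[R] ExteriorAlgebra R (Fin e → R) :=
  if i + 1 = j then contractLeft (Fintype.linearCombination R a) else 0

lemma koszulD_mem (a : Fin e → R) (i j : ℤ) (x : ExteriorAlgebra R (Fin e → R))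
    (hx : x ∈ koszulComponent R e i) : koszulD a i j x ∈ koszulComponent R e j := by
  rw [koszulD]
  split_ifs with h
  · obtain rfl | ⟨m, rfl, hx⟩ := mem_koszulComponent.1 hx
    · simp
    cases m with
    | zero =>
      rw [ExteriorAlgebra.contractLeft_power_zero _ hx]
      exact Submodule.zero_mem _
    | succ m =>
      exact mem_koszulComponent.2 (Or.inr ⟨m, by push_cast at h; omega,
        ExteriorAlgebra.contractLeft_mem_power _ m x hx⟩)
  · exact Submodule.zero_mem _

/-- The Koszul complex `K^R(a)` on a list `a` of elements of `R`. -/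
noncomputable def koszulComplex (a : Fin e → R) : CochainComplex (ModuleCat.{u} R) ℤ where
  X n := ModuleCat.of R (koszulComponent R e n)
  d i j := ModuleCat.ofHom ((koszulD a i j).restrict (koszulD_mem a i j))
  shape i j h := ModuleCat.hom_ext (LinearMap.ext fun x => Subtype.ext (by
    change koszulD a i j x.1 = 0
    rw [koszulD, if_neg (show ¬ i + 1 = j from h), LinearMap.zero_apply]))
  d_comp_d' i j k hij hjk := ModuleCat.hom_ext (LinearMap.ext fun x => Subtype.ext (by
    change koszulD a j k (koszulD a i j x.1) = 0
    rw [koszulD, if_pos (show j + 1 = k from hjk), koszulD, if_pos (show i + 1 = j from hij),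
      contractLeft_contractLeft]))

/-- The Koszul complex with the wedge product, as a DG algebra. -/
noncomputable def koszul (a : Fin e → R) : DGAlgebra R where
  cx := koszulComplex a
  mul i j k h := LinearMap.mk₂ R
    (fun (x : koszulComponent R e i) (y : koszulComponent R e j) =>
      (⟨x.1 * y.1, mul_mem_koszulComponent h x.2 y.2⟩ : koszulComponent R e k))
    (fun x y z => Subtype.ext (add_mul x.1 y.1 z.1))
    (fun r x y => Subtype.ext (smul_mul_assoc r x.1 y.1))
    (fun x y z => Subtype.ext (mul_add x.1 y.1 z.1))
    (fun r x y => Subtype.ext (mul_smul_comm r x.1 y.1))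
  one := (⟨1, one_mem_koszulComponent⟩ : koszulComponent R e 0)
  one_mul i x := Subtype.ext (one_mul x.1)
  mul_one i x := Subtype.ext (mul_one x.1)
  mul_assoc i j k ij jk ijk hij hjk h h' x y z := Subtype.ext (mul_assoc x.1 y.1 z.1)
  leibniz i j k h x y := Subtype.ext (by
    change koszulD a k (k + 1) (x.1 * y.1) =
      koszulD a i (i + 1) x.1 * y.1 + i.negOnePow • (x.1 * koszulD a j (j + 1) y.1)
    rw [koszulD, if_pos rfl, koszulD, if_pos rfl, koszulD, if_pos rfl]
    obtain hx | ⟨m, rfl, hx⟩ := mem_koszulComponent.1 x.2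
    · simp [hx]
    · rw [ExteriorAlgebra.contractLeft_mul _ m x.1 y.1 hx, Int.negOnePow_neg])
  mul_comm i j k h x y := Subtype.ext (by
    change x.1 * y.1 = (i * j).negOnePow • (y.1 * x.1)
    obtain hx | ⟨m, rfl, hx⟩ := mem_koszulComponent.1 x.2
    · simp [hx]
    obtain hy | ⟨n, rfl, hy⟩ := mem_koszulComponent.1 y.2
    · simp [hy]
    rw [ExteriorAlgebra.power_mul_comm m n x.1 y.1 hx hy, neg_mul_neg])
  mul_self i k h x hi := Subtype.ext (by
    change x.1 * x.1 = 0
    obtain hx | ⟨m, rfl, hx⟩ := mem_koszulComponent.1 x.2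
    · simp [hx]
    exact ExteriorAlgebra.power_mul_self m (by simpa using hi) x.1 hx)

end Koszul

namespace DGModule

lemma sign_identity {V : Type*} [AddCommGroup V] (n i : ℤ) (α β γ : V) :
    ((n * i).negOnePow : ℤ) • (α + (i.negOnePow : ℤ) • β) +
      ((n + 1).negOnePow : ℤ) • (((n * (i + 1)).negOnePow : ℤ) • α +
        (i.negOnePow : ℤ) • ((n * i).negOnePow : ℤ) • γ) =
    (((n + 1) * i).negOnePow : ℤ) • (β + ((n + 1).negOnePow : ℤ) • γ) := by
  have hn : (n.negOnePow : ℤ) * (n.negOnePow : ℤ) = 1 := by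
    rw [← Units.val_mul, Int.units_mul_self, Units.val_one]
  simp only [mul_add, add_mul, mul_one, one_mul, Int.negOnePow_add, Units.val_mul,
    Int.negOnePow_one, Units.val_neg, Units.val_one]
  match_scalars
  · linear_combination -((n * i).negOnePow : ℤ) * hn
  all_goals ring

variable {R : Type u} [CommRing R] {A : DGAlgebra.{u} R}

/-- A morphism of DG modules: an `A`-linear morphism of the underlying complexes. -/
@[ext]
structure Hom (M N : DGModule A) where
  /-- the underlying morphism of complexes -/
  hom : M.cx ⟶ N.cx
  map_smul (i j k : ℤ) (h : i + j = k) (x : A.cx.X i) (m : M.cx.X j) :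
    hom.f k (M.smul i j k h x m) = N.smul i j k h x (hom.f j m)

instance : Category (DGModule A) where
  Hom := Hom
  id M := ⟨𝟙 M.cx, fun _ _ _ _ _ _ => by simp⟩
  comp f g := ⟨f.hom ≫ g.hom, fun i j k h x m => by simp [f.map_smul, g.map_smul]⟩

/-- The underlying complex of a DG module, as a functor. -/
def forget (A : DGAlgebra.{u} R) : DGModule A ⥤ CochainComplex (ModuleCat.{u} R) ℤ where
  obj M := M.cx
  map f := Hom.hom f

/-- The quasi-isomorphisms of DG modules. -/
def quasiIso (A : DGAlgebra.{u} R) : MorphismProperty (DGModule A) :=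
  (HomologicalComplex.quasiIso (ModuleCat.{u} R) (ComplexShape.up ℤ)).inverseImage (forget A)

/-- The derived category of DG modules: the localization at the quasi-isomorphisms. -/
abbrev Derived (A : DGAlgebra.{u} R) := (quasiIso A).Localization

/-- The localization functor to the derived category of DG modules. -/
abbrev Q (A : DGAlgebra.{u} R) : DGModule A ⥤ Derived A := (quasiIso A).Q

/-- A DG algebra as a DG module over itself. -/
def self (A : DGAlgebra.{u} R) : DGModule A where
  cx := A.cx
  smul := A.mul
  one_smul := A.one_mul
  mul_smul := A.mul_assoc
  leibniz := A.leibniz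

/-- The `A`-linear cochains of degree `n`: those with `f(x m) = (-1)^{n |x|} x f(m)`. -/
def linearCochains (M N : DGModule A) (n : ℤ) : Submodule R (Cochain M.cx N.cx n) where
  carrier := {f | ∀ (i j k j' k' : ℤ) (h : i + j = k) (hj : j + n = j') (hk : k + n = k')
    (x : A.cx.X i) (m : M.cx.X j),
      f.v k k' hk (M.smul i j k h x m) =
        (n * i).negOnePow • N.smul i j' k' (by omega) x (f.v j j' hj m)}
  add_mem' := by
    intro f g hf hg i j k j' k' h hj hk x m
    simp [hf i j k j' k' h hj hk x m, hg i j k j' k' h hj hk x m]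
  zero_mem' := by
    intro i j k j' k' h hj hk x m
    simp
  smul_mem' := by
    intro r f hf i j k j' k' h hj hk x m
    simp [hf i j k j' k' h hj hk x m, smul_comm r]

lemma δ_mem_linearCochains (M N : DGModule A) (n n' : ℤ) (f : Cochain M.cx N.cx n)
    (hf : f ∈ linearCochains M N n) : δ n n' f ∈ linearCochains M N n' := by
  by_cases hn : n + 1 = n'
  swap
  · rw [δ_shape n n' hn]
    exact Submodule.zero_mem _
  subst hn
  intro i j k j' k' h hj hk x m
  have e1 := hf i j k (j + n) (k + n) h rfl rfl x m
  have e2 := hf i (j + 1) (k + 1) j' k' (by omega) (by omega) (by omega) x (M.cx.d j (j + 1) m)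
  have e3 := hf (i + 1) j (k + 1) (j + n) k' (by omega) (by omega) (by omega)
    (A.cx.d i (i + 1) x) m
  have l1 := M.leibniz i j k h x m
  have l2 := N.leibniz i (j + n) (k + n) (by omega) x (f.v j (j + n) rfl m)
  obtain rfl : k' = k + n + 1 := by omega
  obtain rfl : j' = j + n + 1 := by omega
  rw [δ_v n (n + 1) rfl f k _ hk (k + n) (k + 1) (by omega) rfl,
    δ_v n (n + 1) rfl f j _ hj (j + n) (j + 1) (by omega) rfl]
  simp only [ModuleCat.hom_add, ModuleCat.hom_comp, LinearMap.add_apply, LinearMap.comp_apply,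
    ModuleCat.hom_smul, LinearMap.smul_apply, Units.smul_def, map_add, map_zsmul] at e1 e2 e3 l1 l2 ⊢
  rw [e1, l1]
  simp only [map_add, map_zsmul, e2, e3, l2]
  exact sign_identity n i _ _ _

lemma smul_left_comm (N : DGModule A) (i j p q q' r : ℤ) (hq : j + p = q) (hq' : i + p = q')
    (h : i + q = r) (h' : j + q' = r) (x : A.cx.X i) (y : A.cx.X j) (z : N.cx.X p) :
    N.smul i q r h x (N.smul j p q hq y z) =
      (i * j).negOnePow • N.smul j q' r h' y (N.smul i p q' hq' x z) := by
  rw [← N.mul_smul i j p (i + j) q r rfl hq (by omega) h,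
    ← N.mul_smul j i p (i + j) q' r (by omega) hq' (by omega) h', A.mul_comm i j (i + j) rfl]
  simp only [Units.smul_def, map_zsmul, LinearMap.smul_apply]

/-- The cochain `p ↦ x f(p)`. -/
noncomputable def smulCochain {L : CochainComplex (ModuleCat.{u} R) ℤ} (N : DGModule A)
    (i j k : ℤ) (h : i + j = k) (x : A.cx.X i) (f : Cochain L N.cx j) : Cochain L N.cx k :=
  Cochain.mk fun p q _ => f.v p (p + j) rfl ≫ ModuleCat.ofHom (N.smul i (p + j) q (by omega) x)

lemma smulCochain_apply {L : CochainComplex (ModuleCat.{u} R) ℤ} (N : DGModule A)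
    (i j k : ℤ) (h : i + j = k) (x : A.cx.X i) (f : Cochain L N.cx j) (p q' q : ℤ)
    (hq : p + k = q) (hq' : p + j = q') (z : L.X p) :
    (smulCochain N i j k h x f).v p q hq z = N.smul i q' q (by omega) x (f.v p q' hq' z) := by
  subst hq'
  rfl

lemma add_smulCochain {L : CochainComplex (ModuleCat.{u} R) ℤ} (N : DGModule A)
    (i j k : ℤ) (h : i + j = k) (x y : A.cx.X i) (f : Cochain L N.cx j) :
    smulCochain N i j k h (x + y) f = smulCochain N i j k h x f + smulCochain N i j k h y f := by
  ext
  simp [smulCochain]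

lemma smul_smulCochain {L : CochainComplex (ModuleCat.{u} R) ℤ} (N : DGModule A)
    (i j k : ℤ) (h : i + j = k) (r : R) (x : A.cx.X i) (f : Cochain L N.cx j) :
    smulCochain N i j k h (r • x) f = r • smulCochain N i j k h x f := by
  ext
  simp [smulCochain]

lemma smulCochain_mem (M N : DGModule A) (i j k : ℤ) (h : i + j = k) (x : A.cx.X i)
    (f : Cochain M.cx N.cx j) (hf : f ∈ linearCochains M N j) :
    smulCochain N i j k h x f ∈ linearCochains M N k := by
  intro a b c b' c' habc hb hc y m
  rw [smulCochain_apply N i j k h x f c (c + j) c' hc rfl,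
    smulCochain_apply N i j k h x f b (b + j) b' hb rfl,
    hf a b c (b + j) (c + j) habc rfl rfl y m]
  simp only [Units.smul_def, map_zsmul]
  rw [smul_left_comm N i a (b + j) (c + j) b' c' (by omega) (by omega) (by omega) (by omega)]
  subst h
  rw [Units.smul_def, smul_smul, add_mul, Int.negOnePow_add, Units.val_mul, _root_.mul_comm]

lemma δ_smulCochain {L : CochainComplex (ModuleCat.{u} R) ℤ} (N : DGModule A)
    (i j k : ℤ) (h : i + j = k) (x : A.cx.X i) (f : Cochain L N.cx j) :
    δ k (k + 1) (smulCochain N i j k h x f) =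
      smulCochain N (i + 1) j (k + 1) (by omega) (A.cx.d i (i + 1) x) f +
        i.negOnePow • smulCochain N i (j + 1) (k + 1) (by omega) x (δ j (j + 1) f) := by
  ext p q hq z
  have e1 := smulCochain_apply N i j k h x f p (p + j) (p + k) rfl rfl z
  have e2 := smulCochain_apply N i j k h x f (p + 1) (p + j + 1) q (by omega) (by omega)
    (L.d p (p + 1) z)
  have e3 := smulCochain_apply N (i + 1) j (k + 1) (by omega) (A.cx.d i (i + 1) x) f p (p + j) q
    hq rfl z
  have e4 := smulCochain_apply N i (j + 1) (k + 1) (by omega) x (δ j (j + 1) f) p (p + j + 1) q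
    hq (by omega) z
  have l := N.leibniz i (p + j) (p + k) (by omega) x (f.v p (p + j) rfl z)
  obtain rfl : q = p + k + 1 := by omega
  rw [δ_v j (j + 1) rfl f p (p + j + 1) (by omega) (p + j) (p + 1) (by omega) rfl] at e4
  rw [δ_v k (k + 1) rfl _ p _ hq (p + k) (p + 1) (by omega) rfl]
  rw [Cochain.add_v, Cochain.units_smul_v]
  simp only [ModuleCat.hom_add, ModuleCat.hom_comp, LinearMap.add_apply,
    LinearMap.comp_apply, ModuleCat.hom_smul, LinearMap.smul_apply, Units.smul_def, map_add,
    map_zsmul] at e1 e2 e3 e4 l ⊢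
  rw [e1, l, e2, e3, e4]
  have hs : ((k + 1).negOnePow : ℤ) = i.negOnePow * (j + 1).negOnePow := by
    rw [← Units.val_mul, ← Int.negOnePow_add, ← h, add_assoc]
  rw [hs, mul_zsmul, smul_add]
  exact add_assoc _ _ _

lemma ofHom_mem {M N : DGModule A} (f : M ⟶ N) :
    Cochain.ofHom f.hom ∈ linearCochains M N 0 := by
  intro i j k j' k' h hj hk x m
  obtain rfl : j' = j := by omega
  obtain rfl : k' = k := by omega
  simpa using f.map_smul i j' k' h x m

/-- The complex `Hom_A(M, N)` of `A`-linear cochains, as a DG module with `(x f)(m) = x f(m)`. -/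
noncomputable def homDG (M N : DGModule A) : DGModule A where
  cx :=
    { X n := ModuleCat.of R (linearCochains M N n)
      d n n' := ModuleCat.ofHom ((δ_hom R M.cx N.cx n n').restrict
        (δ_mem_linearCochains M N n n'))
      shape n n' h := ModuleCat.hom_ext (LinearMap.ext fun f => Subtype.ext (δ_shape n n' h f.1))
      d_comp_d' i j k _ _ :=
        ModuleCat.hom_ext (LinearMap.ext fun f => Subtype.ext (δ_δ i j k f.1)) }
  smul i j k h := LinearMap.mk₂ R
    (fun x (f : linearCochains M N j) =>
      (⟨smulCochain N i j k h x f.1, smulCochain_mem M N i j k h x f.1 f.2⟩ :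
        linearCochains M N k))
    (fun x y f => Subtype.ext (add_smulCochain N i j k h x y f.1))
    (fun r x f => Subtype.ext (smul_smulCochain N i j k h r x f.1))
    (fun x f g => Subtype.ext (by ext; simp [smulCochain]))
    (fun r x f => Subtype.ext (by ext; simp [smulCochain]))
  one_smul i f := Subtype.ext (by
    ext p q hq m
    exact (smulCochain_apply N 0 i i (zero_add i) A.one f.1 p q q hq hq m).trans (N.one_smul q _))
  mul_smul i j k ij jk ijk hij hjk h h' x y f := Subtype.ext (by
    ext p q hq m
    refine (smulCochain_apply N ij k ijk h (A.mul i j ij hij x y) f.1 p (p + k) q hq rfl m).trans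
      (Eq.trans ?_ (smulCochain_apply N i jk ijk h' x _ p (p + jk) q hq rfl m).symm)
    refine (N.mul_smul i j (p + k) ij (p + jk) q hij (by omega) (by omega) (by omega) x y _).trans
      (congrArg _ ?_)
    exact (smulCochain_apply N j k jk hjk y f.1 p (p + k) (p + jk) rfl rfl m).symm)
  leibniz i j k h x f := Subtype.ext (δ_smulCochain N i j k h x f.1)

/-- For a morphism `π : P ⟶ M` of DG modules, the morphism `A ⟶ Hom_A(P, M)` of DG modules
given by `x ↦ (p ↦ x π(p))`. It is the composite of the homothety morphism `A ⟶ Hom_A(M, M)`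
with `Hom_A(π, M)`. -/
noncomputable def homothety {P M : DGModule A} (π : P ⟶ M) : self A ⟶ homDG P M where
  hom :=
   { f n := ModuleCat.ofHom
      { toFun x := (⟨smulCochain M n 0 n (add_zero n) x (Cochain.ofHom π.hom),
          smulCochain_mem P M n 0 n (add_zero n) x _ (ofHom_mem π)⟩ : linearCochains P M n)
        map_add' x y := Subtype.ext (add_smulCochain M n 0 n (add_zero n) x y _)
        map_smul' r x := Subtype.ext (smul_smulCochain M n 0 n (add_zero n) r x _) }
     comm' := by
      rintro n n' rfl
      refine ModuleCat.hom_ext (LinearMap.ext fun x => Subtype.ext ?_)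
      refine (δ_smulCochain M n 0 n (add_zero n) x (Cochain.ofHom π.hom)).trans ?_
      ext p q hq m
      have e1 : (smulCochain M n (0 + 1) (n + 1) (by omega) x (δ 0 (0 + 1) (Cochain.ofHom π.hom))) =
        0 := by
        ext
        simp [smulCochain]
      rw [e1, smul_zero, add_zero]
      rfl }
  map_smul i j k h x y := Subtype.ext (by
    ext p q hq m
    refine (smulCochain_apply M k 0 k (add_zero k) (A.mul i j k h x y) _ p p q hq (add_zero p)
      m).trans (Eq.trans ?_ (smulCochain_apply M i j k h x _ p (p + j) q hq rfl m).symm)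
    refine (M.mul_smul i j p k (p + j) q h (by omega) (by omega) (by omega) x y _).trans
      (congrArg _ ?_)
    exact (smulCochain_apply M j 0 j (add_zero j) y _ p p (p + j) rfl (add_zero p) m).symm)

lemma comp_ofHom_mem {P M N : DGModule A} (g : M ⟶ N) (n : ℤ) (f : Cochain P.cx M.cx n)
    (hf : f ∈ linearCochains P M n) :
    f.comp (Cochain.ofHom g.hom) (add_zero n) ∈ linearCochains P N n := by
  intro i j k j' k' h hj hk x m
  have e := hf i j k j' k' h hj hk x m
  simp [e, Units.smul_def, g.map_smul]

/-- The morphism `Hom_A(P, M) ⟶ Hom_A(P, N)` induced by a morphism `M ⟶ N`. -/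
noncomputable def homDGMap (P : DGModule A) {M N : DGModule A} (g : M ⟶ N) :
    homDG P M ⟶ homDG P N where
  hom :=
   { f n := ModuleCat.ofHom
      { toFun z := (⟨z.1.comp (Cochain.ofHom g.hom) (add_zero n),
          comp_ofHom_mem g n z.1 z.2⟩ : linearCochains P N n)
        map_add' z w := Subtype.ext (Cochain.add_comp z.1 w.1 _ (add_zero n))
        map_smul' r z := Subtype.ext (Cochain.smul_comp r z.1 _ (add_zero n)) }
     comm' := by
      rintro n n' rfl
      exact ModuleCat.hom_ext (LinearMap.ext fun z => Subtype.ext (δ_comp_ofHom z.1 g.hom (n + 1))) }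
  map_smul i j k h x z := Subtype.ext (by
    ext p q hq m
    have e1 := smulCochain_apply M i j k h x z.1 p (p + j) q hq rfl m
    have e2 := smulCochain_apply N i j k h x (z.1.comp (Cochain.ofHom g.hom) (add_zero j)) p (p + j)
      q hq rfl m
    rw [Cochain.comp_zero_cochain_v] at e2
    refine Eq.trans ?_ e2.symm
    change ((smulCochain M i j k h x z.1).comp (Cochain.ofHom g.hom) (add_zero k)).v p q hq m = _
    rw [Cochain.comp_zero_cochain_v]
    refine (congrArg _ e1).trans ?_
    rw [Cochain.ofHom_v]
    exact g.map_smul i (p + j) q (by omega) x _)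

/-- A DG module `P` is K-projective if the functor `Hom_A(P, -)` preserves quasi-isomorphisms. -/
def IsKProjective (P : DGModule A) : Prop :=
  ∀ ⦃M N : DGModule A⦄ (g : M ⟶ N), quasiIso A g → quasiIso A (homDGMap P g)

/-- A DG module `M` over `A` is semidualizing if its homology is bounded and degreewise finitely
generated over `R`, and the homothety morphism `A ⟶ RHom_A(M, M)` is an isomorphism in the derived
category of DG modules, where `RHom_A(M, M) = Hom_A(P, M)` is computed by a K-projective
resolution `π : P ⟶ M`. -/
def IsSemidualizing (M : DGModule A) : Prop :=
  HomologicallyFinite M.cx ∧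
    ∃ (P : DGModule A) (π : P ⟶ M),
      P.IsKProjective ∧ quasiIso A π ∧ IsIso ((Q A).map (homothety π))

section Tensor

open MonoidalCategory hiding tensorObj
open HomologicalComplex (tensorObj ιTensorObj mapBifunctorDesc mapBifunctor)

variable (A : DGAlgebra.{u} R) (C : CochainComplex (ModuleCat.{u} R) ℤ)

/-- The action of `x` on `A ⊗_R C`, given by `y ⊗ c ↦ (x y) ⊗ c`. -/
noncomputable def tensorAct (i j k : ℤ) (h : i + j = k) (x : A.cx.X i) :
    (tensorObj A.cx C).X j ⟶ (tensorObj A.cx C).X k :=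
  mapBifunctorDesc (fun p q hpq => ModuleCat.ofHom (A.mul i p (i + p) rfl x) ▷ C.X q ≫
    ιTensorObj A.cx C (i + p) q k (by
      change p + q = j at hpq
      omega))

variable {A C} in
lemma tensor_hom_ext {j : ℤ} {V : ModuleCat.{u} R} {f g : (tensorObj A.cx C).X j ⟶ V}
    (h : ∀ (p q : ℤ) (hpq : p + q = j),
      ιTensorObj A.cx C p q j hpq ≫ f = ιTensorObj A.cx C p q j hpq ≫ g) : f = g :=
  HomologicalComplex.mapBifunctor.hom_ext h

lemma ι_tensorAct (i j k : ℤ) (h : i + j = k) (x : A.cx.X i) (p q r : ℤ) (hpq : p + q = j)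
    (hr : i + p = r) :
    ιTensorObj A.cx C p q j hpq ≫ tensorAct A C i j k h x =
      ModuleCat.ofHom (A.mul i p r hr x) ▷ C.X q ≫ ιTensorObj A.cx C r q k (by omega) := by
  subst hr
  simp [tensorAct]

lemma ι_tensor_d (p q r r' : ℤ) (h : p + q = r) (hr : r + 1 = r') :
    ιTensorObj A.cx C p q r h ≫ (tensorObj A.cx C).d r r' =
      A.cx.d p (p + 1) ▷ C.X q ≫ ιTensorObj A.cx C (p + 1) q r' (by omega) +
        p.negOnePow • (A.cx.X p ◁ C.d q (q + 1) ≫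
          ιTensorObj A.cx C p (q + 1) r' (by omega)) := by
  subst hr
  rw [HomologicalComplex.mapBifunctor.d_eq, Preadditive.comp_add,
    HomologicalComplex.mapBifunctor.ι_D₁, HomologicalComplex.mapBifunctor.ι_D₂,
    HomologicalComplex.mapBifunctor.d₁_eq _ _ _ _
      (show (ComplexShape.up ℤ).Rel p (p + 1) from rfl) _ _ (by change p + 1 + q = r + 1; omega),
    HomologicalComplex.mapBifunctor.d₂_eq _ _ _ _ _
      (show (ComplexShape.up ℤ).Rel q (q + 1) from rfl) _ (by change p + (q + 1) = r + 1; omega)]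
  simp

lemma tensorAct_add (i j k : ℤ) (h : i + j = k) (x y : A.cx.X i) :
    tensorAct A C i j k h (x + y) = tensorAct A C i j k h x + tensorAct A C i j k h y := by
  refine tensor_hom_ext fun p q hpq => ?_
  rw [Preadditive.comp_add, ι_tensorAct _ _ _ _ _ _ _ _ _ _ hpq rfl,
    ι_tensorAct _ _ _ _ _ _ _ _ _ _ hpq rfl, ι_tensorAct _ _ _ _ _ _ _ _ _ _ hpq rfl, map_add,
    ModuleCat.ofHom_add, MonoidalPreadditive.add_whiskerRight, Preadditive.add_comp]

lemma tensorAct_smul (i j k : ℤ) (h : i + j = k) (r : R) (x : A.cx.X i) :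
    tensorAct A C i j k h (r • x) = r • tensorAct A C i j k h x := by
  refine tensor_hom_ext fun p q hpq => ?_
  rw [Linear.comp_smul, ι_tensorAct _ _ _ _ _ _ _ _ _ _ hpq rfl,
    ι_tensorAct _ _ _ _ _ _ _ _ _ _ hpq rfl, map_smul, ← Linear.smul_comp,
    ← MonoidalLinear.smul_whiskerRight]
  rfl

lemma tensorAct_one (i : ℤ) : tensorAct A C 0 i i (zero_add i) A.one = 𝟙 _ := by
  refine tensor_hom_ext fun p q hpq => ?_
  have : A.mul 0 p p (zero_add p) A.one = LinearMap.id := LinearMap.ext (A.one_mul p)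
  rw [ι_tensorAct _ _ _ _ _ _ _ _ _ _ hpq (zero_add p), this, Category.comp_id,
    ModuleCat.ofHom_id, id_whiskerRight, Category.id_comp]

lemma tensorAct_mul (i j k ij jk ijk : ℤ) (hij : i + j = ij) (hjk : j + k = jk)
    (h : ij + k = ijk) (h' : i + jk = ijk) (x : A.cx.X i) (y : A.cx.X j) :
    tensorAct A C ij k ijk h (A.mul i j ij hij x y) =
      tensorAct A C j k jk hjk y ≫ tensorAct A C i jk ijk h' x := by
  refine tensor_hom_ext fun p q hpq => ?_
  have : A.mul ij p (ij + p) rfl (A.mul i j ij hij x y) =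
      A.mul i (j + p) (ij + p) (by omega) x ∘ₗ A.mul j p (j + p) rfl y :=
    LinearMap.ext (A.mul_assoc i j p ij (j + p) (ij + p) hij rfl rfl (by omega) x y)
  rw [ι_tensorAct _ _ _ _ _ _ _ _ _ _ hpq rfl, this, ← Category.assoc,
    ι_tensorAct _ _ _ _ _ _ _ _ _ _ hpq rfl, Category.assoc,
    ι_tensorAct _ _ _ _ _ _ _ _ _ (ij + p) _ (by omega), ModuleCat.ofHom_comp,
    comp_whiskerRight, Category.assoc]

lemma tensorAct_leibniz (i j k : ℤ) (h : i + j = k) (x : A.cx.X i) :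
    tensorAct A C i j k h x ≫ (tensorObj A.cx C).d k (k + 1) =
      tensorAct A C (i + 1) j (k + 1) (by omega) (A.cx.d i (i + 1) x) +
        i.negOnePow • ((tensorObj A.cx C).d j (j + 1) ≫
          tensorAct A C i (j + 1) (k + 1) (by omega) x) := by
  refine tensor_hom_ext fun p q hpq => ?_
  have hl : ModuleCat.ofHom (A.mul i p (i + p) rfl x) ≫ A.cx.d (i + p) (i + p + 1) =
      ModuleCat.ofHom (A.mul (i + 1) p (i + p + 1) (by omega) (A.cx.d i (i + 1) x)) +
        i.negOnePow • (A.cx.d p (p + 1) ≫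
          ModuleCat.ofHom (A.mul i (p + 1) (i + p + 1) (by omega) x)) := by
    ext z
    exact A.leibniz i p (i + p) rfl x z
  rw [Preadditive.comp_add, Linear.comp_units_smul, ← Category.assoc,
    ι_tensorAct _ _ _ _ _ _ _ _ _ _ hpq rfl, Category.assoc, ι_tensor_d _ _ _ _ _ _ _ rfl,
    ι_tensorAct _ _ _ _ _ _ _ _ _ (i + p + 1) hpq (by omega), ← Category.assoc,
    ι_tensor_d _ _ _ _ _ _ _ rfl, Preadditive.add_comp, Linear.units_smul_comp,
    Category.assoc, Category.assoc, ι_tensorAct _ _ _ _ _ _ _ _ _ (i + p + 1) _ (by omega),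
    ι_tensorAct _ _ _ _ _ _ _ _ _ (i + p) _ rfl, Preadditive.comp_add, Linear.comp_units_smul,
    ← Category.assoc, ← comp_whiskerRight, hl]
  have hu (u : ℤˣ) {X Y : ModuleCat.{u} R} (f : X ⟶ Y) (Z : ModuleCat.{u} R) :
      (u • f) ▷ Z = u • (f ▷ Z) := by
    rcases Int.units_eq_one_or u with rfl | rfl
    · simp
    · rw [Units.neg_smul, Units.neg_smul, MulAction.one_smul, MulAction.one_smul,
        ← neg_one_smul R, MonoidalLinear.smul_whiskerRight, neg_one_smul]
  rw [MonoidalPreadditive.add_whiskerRight, hu, Preadditive.add_comp, Linear.units_smul_comp,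
    comp_whiskerRight, Category.assoc, Int.negOnePow_add, SemigroupAction.mul_smul, smul_add,
    ← whisker_exchange_assoc]
  exact add_assoc _ _ _

/-- The DG module `A ⊗_R C` for an `R`-complex `C`, with `x (y ⊗ c) = (x y) ⊗ c`. -/
noncomputable def tensor : DGModule A where
  cx := tensorObj A.cx C
  smul i j k h :=
    { toFun x := (tensorAct A C i j k h x).hom
      map_add' x y := congrArg ModuleCat.Hom.hom (tensorAct_add A C i j k h x y)
      map_smul' r x := congrArg ModuleCat.Hom.hom (tensorAct_smul A C i j k h r x) }
  one_smul i m := congrArg (fun f => f.hom m) (tensorAct_one A C i)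
  mul_smul i j k ij jk ijk hij hjk h h' x y m :=
    congrArg (fun f => f.hom m) (tensorAct_mul A C i j k ij jk ijk hij hjk h h' x y)
  leibniz i j k h x m := congrArg (fun f => f.hom m) (tensorAct_leibniz A C i j k h x)

end Tensor

end DGModule

/-!
Write `K = K(a)`. The proof rests on three observations.

*The Koszul complex is an iterated cone.* `K(a₀, …, a_e)` is the cone of multiplication by `a₀` on
`K(a₁, …, a_e)` (`koszulMulCone`), and this persists after applying `- ⊗ C` and `Hom(P, -)`. If `X`
has finitely generated homology and `b` lies in the maximal ideal, then the long exact sequence of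
the cone of `b` on `X` and Nakayama's lemma show that statements such as "`Hⁿ = 0`" and "the map is
a quasi-isomorphism" descend from the cones to the complexes (`MulCone.isZero_of_isZero`,
`MulCone.quasiIso_of_quasiIso_cone`); they ascend without any hypothesis. A `KoszulTower` organizes
the induction on the number of elements.

*The DG module `K ⊗ P` is free on `P`.* Restriction along `p ↦ 1 ⊗ p` is an isomorphism
`Hom_K(K ⊗ P, N) ≅ Hom(P, N)`. Hence `K ⊗ P` is K-projective if `P` is, and for a resolution
`π : P ⟶ C` the homothety morphism of `K ⊗ C` becomes the morphism `K ⟶ Hom(P, K ⊗ C)`,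
`x ↦ (p ↦ x ⊗ π p)`. The latter is the value at `a` of a morphism of towers whose value at the empty
sequence is the homothety morphism `R ⟶ Hom(P, C)` (`koszulHomothety`,
`quasiIso_tensorHomothety_zero_iff`). Together with the first observation this gives (a), once two
points are settled: the homothety condition does not depend on the K-projective resolution
(`DGModule.quasiIso_homothety_of_quasiIso`), and `H(Hom(P, K ⊗ C))` is degreewise finitely generated
(`finite_homology_homCx`), which holds for a resolution by finitely generated free modules that
vanish in large degrees.

*Lifting isomorphisms.* For (b), let `L ⟶ C` be such a resolution. An isomorphism `K ⊗ C ≃ K ⊗ C'`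
in the derived category yields a quasi-isomorphism `f : K ⊗ L ⟶ K ⊗ C'` of DG modules
(`DGModule.IsKProjective.exists_quasiIso`). By (a), `Hom(L, K ⊗ C') ≅ Hom_K(K ⊗ L, K ⊗ C')` is
quasi-isomorphic to `K`, so that it has no cohomology in positive degrees. By Nakayama's lemma the
same holds at each level of the tower `Hom(L, K(-) ⊗ C')`, so the obstructions to lifting a class of
degree `0` down the tower vanish (`KoszulTower.exists_of_isZero_of_pos`): `f` is homotopic to
`K ⊗ φ` for a chain map `φ : L ⟶ C'`. As `K ⊗ φ` is a quasi-isomorphism, so is `φ`.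
-/

/-! ### Cocycles and coboundaries in complexes of modules -/

section Homology

variable {R : Type u} [CommRing R]

/-- The submodule of cocycles of degree `n`. -/
def cocyc (X : CochainComplex (ModuleCat.{u} R) ℤ) (n : ℤ) : Submodule R (X.X n) :=
  LinearMap.ker (X.d n (n + 1)).hom

/-- The submodule of coboundaries of degree `n`. -/
def cobdry (X : CochainComplex (ModuleCat.{u} R) ℤ) (n : ℤ) : Submodule R (X.X n) :=
  LinearMap.range (X.d (n - 1) n).hom

variable {X Y : CochainComplex (ModuleCat.{u} R) ℤ}

lemma mem_cocyc {n m : ℤ} (h : n + 1 = m) {x : X.X n} : x ∈ cocyc X n ↔ X.d n m x = 0 := by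
  subst h
  exact Iff.rfl

lemma mem_cobdry {k n : ℤ} (h : k + 1 = n) {x : X.X n} :
    x ∈ cobdry X n ↔ ∃ y : X.X k, X.d k n y = x := by
  obtain rfl : k = n - 1 := by omega
  exact Iff.rfl

lemma d_mem_cobdry (k n : ℤ) (x : X.X k) : X.d k n x ∈ cobdry X n := by
  by_cases h : k + 1 = n
  · exact (mem_cobdry h).2 ⟨x, rfl⟩
  · rw [X.shape k n h]
    exact Submodule.zero_mem _

lemma d_d_apply (i j k : ℤ) (x : X.X i) : X.d j k (X.d i j x) = 0 := by
  rw [← ModuleCat.comp_apply, X.d_comp_d]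
  rfl

lemma hom_comm_apply (φ : X ⟶ Y) (i j : ℤ) (x : X.X i) :
    Y.d i j (φ.f i x) = φ.f j (X.d i j x) := by
  rw [← ModuleCat.comp_apply, φ.comm, ModuleCat.comp_apply]

lemma map_mem_cocyc (φ : X ⟶ Y) {n : ℤ} {x : X.X n} (hx : x ∈ cocyc X n) :
    φ.f n x ∈ cocyc Y n := by
  rw [mem_cocyc rfl] at hx ⊢
  rw [hom_comm_apply, hx, map_zero]

lemma map_mem_cobdry (φ : X ⟶ Y) {n : ℤ} {x : X.X n} (hx : x ∈ cobdry X n) :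
    φ.f n x ∈ cobdry Y n := by
  obtain ⟨y, rfl⟩ := hx
  exact (hom_comm_apply φ _ _ y) ▸ d_mem_cobdry _ _ _

/-- The cohomology class of a cocycle. -/
noncomputable def homologyClass (X : CochainComplex (ModuleCat.{u} R) ℤ) (n : ℤ) :
    cocyc X n →ₗ[R] X.homology n :=
  (X.liftCycles (ModuleCat.ofHom (cocyc X n).subtype) (n + 1) (by simp)
    (ModuleCat.hom_ext (LinearMap.ext fun x => x.2)) ≫ X.homologyπ n).hom

lemma homologyClass_map (φ : X ⟶ Y) (n : ℤ) (x : cocyc X n) :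
    HomologicalComplex.homologyMap φ n (homologyClass X n x) =
      homologyClass Y n ⟨φ.f n x, map_mem_cocyc φ x.2⟩ := by
  let g : ModuleCat.of R (cocyc X n) ⟶ ModuleCat.of R (cocyc Y n) := ModuleCat.ofHom
    ((φ.f n).hom.restrict fun x hx => map_mem_cocyc φ hx)
  have : (X.liftCycles (ModuleCat.ofHom (cocyc X n).subtype) (n + 1) (by simp)
      (ModuleCat.hom_ext (LinearMap.ext fun x => x.2)) ≫ X.homologyπ n) ≫
        HomologicalComplex.homologyMap φ n =
      g ≫ Y.liftCycles (ModuleCat.ofHom (cocyc Y n).subtype) (n + 1) (by simp)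
      (ModuleCat.hom_ext (LinearMap.ext fun x => x.2)) ≫ Y.homologyπ n := by
    rw [Category.assoc, HomologicalComplex.homologyπ_naturality, ← Category.assoc,
      ← Category.assoc]
    congr 1
    rw [← cancel_mono (Y.iCycles n)]
    simp only [Category.assoc, HomologicalComplex.cyclesMap_i,
      HomologicalComplex.liftCycles_i, HomologicalComplex.liftCycles_i_assoc]
    rfl
  exact ConcreteCategory.congr_hom this x

lemma homologyClass_surjective (X : CochainComplex (ModuleCat.{u} R) ℤ) (n : ℤ) :
    Function.Surjective (homologyClass X n) := by
  intro h
  obtain ⟨c, rfl⟩ := (ModuleCat.epi_iff_surjective (X.homologyπ n)).1 inferInstance h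
  refine ⟨⟨X.iCycles n c, ?_⟩, ?_⟩
  · rw [mem_cocyc rfl, ← ModuleCat.comp_apply, X.iCycles_d]
    rfl
  · rw [homologyClass, ModuleCat.hom_comp, LinearMap.comp_apply]
    refine congrArg (X.homologyπ n) ?_
    refine (ModuleCat.mono_iff_injective (X.iCycles n)).1 inferInstance ?_
    rw [← ModuleCat.comp_apply, HomologicalComplex.liftCycles_i]
    rfl

lemma homologyClass_eq_zero_iff (n : ℤ) (x : cocyc X n) :
    homologyClass X n x = 0 ↔ x.1 ∈ cobdry X n := by
  have hS : (ShortComplex.mk (X.toCycles (n - 1) n) (X.homologyπ n) (by simp)).Exact :=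
    ShortComplex.exact_of_g_is_cokernel _ (X.homologyIsCokernel (n - 1) n (by simp))
  rw [ShortComplex.moduleCat_exact_iff] at hS
  have hi : ∀ c : ModuleCat.of R (cocyc X n), X.iCycles n
      (X.liftCycles (ModuleCat.ofHom (cocyc X n).subtype) (n + 1) (by simp)
      (ModuleCat.hom_ext (LinearMap.ext fun x => x.2)) c) = c.1 := fun c => by
    rw [← ModuleCat.comp_apply, HomologicalComplex.liftCycles_i]
    rfl
  constructor
  · intro h
    obtain ⟨y, hy⟩ := hS _ h
    refine ⟨y, ?_⟩
    rw [← hi x, ← X.toCycles_i (n - 1) n]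
    exact congrArg (X.iCycles n) hy
  · rintro ⟨y, hy⟩
    have : X.toCycles (n - 1) n y =
        (X.liftCycles (ModuleCat.ofHom (cocyc X n).subtype) (n + 1) (by simp)
        (ModuleCat.hom_ext (LinearMap.ext fun x => x.2))) x := by
      refine (ModuleCat.mono_iff_injective (X.iCycles n)).1 inferInstance ?_
      rw [← ModuleCat.comp_apply, X.toCycles_i]
      exact hy.trans (hi x).symm
    refine (congrArg (X.homologyπ n) this).symm.trans ?_
    rw [← ModuleCat.comp_apply, X.toCycles_comp_homologyπ]
    rfl

lemma isZero_homology_iff (n : ℤ) :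
    Limits.IsZero (X.homology n) ↔ cocyc X n ≤ cobdry X n := by
  rw [ModuleCat.isZero_iff_subsingleton]
  constructor
  · intro _ x hx
    exact (homologyClass_eq_zero_iff n ⟨x, hx⟩).1 (Subsingleton.elim _ _)
  · intro h
    refine subsingleton_of_forall_eq 0 fun y => ?_
    obtain ⟨x, rfl⟩ := homologyClass_surjective X n y
    exact (homologyClass_eq_zero_iff n x).2 (h x.2)

lemma quasiIso_iff_cocyc (φ : X ⟶ Y) : QuasiIso φ ↔ ∀ n,
    (∀ x ∈ cocyc X n, φ.f n x ∈ cobdry Y n → x ∈ cobdry X n) ∧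
    ∀ y ∈ cocyc Y n, ∃ x ∈ cocyc X n, y - φ.f n x ∈ cobdry Y n := by
  rw [quasiIso_iff]
  refine forall_congr' fun n => ?_
  rw [quasiIsoAt_iff_isIso_homologyMap, ConcreteCategory.isIso_iff_bijective]
  refine and_congr ?_ ?_
  · refine (injective_iff_map_eq_zero
      (HomologicalComplex.homologyMap φ n).hom.toAddMonoidHom).trans ?_
    constructor
    · intro h x hx hx'
      refine (homologyClass_eq_zero_iff n ⟨x, hx⟩).1 (h _ ?_)
      refine (homologyClass_map φ n ⟨x, hx⟩).trans ((homologyClass_eq_zero_iff n _).2 hx')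
    · intro h y hy
      obtain ⟨x, rfl⟩ := homologyClass_surjective X n y
      refine (homologyClass_eq_zero_iff n x).2 (h x x.2 ?_)
      exact (homologyClass_eq_zero_iff n _).1 ((homologyClass_map φ n x).symm.trans hy)
  · constructor
    · intro h y hy
      obtain ⟨z, hz⟩ := h (homologyClass Y n ⟨y, hy⟩)
      obtain ⟨x, rfl⟩ := homologyClass_surjective X n z
      rw [homologyClass_map] at hz
      refine ⟨x, x.2, ?_⟩
      refine (homologyClass_eq_zero_iff n
        ((⟨y, hy⟩ : cocyc Y n) - (⟨φ.f n x, map_mem_cocyc φ x.2⟩ : cocyc Y n))).1 ?_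
      rw [map_sub, hz, sub_self]
    · intro h z
      obtain ⟨y, rfl⟩ := homologyClass_surjective Y n z
      obtain ⟨x, hx, hxy⟩ := h y y.2
      refine ⟨homologyClass X n ⟨x, hx⟩, ?_⟩
      rw [homologyClass_map, ← sub_eq_zero, ← map_sub, homologyClass_eq_zero_iff]
      rw [← neg_mem_iff]
      simpa using hxy

lemma finite_homology_of_finite [IsNoetherianRing R] (n : ℤ) [Module.Finite R (X.X n)] :
    Module.Finite R (X.homology n) :=
  Module.Finite.of_surjective _ (homologyClass_surjective X n)

lemma finite_homology_of_quasiIso (φ : X ⟶ Y) [QuasiIso φ] (n : ℤ)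
    [Module.Finite R (X.homology n)] : Module.Finite R (Y.homology n) :=
  Module.Finite.equiv (asIso (HomologicalComplex.homologyMap φ n)).toLinearEquiv

lemma finite_homology_of_quasiIso' (φ : X ⟶ Y) [QuasiIso φ] (n : ℤ)
    [Module.Finite R (Y.homology n)] : Module.Finite R (X.homology n) :=
  Module.Finite.equiv (asIso (HomologicalComplex.homologyMap φ n)).toLinearEquiv.symm

/-- Nakayama's lemma for submodules of a finitely generated homology module, in terms of
cocycles. -/
lemma le_cobdry_of_le_smul [IsNoetherianRing R] [IsLocalRing R] {b : R}
    (hb : b ∈ IsLocalRing.maximalIdeal R) {n : ℤ} [Module.Finite R (X.homology n)]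
    (S : Submodule R (X.X n)) (hS : S ≤ cocyc X n)
    (h : ∀ x ∈ S, ∃ y ∈ S, x - b • y ∈ cobdry X n) : S ≤ cobdry X n := by
  let N : Submodule R (X.homology n) :=
    (S.comap (cocyc X n).subtype).map (homologyClass X n)
  have hN : N ≤ ⊥ := by
    refine Submodule.le_of_le_smul_of_le_jacobson_bot (I := IsLocalRing.maximalIdeal R)
      (IsNoetherian.noetherian N) (IsLocalRing.maximalIdeal_le_jacobson _) ?_
    rintro _ ⟨⟨x, hx⟩, hxS, rfl⟩
    obtain ⟨y, hy, hxy⟩ := h x hxS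
    have e : homologyClass X n ⟨x, hx⟩ = b • homologyClass X n ⟨y, hS hy⟩ := by
      rw [← sub_eq_zero, ← map_smul, ← map_sub, homologyClass_eq_zero_iff]
      exact hxy
    rw [e]
    exact Submodule.mem_sup_right (Submodule.smul_mem_smul hb ⟨⟨y, hS hy⟩, hy, rfl⟩)
  intro x hx
  exact (homologyClass_eq_zero_iff n ⟨x, hS hx⟩).1 (hN ⟨⟨x, hS hx⟩, hx, rfl⟩)

end Homology

/-! ### Cones of multiplication by a ring element -/

section MulCone

variable {R : Type u} [CommRing R]

/-- The structure on `Y` of a mapping cone of multiplication by `b` on `X`, given by the inclusion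
`incl` of `X`, the projection `proj` onto the shift of `X`, and a splitting `sec`, `ret` of the
resulting degreewise exact sequence; the differential of `Y` is pinned by `δ sec = b • incl`.
Everything is phrased with cochains, so that it is preserved by DG functors. -/
structure MulCone (b : R) (X Y : CochainComplex (ModuleCat.{u} R) ℤ) where
  /-- the inclusion of `X` in the cone -/
  incl : X ⟶ Y
  /-- the projection onto the shift of `X` -/
  proj : Cochain Y X 1
  /-- a degreewise section of `proj` -/
  sec : Cochain X Y (-1)
  /-- a degreewise retraction of `incl` -/
  ret : Cochain Y X 0
  sec_proj : sec.comp proj (neg_add_cancel 1) = Cochain.ofHom (𝟙 X)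
  incl_ret : (Cochain.ofHom incl).comp ret (add_zero 0) = Cochain.ofHom (𝟙 X)
  incl_proj : (Cochain.ofHom incl).comp proj (zero_add 1) = 0
  decomp : proj.comp sec (add_neg_cancel 1) + ret.comp (Cochain.ofHom incl) (add_zero 0) =
    Cochain.ofHom (𝟙 Y)
  δ_sec : δ (-1) 0 sec = b • Cochain.ofHom incl

namespace MulCone

variable {b : R} {X Y X' Y' : CochainComplex (ModuleCat.{u} R) ℤ}

section

variable (c : MulCone b X Y)

lemma proj_sec_apply (n m : ℤ) (h : n + 1 = m) (x : X.X m) :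
    c.proj.v n m h (c.sec.v m n (by omega) x) = x := by
  have := Cochain.congr_v c.sec_proj m m (add_zero m)
  rw [Cochain.comp_v _ _ _ m n m (by omega) h, Cochain.ofHom_v] at this
  exact ConcreteCategory.congr_hom this x

lemma ret_incl_apply (n : ℤ) (x : X.X n) :
    c.ret.v n n (add_zero n) (c.incl.f n x) = x := by
  have := Cochain.congr_v c.incl_ret n n (add_zero n)
  rw [Cochain.comp_zero_cochain_v, Cochain.ofHom_v, Cochain.ofHom_v] at this
  exact ConcreteCategory.congr_hom this x

lemma proj_incl_apply (n m : ℤ) (h : n + 1 = m) (x : X.X n) :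
    c.proj.v n m h (c.incl.f n x) = 0 := by
  have := Cochain.congr_v c.incl_proj n m h
  rw [Cochain.zero_cochain_comp_v, Cochain.ofHom_v] at this
  exact ConcreteCategory.congr_hom this x

lemma decomp_apply (n m : ℤ) (h : n + 1 = m) (y : Y.X n) :
    c.sec.v m n (by omega) (c.proj.v n m h y) + c.incl.f n (c.ret.v n n (add_zero n) y) = y := by
  have := Cochain.congr_v c.decomp n n (add_zero n)
  rw [Cochain.add_v, Cochain.comp_v _ _ _ n m n h (by omega), Cochain.comp_zero_cochain_v,
    Cochain.ofHom_v, Cochain.ofHom_v] at this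
  exact ConcreteCategory.congr_hom this y

lemma d_sec_apply (n m l : ℤ) (h : n + 1 = m) (h' : m + 1 = l) (x : X.X m) :
    Y.d n m (c.sec.v m n (by omega) x) =
      b • c.incl.f m x - c.sec.v l m (by omega) (X.d m l x) := by
  have := Cochain.congr_v c.δ_sec m m (add_zero m)
  rw [δ_v (-1) 0 rfl _ m m (add_zero m) n l (by omega) h', Cochain.smul_v, Cochain.ofHom_v] at this
  have := ConcreteCategory.congr_hom this x
  simp only [Int.negOnePow_zero, one_smul] at this
  exact eq_sub_of_add_eq this

lemma incl_injective (n : ℤ) : Function.Injective (c.incl.f n) := fun x y h => by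
  rw [← c.ret_incl_apply n x, h, c.ret_incl_apply]

/-- The projection is a morphism to the shift of `X`, whence the sign. -/
lemma proj_d_apply (n m l : ℤ) (h : n + 1 = m) (h' : m + 1 = l) (y : Y.X n) :
    c.proj.v m l h' (Y.d n m y) = - X.d m l (c.proj.v n m h y) := by
  conv_lhs => rw [← c.decomp_apply n m h y]
  rw [map_add, c.d_sec_apply n m l h h', hom_comm_apply, map_add, map_sub, map_smul,
    c.proj_incl_apply, c.proj_incl_apply, c.proj_sec_apply m l h', smul_zero, zero_sub, add_zero]

variable {n m : ℤ} (h : n + 1 = m)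

lemma proj_mem_cocyc {y : Y.X n} (hy : y ∈ cocyc Y n) : c.proj.v n m h y ∈ cocyc X m := by
  rw [mem_cocyc h] at hy
  rw [mem_cocyc rfl, ← neg_eq_zero, ← c.proj_d_apply n m _ h rfl, hy, map_zero]

lemma proj_mem_cobdry {y : Y.X n} (hy : y ∈ cobdry Y n) : c.proj.v n m h y ∈ cobdry X m := by
  obtain ⟨z, rfl⟩ := (mem_cobdry (sub_add_cancel n 1)).1 hy
  rw [c.proj_d_apply (n - 1) n m (by omega) h]
  exact neg_mem (d_mem_cobdry _ _ _)

lemma incl_smul_mem_cobdry {x : X.X n} (hx : x ∈ cocyc X n) :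
    b • c.incl.f n x ∈ cobdry Y n := by
  rw [mem_cocyc rfl] at hx
  have := c.d_sec_apply (n - 1) n (n + 1) (by omega) rfl x
  rw [hx, map_zero, sub_zero] at this
  exact this ▸ d_mem_cobdry _ _ _

lemma exists_of_incl_mem_cobdry {x : X.X n} (hi : c.incl.f n x ∈ cobdry Y n) :
    ∃ x' ∈ cocyc X n, x - b • x' ∈ cobdry X n := by
  obtain ⟨y, hy⟩ := (mem_cobdry (sub_add_cancel n 1)).1 hi
  have hp := c.proj_d_apply (n - 1) n (n + 1) (by omega) rfl y
  rw [hy, c.proj_incl_apply, eq_comm, neg_eq_zero] at hp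
  refine ⟨c.proj.v (n - 1) n (by omega) y, (mem_cocyc rfl).2 hp, ?_⟩
  rw [← c.decomp_apply (n - 1) n (by omega) y, map_add,
    c.d_sec_apply (n - 1) n (n + 1) (by omega) rfl, hp, map_zero, sub_zero, hom_comm_apply,
    ← map_smul, ← map_add] at hy
  rw [← c.incl_injective n hy, add_sub_cancel_left]
  exact d_mem_cobdry _ _ _

lemma exists_of_proj_mem_cobdry {y : Y.X n} (hy : y ∈ cocyc Y n)
    (hp : c.proj.v n m h y ∈ cobdry X m) : ∃ x ∈ cocyc X n, y - c.incl.f n x ∈ cobdry Y n := by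
  obtain ⟨z, hz⟩ := (mem_cobdry h).1 hp
  have hd := c.d_sec_apply (n - 1) n m (by omega) h z
  have hy' := c.decomp_apply n m h y
  have e : y - c.incl.f n (c.ret.v n n (add_zero n) y + b • z) =
      - Y.d (n - 1) n (c.sec.v n (n - 1) (by omega) z) := by
    rw [hd, hz, map_add, map_smul]
    nth_rewrite 1 [← hy']
    abel
  refine ⟨c.ret.v n n (add_zero n) y + b • z, ?_, e ▸ neg_mem (d_mem_cobdry _ _ _)⟩
  rw [mem_cocyc h] at hy ⊢
  apply c.incl_injective
  rw [← hom_comm_apply, ← sub_sub_cancel y (c.incl.f n _), e, map_sub, map_neg, d_d_apply, hy,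
    map_zero]
  simp

lemma smul_proj_mem_cobdry {y : Y.X n} (hy : y ∈ cocyc Y n) :
    b • c.proj.v n m h y ∈ cobdry X m := by
  have hp := c.proj_mem_cocyc h hy
  rw [mem_cocyc rfl] at hp
  rw [mem_cocyc h, ← c.decomp_apply n m h y, map_add, c.d_sec_apply n m _ h rfl, hp, map_zero,
    sub_zero, hom_comm_apply, ← map_smul, ← map_add] at hy
  rw [eq_neg_of_add_eq_zero_left (c.incl_injective m (hy.trans (map_zero _).symm))]
  exact neg_mem (d_mem_cobdry _ _ _)

lemma exists_proj_eq {x : X.X m} (hx : x ∈ cocyc X m) (hb : b • x ∈ cobdry X m) :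
    ∃ y ∈ cocyc Y n, c.proj.v n m h y = x := by
  obtain ⟨z, hz⟩ := (mem_cobdry h).1 hb
  rw [mem_cocyc rfl] at hx
  refine ⟨c.sec.v m n (by omega) x - c.incl.f n z, ?_, ?_⟩
  · rw [mem_cocyc h, map_sub, c.d_sec_apply n m _ h rfl, hx, map_zero, sub_zero, hom_comm_apply,
      hz, map_smul, sub_self]
  · rw [map_sub, c.proj_sec_apply n m h, c.proj_incl_apply, sub_zero]

/-- If `Y` has no homology in degree `n`, then multiplication by `b` is surjective on `Hⁿ(X)`, and
Nakayama's lemma applies. -/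
lemma isZero_of_isZero (c : MulCone b X Y) [IsNoetherianRing R] [IsLocalRing R]
    (hb : b ∈ IsLocalRing.maximalIdeal R) [Module.Finite R (X.homology n)]
    (hY : Limits.IsZero (Y.homology n)) : Limits.IsZero (X.homology n) := by
  rw [isZero_homology_iff] at hY ⊢
  exact le_cobdry_of_le_smul hb _ le_rfl fun x hx =>
    c.exists_of_incl_mem_cobdry (hY (map_mem_cocyc c.incl hx))

lemma isZero_cone (c : MulCone b X Y) (h : n + 1 = m) (hn : Limits.IsZero (X.homology n))
    (hm : Limits.IsZero (X.homology m)) : Limits.IsZero (Y.homology n) := by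
  rw [isZero_homology_iff] at hn hm ⊢
  intro y hy
  obtain ⟨x, hx, hxy⟩ := c.exists_of_proj_mem_cobdry h hy (hm (c.proj_mem_cocyc h hy))
  exact (Submodule.sub_mem_iff_left _ (map_mem_cobdry c.incl (hn hx))).1 hxy

lemma exists_incl_of_isZero (c : MulCone b X Y) (h : n + 1 = m)
    (hm : Limits.IsZero (X.homology m)) {y : Y.X n} (hy : y ∈ cocyc Y n) :
    ∃ x ∈ cocyc X n, y - c.incl.f n x ∈ cobdry Y n := by
  rw [isZero_homology_iff] at hm
  exact c.exists_of_proj_mem_cobdry h hy (hm (c.proj_mem_cocyc h hy))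

lemma finite_homology_cone (c : MulCone b X Y) [IsNoetherianRing R] (h : n + 1 = m)
    [Module.Finite R (X.homology n)] [Module.Finite R (X.homology m)] :
    Module.Finite R (Y.homology n) := by
  let q : cocyc Y n →ₗ[R] X.homology m := (homologyClass X m).comp
    ((c.proj.v n m h).hom.restrict fun y hy => c.proj_mem_cocyc h hy)
  have hk : LinearMap.ker (homologyClass Y n) ≤ LinearMap.ker q := by
    intro y hy
    refine (homologyClass_eq_zero_iff m _).2 ?_
    exact c.proj_mem_cobdry h ((homologyClass_eq_zero_iff n y).1 hy)
  let e := (homologyClass Y n).quotKerEquivOfSurjective (homologyClass_surjective Y n)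
  let g : Y.homology n →ₗ[R] X.homology m := (Submodule.liftQ _ q hk).comp e.symm.toLinearMap
  have hg : ∀ y, g (homologyClass Y n y) = q y := fun y => by
    have : e.symm (homologyClass Y n y) = Submodule.Quotient.mk y :=
      (LinearEquiv.symm_apply_eq _).2 rfl
    change Submodule.liftQ _ q hk (e.symm (homologyClass Y n y)) = q y
    rw [this]
    rfl
  have : IsNoetherian R (Y.homology n) := by
    refine isNoetherian_of_range_eq_ker (HomologicalComplex.homologyMap c.incl n).hom g ?_
    apply le_antisymm
    · rintro _ ⟨x, rfl⟩
      obtain ⟨x, rfl⟩ := homologyClass_surjective X n x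
      refine (congrArg g (homologyClass_map c.incl n x)).trans ((hg _).trans ?_)
      refine (homologyClass_eq_zero_iff m _).2 ?_
      change c.proj.v n m h (c.incl.f n x.1) ∈ cobdry X m
      rw [c.proj_incl_apply]
      exact Submodule.zero_mem _
    · intro z hz
      obtain ⟨y, rfl⟩ := homologyClass_surjective Y n z
      have hz := (homologyClass_eq_zero_iff m _).1 ((hg y).symm.trans hz)
      obtain ⟨x, hx, hxy⟩ := c.exists_of_proj_mem_cobdry h y.2 hz
      refine ⟨homologyClass X n ⟨x, hx⟩, ?_⟩
      refine (homologyClass_map c.incl n ⟨x, hx⟩).trans ?_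
      rw [eq_comm, ← sub_eq_zero, ← map_sub, homologyClass_eq_zero_iff]
      exact hxy
  infer_instance

end

variable {c : MulCone b X Y} {c' : MulCone b X' Y'}

/-- A morphism of cones of multiplication by `b` is a quasi-isomorphism if its restriction to the
base is one. -/
lemma quasiIso_cone {φ : X ⟶ X'} {ψ : Y ⟶ Y'} (hi : c.incl ≫ ψ = φ ≫ c'.incl)
    (hp : ∀ (n m : ℤ) (h : n + 1 = m), c.proj.v n m h ≫ φ.f m = ψ.f n ≫ c'.proj.v n m h)
    (hφ : QuasiIso φ) : QuasiIso ψ := by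
  rw [quasiIso_iff_cocyc] at hφ ⊢
  have hi' : ∀ n x, ψ.f n (c.incl.f n x) = c'.incl.f n (φ.f n x) := fun n x =>
    ConcreteCategory.congr_hom (HomologicalComplex.congr_hom hi n) x
  have hp' : ∀ n y, φ.f (n + 1) (c.proj.v n (n + 1) rfl y) = c'.proj.v n (n + 1) rfl (ψ.f n y) :=
    fun n y => ConcreteCategory.congr_hom (hp n _ rfl) y
  refine fun n => ⟨fun y hy hψ => ?_, fun y hy => ?_⟩
  · have h1 := (hφ (n + 1)).1 _ (c.proj_mem_cocyc rfl hy) (hp' n y ▸ c'.proj_mem_cobdry rfl hψ)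
    obtain ⟨x, hx, hxy⟩ := c.exists_of_proj_mem_cobdry rfl hy h1
    have h2 : c'.incl.f n (φ.f n x) ∈ cobdry Y' n := by
      have := map_mem_cobdry ψ hxy
      rw [map_sub, Submodule.sub_mem_iff_right _ hψ, hi'] at this
      exact this
    obtain ⟨z, hz, hzx⟩ := c'.exists_of_incl_mem_cobdry h2
    obtain ⟨w, hw, hwz⟩ := (hφ n).2 z hz
    have h3 : x - b • w ∈ cobdry X n := by
      refine (hφ n).1 _ (sub_mem hx (Submodule.smul_mem _ _ hw)) ?_
      have := add_mem hzx (Submodule.smul_mem _ b hwz)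
      rw [map_sub, map_smul]
      convert this using 1
      module
    have h4 := add_mem (map_mem_cobdry c.incl h3) (c.incl_smul_mem_cobdry hw)
    rw [map_sub, map_smul, sub_add_cancel] at h4
    exact (Submodule.sub_mem_iff_left _ h4).1 hxy
  · obtain ⟨x, hx, hxy⟩ := (hφ (n + 1)).2 _ (c'.proj_mem_cocyc rfl hy)
    have h1 : b • x ∈ cobdry X (n + 1) := by
      refine (hφ (n + 1)).1 _ (Submodule.smul_mem _ _ hx) ?_
      have := sub_mem (c'.smul_proj_mem_cobdry rfl hy) (Submodule.smul_mem _ b hxy)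
      rw [map_smul]
      convert this using 1
      module
    obtain ⟨z, hz, rfl⟩ := c.exists_proj_eq rfl hx h1
    rw [hp', ← map_sub] at hxy
    obtain ⟨w, hw, hwy⟩ := c'.exists_of_proj_mem_cobdry rfl (sub_mem hy (map_mem_cocyc ψ hz)) hxy
    obtain ⟨v, hv, hvw⟩ := (hφ n).2 w hw
    refine ⟨z + c.incl.f n v, add_mem hz (map_mem_cocyc _ hv), ?_⟩
    have := add_mem hwy (map_mem_cobdry c'.incl hvw)
    rw [map_sub, ← hi'] at this
    rw [map_add]
    convert this using 1
    module

/-- Over a noetherian local ring and for `b` in the maximal ideal, a morphism of cones of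
multiplication by `b` is a quasi-isomorphism only if its restriction to the base is one, by
Nakayama's lemma for the kernel and the cokernel in homology. -/
lemma quasiIso_of_quasiIso_cone [IsNoetherianRing R] [IsLocalRing R]
    (hb : b ∈ IsLocalRing.maximalIdeal R)
    {φ : X ⟶ X'} {ψ : Y ⟶ Y'} (hi : c.incl ≫ ψ = φ ≫ c'.incl)
    (hp : ∀ (n m : ℤ) (h : n + 1 = m), c.proj.v n m h ≫ φ.f m = ψ.f n ≫ c'.proj.v n m h)
    (hX : HomologicallyDegreewiseFinite X) (hX' : HomologicallyDegreewiseFinite X')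
    (hψ : QuasiIso ψ) : QuasiIso φ := by
  rw [quasiIso_iff_cocyc] at hψ ⊢
  have hi' : ∀ n x, ψ.f n (c.incl.f n x) = c'.incl.f n (φ.f n x) := fun n x =>
    ConcreteCategory.congr_hom (HomologicalComplex.congr_hom hi n) x
  have hp' : ∀ n m h y, φ.f m (c.proj.v n m h y) = c'.proj.v n m h (ψ.f n y) :=
    fun n m h y => ConcreteCategory.congr_hom (hp n m h) y
  have hinj : ∀ n, ∀ x ∈ cocyc X n, φ.f n x ∈ cobdry X' n → x ∈ cobdry X n := by
    intro n x hx hφ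
    have := hX n
    refine le_cobdry_of_le_smul (X := X) hb (cocyc X n ⊓ (cobdry X' n).comap (φ.f n).hom)
      inf_le_left ?_ ⟨hx, hφ⟩
    rintro x ⟨hx, hφ⟩
    replace hφ : φ.f n x ∈ cobdry X' n := hφ
    have h1 : c.incl.f n x ∈ cobdry Y n :=
      (hψ n).1 _ (map_mem_cocyc _ hx) (hi' n x ▸ map_mem_cobdry _ hφ)
    obtain ⟨z, hz, hzx⟩ := c.exists_of_incl_mem_cobdry h1
    have h2 : b • φ.f n z ∈ cobdry X' n := by
      have := map_mem_cobdry φ hzx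
      rw [map_sub, Submodule.sub_mem_iff_right _ hφ, map_smul] at this
      exact this
    obtain ⟨y, hy, hyz⟩ := c'.exists_proj_eq (sub_add_cancel n 1) (map_mem_cocyc φ hz) h2
    obtain ⟨v, hv, hvy⟩ := (hψ (n - 1)).2 y hy
    refine ⟨z - c.proj.v (n - 1) n (by omega) v,
      ⟨sub_mem hz (c.proj_mem_cocyc _ hv), ?_⟩, ?_⟩
    · have := c'.proj_mem_cobdry (sub_add_cancel n 1) hvy
      rw [map_sub, ← hp', hyz, ← map_sub] at this
      exact this
    · have := add_mem hzx (c.smul_proj_mem_cobdry (sub_add_cancel n 1) hv)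
      convert this using 1
      module
  refine fun n => ⟨hinj n, fun x hx => ?_⟩
  have := hX' n
  -- cocycles of `X'` homologous to the image of a cocycle form the cokernel to be annihilated
  let S : Submodule R (X'.X n) := cobdry X' n ⊔ (cocyc X n).map (φ.f n).hom
  have hS : ∀ y ∈ cocyc X' n, ∃ z ∈ cocyc X' n, y - b • z ∈ S := by
    intro y hy
    obtain ⟨v, hv, hvy⟩ := (hψ n).2 _ (map_mem_cocyc c'.incl hy)
    have h1 : c.proj.v n (n + 1) rfl v ∈ cobdry X (n + 1) := by
      refine hinj _ _ (c.proj_mem_cocyc rfl hv) ?_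
      have := c'.proj_mem_cobdry rfl hvy
      rw [map_sub, c'.proj_incl_apply, zero_sub, neg_mem_iff, ← hp'] at this
      exact this
    obtain ⟨w, hw, hwv⟩ := c.exists_of_proj_mem_cobdry rfl hv h1
    have h2 : c'.incl.f n (y - φ.f n w) ∈ cobdry Y' n := by
      have := add_mem hvy (map_mem_cobdry ψ hwv)
      rw [map_sub, hi', sub_add_sub_cancel, ← map_sub] at this
      exact this
    obtain ⟨z, hz, hzx⟩ := c'.exists_of_incl_mem_cobdry h2
    refine ⟨z, hz, ?_⟩
    have := add_mem (Submodule.mem_sup_left hzx : _ ∈ S)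
      (Submodule.mem_sup_right ⟨w, hw, rfl⟩ : φ.f n w ∈ S)
    convert this using 1
    module
  have hle : (⊤ : Submodule R (X'.homology n)) ≤
      (S.comap (cocyc X' n).subtype).map (homologyClass X' n) := by
    refine Submodule.le_of_le_smul_of_le_jacobson_bot (I := IsLocalRing.maximalIdeal R)
      (IsNoetherian.noetherian _) (IsLocalRing.maximalIdeal_le_jacobson _) ?_
    intro q _
    obtain ⟨⟨y, hy⟩, rfl⟩ := homologyClass_surjective X' n q
    obtain ⟨z, hz, hzy⟩ := hS y hy
    have e : homologyClass X' n ⟨y, hy⟩ =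
        homologyClass X' n ⟨y - b • z, sub_mem hy (Submodule.smul_mem _ _ hz)⟩ +
          b • homologyClass X' n ⟨z, hz⟩ := by
      rw [← map_smul, ← map_add]
      congr 1
      exact Subtype.ext (sub_add_cancel y (b • z)).symm
    rw [e]
    exact add_mem (Submodule.mem_sup_left ⟨_, hzy, rfl⟩)
      (Submodule.mem_sup_right (Submodule.smul_mem_smul hb Submodule.mem_top))
  obtain ⟨⟨y, hy⟩, hyS, hyx⟩ := hle (Submodule.mem_top (x := homologyClass X' n ⟨x, hx⟩))
  obtain ⟨t, ht, _, ⟨w, hw, rfl⟩, hyt⟩ := Submodule.mem_sup.1 hyS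
  rw [← sub_eq_zero, ← map_sub, homologyClass_eq_zero_iff] at hyx
  refine ⟨w, hw, ?_⟩
  have := sub_mem ht hyx
  convert this using 1
  change x - (φ.f n).hom w = t - (y - x)
  rw [show y = t + (φ.f n).hom w from hyt.symm]
  abel

end MulCone

end MulCone

/-! ### Tensor products of complexes, elementwise -/

section Tensor

open MonoidalCategory hiding tensorObj
open HomologicalComplex (tensorObj ιTensorObj mapBifunctorDesc mapBifunctor)

variable {R : Type u} [CommRing R]

lemma modHom_add_apply {M N : ModuleCat.{u} R} (f g : M ⟶ N) (x : M) : (f + g) x = f x + g x :=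
  rfl

lemma modHom_smul_apply {M N : ModuleCat.{u} R} (b : R) (f : M ⟶ N) (x : M) :
    (b • f) x = b • f x := rfl

lemma modHom_units_smul_apply {M N : ModuleCat.{u} R} (b : ℤˣ) (f : M ⟶ N) (x : M) :
    (b • f) x = b • f x := rfl

/-- The element `x ⊗ c` of the tensor product of two complexes, as a bilinear map. -/
noncomputable def tmul (K C : CochainComplex (ModuleCat.{u} R) ℤ) (p q n : ℤ) (h : p + q = n) :
    K.X p →ₗ[R] C.X q →ₗ[R] (tensorObj K C).X n :=
  (TensorProduct.mk R (K.X p) (C.X q)).compr₂ (ιTensorObj K C p q n h).hom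

variable {K K' K'' C C' : CochainComplex (ModuleCat.{u} R) ℤ}

lemma ι_hom_ext {p q n : ℤ} {h : p + q = n} {V : ModuleCat.{u} R}
    {f g : (tensorObj K C).X n ⟶ V} (hfg : ∀ x c, f (tmul K C p q n h x c) =
      g (tmul K C p q n h x c)) : ιTensorObj K C p q n h ≫ f = ιTensorObj K C p q n h ≫ g :=
  ModuleCat.hom_ext (TensorProduct.ext' hfg)

lemma tmul_hom_ext {n : ℤ} {V : ModuleCat.{u} R} {f g : (tensorObj K C).X n ⟶ V}
    (hfg : ∀ p q h x c, f (tmul K C p q n h x c) = g (tmul K C p q n h x c)) : f = g :=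
  HomologicalComplex.mapBifunctor.hom_ext fun p q h => ι_hom_ext (hfg p q h)

/-- The map out of a tensor product of complexes given in each bidegree by a bilinear map. -/
noncomputable def tensorDesc {n : ℤ} {V : ModuleCat.{u} R}
    (φ : ∀ p q : ℤ, p + q = n → K.X p →ₗ[R] C.X q →ₗ[R] V) : (tensorObj K C).X n ⟶ V :=
  mapBifunctorDesc fun p q h => ModuleCat.ofHom (TensorProduct.lift (φ p q h))

lemma tensorDesc_tmul {n : ℤ} {V : ModuleCat.{u} R}
    (φ : ∀ p q : ℤ, p + q = n → K.X p →ₗ[R] C.X q →ₗ[R] V) (p q : ℤ) (h : p + q = n)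
    (x : K.X p) (c : C.X q) : tensorDesc φ (tmul K C p q n h x c) = φ p q h x c := by
  have : ιTensorObj K C p q n h ≫ tensorDesc φ = ModuleCat.ofHom (TensorProduct.lift (φ p q h)) :=
    HomologicalComplex.ι_mapBifunctorDesc _ _ _ _
  exact (ConcreteCategory.congr_hom this (x ⊗ₜ[R] c)).trans (TensorProduct.lift.tmul x c)

lemma d_tmul (p p' q q' n n' : ℤ) (h : p + q = n) (hp : p + 1 = p') (hq : q + 1 = q')
    (hn : n + 1 = n') (x : K.X p) (c : C.X q) :
    (tensorObj K C).d n n' (tmul K C p q n h x c) =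
      tmul K C p' q n' (by omega) (K.d p p' x) c +
        p.negOnePow • tmul K C p q' n' (by omega) x (C.d q q' c) := by
  subst hp hq
  have : ιTensorObj K C p q n h ≫ (tensorObj K C).d n n' =
      K.d p (p + 1) ▷ C.X q ≫ ιTensorObj K C (p + 1) q n' (by omega) +
        p.negOnePow • (K.X p ◁ C.d q (q + 1) ≫ ιTensorObj K C p (q + 1) n' (by omega)) := by
    subst hn
    rw [HomologicalComplex.mapBifunctor.d_eq, Preadditive.comp_add,
      HomologicalComplex.mapBifunctor.ι_D₁, HomologicalComplex.mapBifunctor.ι_D₂,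
      HomologicalComplex.mapBifunctor.d₁_eq _ _ _ _
        (show (ComplexShape.up ℤ).Rel p (p + 1) from rfl) _ _ (by change p + 1 + q = n + 1; omega),
      HomologicalComplex.mapBifunctor.d₂_eq _ _ _ _ _
        (show (ComplexShape.up ℤ).Rel q (q + 1) from rfl) _ (by change p + (q + 1) = n + 1; omega)]
    simp
  exact ConcreteCategory.congr_hom this (x ⊗ₜ[R] c)

/-- The cochain `f ⊗ C` for a cochain `f` of complexes. -/
noncomputable def tensorCochain (C : CochainComplex (ModuleCat.{u} R) ℤ) {t : ℤ}
    (f : Cochain K K' t) : Cochain (tensorObj K C) (tensorObj K' C) t :=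
  Cochain.mk fun n m h => tensorDesc fun p q hpq =>
    (tmul K' C (p + t) q m (by omega)).comp (f.v p (p + t) rfl).hom

lemma tensorCochain_tmul {t : ℤ} (f : Cochain K K' t) (p p' q n m : ℤ) (h : n + t = m)
    (hpq : p + q = n) (hp : p + t = p') (x : K.X p) (c : C.X q) :
    (tensorCochain C f).v n m h (tmul K C p q n hpq x c) =
      tmul K' C p' q m (by omega) (f.v p p' hp x) c := by
  subst hp
  rw [tensorCochain, Cochain.mk_v, tensorDesc_tmul]
  rfl

lemma tensorCochain_add {t : ℤ} (f g : Cochain K K' t) :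
    tensorCochain C (f + g) = tensorCochain C f + tensorCochain C g := by
  ext1 n m h
  refine tmul_hom_ext fun p q hpq x c => ?_
  rw [Cochain.add_v, modHom_add_apply,
    tensorCochain_tmul _ p _ q n m h hpq rfl,
    tensorCochain_tmul _ p _ q n m h hpq rfl, tensorCochain_tmul _ p _ q n m h hpq rfl,
    Cochain.add_v, modHom_add_apply, map_add, LinearMap.add_apply]

lemma tensorCochain_smul {t : ℤ} (b : R) (f : Cochain K K' t) :
    tensorCochain C (b • f) = b • tensorCochain C f := by
  ext1 n m h
  refine tmul_hom_ext fun p q hpq x c => ?_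
  rw [Cochain.smul_v, modHom_smul_apply,
    tensorCochain_tmul _ p _ q n m h hpq rfl, tensorCochain_tmul _ p _ q n m h hpq rfl,
    Cochain.smul_v, modHom_smul_apply, map_smul, LinearMap.smul_apply]

lemma tensorCochain_zero {t : ℤ} : tensorCochain C (0 : Cochain K K' t) = 0 := by
  have := tensorCochain_smul (C := C) 0 (0 : Cochain K K' t)
  rwa [zero_smul, zero_smul] at this

lemma tensorCochain_comp {s t k : ℤ} (f : Cochain K K' s) (g : Cochain K' K'' t) (h : s + t = k) :
    tensorCochain C (f.comp g h) = (tensorCochain C f).comp (tensorCochain C g) h := by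
  ext1 n m hnm
  refine tmul_hom_ext fun p q hpq x c => ?_
  rw [Cochain.comp_v _ _ h n (n + s) m rfl (by omega), ModuleCat.comp_apply,
    tensorCochain_tmul f p (p + s) q n _ rfl hpq rfl,
    tensorCochain_tmul g (p + s) (p + k) q _ m _ _ (by omega),
    tensorCochain_tmul (f.comp g h) p (p + k) q n m hnm hpq rfl,
    Cochain.comp_v _ _ h p (p + s) (p + k) rfl (by omega), ModuleCat.comp_apply]

lemma tensorCochain_δ {s t : ℤ} (f : Cochain K K' s) (h : s + 1 = t) :
    δ s t (tensorCochain C f) = tensorCochain C (δ s t f) := by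
  ext1 n m hnm
  refine tmul_hom_ext fun p q hpq x c => ?_
  have hs : (p + s).negOnePow = - (t.negOnePow * p.negOnePow) := by
    rw [← h, Int.negOnePow_add, Int.negOnePow_succ, neg_mul, neg_neg, mul_comm]
  rw [δ_v s t h _ n m hnm (n + s) (n + 1) (by omega) rfl,
    tensorCochain_tmul _ p (p + t) q n m hnm hpq rfl,
    δ_v s t h _ p (p + t) rfl (p + s) (p + 1) (by omega) rfl,
    modHom_add_apply, modHom_add_apply, modHom_units_smul_apply, modHom_units_smul_apply,
    ModuleCat.comp_apply, ModuleCat.comp_apply, ModuleCat.comp_apply, ModuleCat.comp_apply,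
    tensorCochain_tmul f p (p + s) q n (n + s) rfl hpq rfl,
    d_tmul p (p + 1) q (q + 1) n (n + 1) hpq rfl rfl rfl,
    d_tmul (p + s) (p + t) q (q + 1) (n + s) m (by omega) (by omega) rfl (by omega),
    map_add, Units.smul_def p.negOnePow, map_zsmul,
    tensorCochain_tmul f (p + 1) (p + t) q (n + 1) m (by omega) (by omega) (by omega),
    tensorCochain_tmul f p (p + s) (q + 1) (n + 1) m (by omega) (by omega) (by omega),
    map_add, LinearMap.add_apply, Units.smul_def t.negOnePow, Units.smul_def t.negOnePow,
    map_zsmul, LinearMap.smul_apply, hs, Units.smul_def, Units.val_neg, Units.val_mul, smul_add,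
    smul_smul, neg_smul]
  abel

/-- The chain map `f ⊗ C` for a chain map `f`. -/
noncomputable def tensorMapLeft (C : CochainComplex (ModuleCat.{u} R) ℤ) (f : K ⟶ K') :
    tensorObj K C ⟶ tensorObj K' C :=
  Cocycle.homOf (Cocycle.mk (tensorCochain C (Cochain.ofHom f)) 1 rfl (by
    rw [tensorCochain_δ _ (by omega), δ_ofHom, tensorCochain_zero]))

lemma ofHom_tensorMapLeft (f : K ⟶ K') :
    Cochain.ofHom (tensorMapLeft C f) = tensorCochain C (Cochain.ofHom f) :=
  congrArg Subtype.val (Cocycle.ofHom_homOf_eq_self (Cocycle.mk (tensorCochain C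
    (Cochain.ofHom f)) 1 rfl _))

lemma tensorMapLeft_tmul (f : K ⟶ K') (p q n : ℤ) (h : p + q = n) (x : K.X p) (c : C.X q) :
    (tensorMapLeft C f).f n (tmul K C p q n h x c) = tmul K' C p q n h (f.f p x) c :=
  (tensorCochain_tmul (Cochain.ofHom f) p p q n n (add_zero n) h (add_zero p) x c).trans
    (by rw [Cochain.ofHom_v])

lemma tensorCochain_id : tensorCochain C (Cochain.ofHom (𝟙 K)) = Cochain.ofHom (𝟙 _) := by
  rw [← ofHom_tensorMapLeft]
  congr 1
  ext1 n
  refine tmul_hom_ext fun p q h x c => ?_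
  rw [tensorMapLeft_tmul]
  rfl

/-- Tensoring a cone of multiplication by `b` with a complex. -/
noncomputable def MulCone.tensor {b : R} (c : MulCone b K K')
    (C : CochainComplex (ModuleCat.{u} R) ℤ) : MulCone b (tensorObj K C) (tensorObj K' C) where
  incl := tensorMapLeft C c.incl
  proj := tensorCochain C c.proj
  sec := tensorCochain C c.sec
  ret := tensorCochain C c.ret
  sec_proj := by rw [← tensorCochain_comp, c.sec_proj, tensorCochain_id]
  incl_ret := by rw [ofHom_tensorMapLeft, ← tensorCochain_comp, c.incl_ret, tensorCochain_id]
  incl_proj := by rw [ofHom_tensorMapLeft, ← tensorCochain_comp, c.incl_proj, tensorCochain_zero]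
  decomp := by
    rw [ofHom_tensorMapLeft, ← tensorCochain_comp, ← tensorCochain_comp, ← tensorCochain_add,
      c.decomp, tensorCochain_id]
  δ_sec := by rw [tensorCochain_δ _ (by omega), c.δ_sec, tensorCochain_smul, ofHom_tensorMapLeft]

/-- The chain map `K ⊗ g` for a chain map `g`. -/
noncomputable def tensorMapRight (K : CochainComplex (ModuleCat.{u} R) ℤ) (g : C ⟶ C') :
    tensorObj K C ⟶ tensorObj K C' where
  f n := tensorDesc fun p q h => (tmul K C' p q n h).compl₂ (g.f q).hom
  comm' n m h := by
    refine tmul_hom_ext fun p q hpq x c => ?_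
    rw [ModuleCat.comp_apply, ModuleCat.comp_apply, tensorDesc_tmul,
      d_tmul p _ q _ n m hpq rfl rfl h, map_add, Units.smul_def, map_zsmul, tensorDesc_tmul,
      tensorDesc_tmul]
    refine (d_tmul p _ q _ n m hpq rfl rfl h x (g.f q c)).trans ?_
    rw [hom_comm_apply]
    rfl

lemma tensorMapRight_tmul (g : C ⟶ C') (p q n : ℤ) (h : p + q = n) (x : K.X p) (c : C.X q) :
    (tensorMapRight K g).f n (tmul K C p q n h x c) = tmul K C' p q n h x (g.f q c) := by
  rw [tensorMapRight, tensorDesc_tmul]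
  rfl

lemma tensorCochain_tensorMapRight {t : ℤ} (f : Cochain K K' t) (g : C ⟶ C') (n m : ℤ)
    (h : n + t = m) : (tensorCochain C f).v n m h ≫ (tensorMapRight K' g).f m =
      (tensorMapRight K g).f n ≫ (tensorCochain C' f).v n m h := by
  refine tmul_hom_ext fun p q hpq x c => ?_
  rw [ModuleCat.comp_apply, ModuleCat.comp_apply, tensorCochain_tmul f p (p + t) q n m h hpq rfl,
    tensorMapRight_tmul, tensorMapRight_tmul, tensorCochain_tmul f p (p + t) q n m h hpq rfl]

lemma tensorMapLeft_tensorMapRight (f : K ⟶ K') (g : C ⟶ C') :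
    tensorMapLeft C f ≫ tensorMapRight K' g = tensorMapRight K g ≫ tensorMapLeft C' f := by
  ext1 n
  refine tmul_hom_ext fun p q hpq x c => ?_
  rw [HomologicalComplex.comp_f, HomologicalComplex.comp_f, ModuleCat.comp_apply,
    ModuleCat.comp_apply, tensorMapLeft_tmul, tensorMapRight_tmul, tensorMapRight_tmul,
    tensorMapLeft_tmul]

end Tensor

/-! ### The Koszul complex as an iterated cone -/

section Koszul

open CliffordAlgebra (contractLeft contractLeft_ι_mul contractLeft_algebraMap)
open ExteriorAlgebra (ι)

variable {R : Type u} [CommRing R]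

lemma ExteriorAlgebra.map_contractLeft {M N : Type*} [AddCommGroup M] [Module R M]
    [AddCommGroup N] [Module R N] (g : M →ₗ[R] N) (f : Module.Dual R N)
    (x : ExteriorAlgebra R M) :
    contractLeft f (ExteriorAlgebra.map g x) =
      ExteriorAlgebra.map g (contractLeft (f.comp g) x) := by
  induction x using CliffordAlgebra.left_induction with
  | algebraMap r => simp [contractLeft_algebraMap]
  | add x y hx hy => simp only [map_add, hx, hy]
  | ι_mul x v hx =>
    have e : ExteriorAlgebra.map g (ι R v * x) = ι R (g v) * ExteriorAlgebra.map g x := by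
      rw [map_mul, ExteriorAlgebra.map_apply_ι]
    refine (congrArg _ e).trans ?_
    rw [contractLeft_ι_mul, contractLeft_ι_mul, hx, map_sub, map_smul, map_mul]
    refine congrArg₂ _ rfl (congrArg₂ _ ?_ rfl)
    exact (ExteriorAlgebra.map_apply_ι g v).symm

lemma ExteriorAlgebra.map_mem_power {M N : Type u} [AddCommGroup M] [Module R M]
    [AddCommGroup N] [Module R N] (g : M →ₗ[R] N) (m : ℕ) (x : ExteriorAlgebra R M)
    (hx : x ∈ ⋀[R]^m M) : ExteriorAlgebra.map g x ∈ ⋀[R]^m N := by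
  have h : (LinearMap.range (ι R (M := M))).map (ExteriorAlgebra.map g).toLinearMap ≤
      LinearMap.range (ι R (M := N)) := by
    rintro _ ⟨_, ⟨v, rfl⟩, rfl⟩
    exact ⟨g v, (ExteriorAlgebra.map_apply_ι g v).symm⟩
  rw [exteriorPower] at hx ⊢
  refine pow_le_pow_left' h m ?_
  rw [← Submodule.map_pow]
  exact ⟨x, hx, rfl⟩

lemma koszulComponent_of_le {e e' : ℕ} (t : ℕ)
    (g : ExteriorAlgebra R (Fin e → R) →ₗ[R] ExteriorAlgebra R (Fin e' → R))
    (hg : ∀ m, ∀ x ∈ ⋀[R]^m (Fin e → R), g x ∈ ⋀[R]^(m + t) (Fin e' → R)) (p q : ℤ)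
    (h : p + -t = q) (x : ExteriorAlgebra R (Fin e → R)) (hx : x ∈ koszulComponent R e p) :
    g x ∈ koszulComponent R e' q := by
  obtain rfl | ⟨m, rfl, hx'⟩ := mem_koszulComponent.1 hx
  · rw [map_zero]
    exact Submodule.zero_mem _
  · exact mem_koszulComponent.2 (Or.inr ⟨m + t, by push_cast; omega, hg m x hx'⟩)

variable {e : ℕ}

/-- The inclusion of the last `e` coordinates in `R^(e+1)`. -/
def consZero (R : Type u) [CommRing R] (e : ℕ) : (Fin e → R) →ₗ[R] (Fin (e + 1) → R) where
  toFun v := Fin.cons 0 v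
  map_add' v w := by
    ext i
    refine Fin.cases ?_ (fun i => ?_) i <;> simp
  map_smul' r v := by
    ext i
    refine Fin.cases ?_ (fun i => ?_) i <;> simp

/-- The projection of `R^(e+1)` onto the last `e` coordinates. -/
def finTail (R : Type u) [CommRing R] (e : ℕ) : (Fin (e + 1) → R) →ₗ[R] (Fin e → R) :=
  LinearMap.funLeft R R Fin.succ

lemma finTail_comp_consZero : (finTail R e).comp (consZero R e) = LinearMap.id := by
  ext
  simp [finTail, consZero, LinearMap.funLeft]

lemma proj_comp_consZero :
    (LinearMap.proj 0 : (Fin (e + 1) → R) →ₗ[R] R).comp (consZero R e) = 0 := by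
  ext
  simp [consZero]

lemma linearCombination_comp_consZero (a : Fin (e + 1) → R) :
    (Fintype.linearCombination R a).comp (consZero R e) =
      Fintype.linearCombination R (Fin.tail a) := by
  refine LinearMap.ext fun v => ?_
  simp [consZero, Fintype.linearCombination_apply, Fin.sum_univ_succ, Fin.tail]

lemma consZero_finTail_add (v : Fin (e + 1) → R) :
    v = consZero R e (finTail R e v) + v 0 • Pi.single 0 1 := by
  ext i
  refine Fin.cases ?_ (fun i => ?_) i <;> simp [consZero, finTail, LinearMap.funLeft]

/-- Every `y ∈ ⋀ R^(e+1)` is `ε ∧ u + v` with `u`, `v` not involving the first basis vector `ε`;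
here `u` comes from the contraction of `y` with the coordinate form dual to `ε`. -/
lemma exterior_decomp (y : ExteriorAlgebra R (Fin (e + 1) → R)) :
    ι R (Pi.single 0 1) * ExteriorAlgebra.map (consZero R e) (ExteriorAlgebra.map (finTail R e)
      (contractLeft (LinearMap.proj 0 : (Fin (e + 1) → R) →ₗ[R] R) y)) +
    ExteriorAlgebra.map (consZero R e) (ExteriorAlgebra.map (finTail R e) y) = y := by
  let τ := (ExteriorAlgebra.map (consZero R e)).comp (ExteriorAlgebra.map (finTail R e))
  let c := contractLeft (Q := (0 : QuadraticForm R (Fin (e + 1) → R)))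
    (LinearMap.proj 0 : (Fin (e + 1) → R) →ₗ[R] R)
  change ι R (Pi.single 0 1) * τ (c y) + τ y = y
  induction y using CliffordAlgebra.left_induction with
  | algebraMap r =>
    have : c (algebraMap R _ r) = 0 := contractLeft_algebraMap _ _ _
    refine (congrArg (fun z => _ * τ z + _) this).trans ?_
    rw [map_zero, mul_zero, zero_add]
    exact τ.commutes r
  | add x y hx hy =>
    rw [map_add, map_add, map_add, mul_add, add_add_add_comm, hx, hy]
  | ι_mul y v hy =>
    set ε : ExteriorAlgebra R (Fin (e + 1) → R) := ι R (Pi.single 0 1) with hε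
    set v' : ExteriorAlgebra R (Fin (e + 1) → R) := ι R (consZero R e (finTail R e v)) with hv'
    have hc : c (ι R v * y) = v 0 • y - ι R v * c y := contractLeft_ι_mul _ _ _
    have hτ : τ (ι R v) = v' := by
      change ExteriorAlgebra.map (consZero R e) (ExteriorAlgebra.map (finTail R e) (ι R v)) = _
      rw [ExteriorAlgebra.map_apply_ι, ExteriorAlgebra.map_apply_ι]
    have hv : ι R v = v' + v 0 • ε := by
      rw [hε, hv', ← map_smul, ← map_add, ← consZero_finTail_add]
    have hsq : ε * ε = 0 := ExteriorAlgebra.ι_sq_zero _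
    have hsw : ε * v' = - (v' * ε) :=
      eq_neg_of_add_eq_zero_left (ExteriorAlgebra.ι_add_mul_swap _ _)
    change ε * τ (c (ι R v * y)) + τ (ι R v * y) = ι R v * y
    rw [hc, map_sub, map_smul, map_mul, map_mul, hτ, hv]
    conv_rhs => rw [← hy]
    have h1 : ε * (v' * τ (c y)) = - (v' * (ε * τ (c y))) := by
      rw [← mul_assoc, hsw, neg_mul, mul_assoc]
    have h2 : ε * (ε * τ (c y)) = 0 := by rw [← mul_assoc, hsq, zero_mul]
    simp only [mul_sub, mul_add, add_mul, smul_mul_assoc, mul_smul_comm, h1, h2, smul_zero]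
    abel

/-- The cochain between Koszul complexes given by a linear map of exterior algebras. -/
noncomputable def koszulCochain {e' : ℕ} (a : Fin e → R) (a' : Fin e' → R) (t : ℤ)
    (g : ExteriorAlgebra R (Fin e → R) →ₗ[R] ExteriorAlgebra R (Fin e' → R))
    (hg : ∀ p q : ℤ, p + t = q → ∀ x ∈ koszulComponent R e p, g x ∈ koszulComponent R e' q) :
    Cochain (koszulComplex a) (koszulComplex a') t :=
  Cochain.mk fun p q h => ModuleCat.ofHom (g.restrict (hg p q h))

lemma koszulComplex_d_coe (a : Fin e → R) (p q : ℤ) (h : p + 1 = q) (x : koszulComponent R e p) :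
    ((koszulComplex a).d p q x : koszulComponent R e q).1 =
      contractLeft (Fintype.linearCombination R a) x.1 := by
  change koszulD a p q x.1 = _
  rw [koszulD, if_pos h]

lemma koszul_hom_ext {e' : ℕ} {a : Fin e → R} {a' : Fin e' → R} {p q : ℤ}
    {f g : (koszulComplex a).X p ⟶ (koszulComplex a').X q}
    (h : ∀ x : koszulComponent R e p, (f x : koszulComponent R e' q).1 =
      (g x : koszulComponent R e' q).1) : f = g :=
  ModuleCat.hom_ext (LinearMap.ext fun x => Subtype.ext (h x))

lemma koszulComponent_map {e' : ℕ} (g : (Fin e → R) →ₗ[R] (Fin e' → R)) (p q : ℤ)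
    (h : p + 0 = q) (x : ExteriorAlgebra R (Fin e → R)) (hx : x ∈ koszulComponent R e p) :
    ExteriorAlgebra.map g x ∈ koszulComponent R e' q :=
  koszulComponent_of_le 0 (ExteriorAlgebra.map g).toLinearMap
    (fun m x hx => ExteriorAlgebra.map_mem_power g m x hx) p q (by simpa using h) x hx

lemma koszulComponent_wedge (p q : ℤ) (h : p + -1 = q) (x : ExteriorAlgebra R (Fin e → R))
    (hx : x ∈ koszulComponent R e p) :
    ((LinearMap.mulLeft R (ι R (Pi.single 0 1))).comp
      (ExteriorAlgebra.map (consZero R e)).toLinearMap) x ∈ koszulComponent R (e + 1) q :=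
  koszulComponent_of_le 1 _ (fun m x hx => by
    rw [add_comm m 1]
    have h1 : ι R (Pi.single 0 1) ∈ ⋀[R]^1 (Fin (e + 1) → R) := by
      simp [ExteriorAlgebra.exteriorPower]
    exact ExteriorAlgebra.mul_mem_power h1 (ExteriorAlgebra.map_mem_power _ m x hx)) p q h x hx

/-- The inclusion of the Koszul complex on `a₁, …, a_e` in the one on `a₀, …, a_e`. -/
noncomputable def koszulIncl (a : Fin (e + 1) → R) :
    koszulComplex (Fin.tail a) ⟶ koszulComplex a where
  f n := ModuleCat.ofHom ((ExteriorAlgebra.map (consZero R e)).toLinearMap.restrict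
    (koszulComponent_map _ n n (add_zero n)))
  comm' n m h := by
    refine koszul_hom_ext fun x => ?_
    refine (koszulComplex_d_coe a n m h _).trans ?_
    refine Eq.trans ?_ (congrArg (ExteriorAlgebra.map (consZero R e))
      (koszulComplex_d_coe (Fin.tail a) n m h x)).symm
    rw [← linearCombination_comp_consZero]
    exact ExteriorAlgebra.map_contractLeft _ _ _

/-- The Koszul complex on `a₀, …, a_e` is the cone of multiplication by `a₀` on the Koszul complex
on `a₁, …, a_e`. If `ε` is the first basis vector, the projection is the contraction with the
coordinate form dual to `ε`, and its section is `y ↦ ε ∧ y`. -/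
noncomputable def koszulMulCone (a : Fin (e + 1) → R) :
    MulCone (a 0) (koszulComplex (Fin.tail a)) (koszulComplex a) where
  incl := koszulIncl a
  proj := koszulCochain a (Fin.tail a) 1
    ((ExteriorAlgebra.map (finTail R e)).toLinearMap.comp (contractLeft (LinearMap.proj 0))) (by
      intro p q h x hx
      refine koszulComponent_map _ q q (add_zero q) _ ?_
      have := koszulD_mem (Pi.single 0 1) p q x hx
      rw [koszulD, if_pos h] at this
      convert this
      ext i
      simp [Fintype.linearCombination_apply, Pi.single_apply, eq_comm])
  sec := koszulCochain (Fin.tail a) a (-1)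
    ((LinearMap.mulLeft R (ι R (Pi.single 0 1))).comp
      (ExteriorAlgebra.map (consZero R e)).toLinearMap)
    koszulComponent_wedge
  ret := koszulCochain a (Fin.tail a) 0 (ExteriorAlgebra.map (finTail R e)).toLinearMap
    (koszulComponent_map _)
  sec_proj := by
    ext1 q
    rw [Cochain.comp_v _ _ _ q (q - 1) q rfl (by omega), Cochain.ofHom_v]
    refine koszul_hom_ext fun x => ?_
    change ExteriorAlgebra.map (finTail R e) (contractLeft _ (ι R _ *
      ExteriorAlgebra.map (consZero R e) x.1)) = x.1
    have e1 := ExteriorAlgebra.map_contractLeft (consZero R e) (LinearMap.proj 0) x.1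
    rw [proj_comp_consZero, map_zero, LinearMap.zero_apply, map_zero] at e1
    rw [contractLeft_ι_mul, e1, mul_zero, sub_zero, LinearMap.proj_apply, Pi.single_eq_same,
      one_smul, ← AlgHom.comp_apply, ExteriorAlgebra.map_comp_map, finTail_comp_consZero,
      ExteriorAlgebra.map_id]
    rfl
  incl_ret := by
    ext1 q
    rw [Cochain.comp_zero_cochain_v, Cochain.ofHom_v, Cochain.ofHom_v]
    refine koszul_hom_ext fun x => ?_
    change ExteriorAlgebra.map (finTail R e) (ExteriorAlgebra.map (consZero R e) x.1) = x.1
    rw [← AlgHom.comp_apply, ExteriorAlgebra.map_comp_map, finTail_comp_consZero,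
      ExteriorAlgebra.map_id]
    rfl
  incl_proj := by
    ext1 p q h
    rw [Cochain.zero_cochain_comp_v, Cochain.ofHom_v]
    refine koszul_hom_ext fun x => ?_
    change ExteriorAlgebra.map (finTail R e) (contractLeft _
      (ExteriorAlgebra.map (consZero R e) x.1)) = 0
    have e1 := ExteriorAlgebra.map_contractLeft (consZero R e) (LinearMap.proj 0) x.1
    rw [proj_comp_consZero, map_zero, LinearMap.zero_apply, map_zero] at e1
    rw [e1, map_zero]
  decomp := by
    ext1 q
    rw [Cochain.add_v, Cochain.comp_v _ _ _ q (q + 1) q rfl (by omega),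
      Cochain.comp_zero_cochain_v, Cochain.ofHom_v, Cochain.ofHom_v]
    exact koszul_hom_ext fun x => exterior_decomp x.1
  δ_sec := by
    ext1 q
    rw [δ_v (-1) 0 rfl _ q q (add_zero q) (q - 1) (q + 1) rfl rfl, Cochain.smul_v, Cochain.ofHom_v,
      Int.negOnePow_zero, one_smul]
    refine koszul_hom_ext fun x => ?_
    have e1 := koszulComplex_d_coe a (q - 1) q (by omega)
      ((koszulCochain (Fin.tail a) a (-1)
        ((LinearMap.mulLeft R (ι R (Pi.single 0 1))).comp
          (ExteriorAlgebra.map (consZero R e)).toLinearMap)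
        koszulComponent_wedge).v q (q - 1) rfl x)
    have e2 := congrArg (ExteriorAlgebra.map (consZero R e))
      (koszulComplex_d_coe (Fin.tail a) q (q + 1) rfl x)
    have e3 := contractLeft_ι_mul (Q := (0 : QuadraticForm R (Fin (e + 1) → R)))
      (Fintype.linearCombination R a) (Pi.single 0 1) (ExteriorAlgebra.map (consZero R e) x.1)
    have e4 := ExteriorAlgebra.map_contractLeft (consZero R e)
      (Fintype.linearCombination R a) x.1
    rw [linearCombination_comp_consZero] at e4
    rw [Fintype.linearCombination_apply_single, one_smul, e4, ← e2] at e3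
    refine (congrArg₂ (· + ·) (e1.trans e3) rfl).trans ?_
    exact sub_add_cancel _ _

end Koszul

/-! ### Hom complexes and K-projective complexes -/

section HomCx

variable {R : Type u} [CommRing R] {P X Y Z : CochainComplex (ModuleCat.{u} R) ℤ}

/-- The cochain `Hom(P, f)` for a cochain `f` of complexes. -/
noncomputable def homCochain (P : CochainComplex (ModuleCat.{u} R) ℤ) {t : ℤ}
    (f : Cochain X Y t) : Cochain (homCx P X) (homCx P Y) t :=
  Cochain.mk fun n m h => ModuleCat.ofHom
    { toFun := fun z : Cochain P X n => (z.comp f h : Cochain P Y m)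
      map_add' z w := Cochain.add_comp z w f h
      map_smul' r z := Cochain.smul_comp r z f h }

lemma homCx_hom_ext {n : ℤ} {V : ModuleCat.{u} R} {f g : (homCx P X).X n ⟶ V}
    (h : ∀ z : Cochain P X n, f z = g z) : f = g :=
  ModuleCat.hom_ext (LinearMap.ext h)

lemma homCochain_add {t : ℤ} (f g : Cochain X Y t) :
    homCochain P (f + g) = homCochain P f + homCochain P g := by
  ext1 n m h
  exact homCx_hom_ext fun z => Cochain.comp_add z f g h

lemma homCochain_smul {t : ℤ} (b : R) (f : Cochain X Y t) :
    homCochain P (b • f) = b • homCochain P f := by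
  ext1 n m h
  exact homCx_hom_ext fun z => Cochain.comp_smul z b f h

lemma homCochain_zero {t : ℤ} : homCochain P (0 : Cochain X Y t) = 0 := by
  ext1 n m h
  exact homCx_hom_ext fun z => Cochain.comp_zero z h

lemma homCochain_comp {s t k : ℤ} (f : Cochain X Y s) (g : Cochain Y Z t) (h : s + t = k) :
    homCochain P (f.comp g h) = (homCochain P f).comp (homCochain P g) h := by
  ext1 n m hnm
  rw [Cochain.comp_v _ _ h n (n + s) m rfl (by omega)]
  exact homCx_hom_ext fun z => (Cochain.comp_assoc z f g rfl h (by omega)).symm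

lemma homCochain_δ {s t : ℤ} (f : Cochain X Y s) (h : s + 1 = t) :
    δ s t (homCochain P f) = homCochain P (δ s t f) := by
  ext1 n m hnm
  rw [δ_v s t h _ n m hnm (n + s) (n + 1) (by omega) rfl]
  refine homCx_hom_ext fun z => ?_
  change δ (n + s) m (z.comp f rfl) + t.negOnePow • (δ n (n + 1) z).comp f (by omega) =
    z.comp (δ s t f) hnm
  have hs : t.negOnePow = - s.negOnePow := by rw [← h, Int.negOnePow_succ]
  rw [δ_comp z f rfl (n + 1) t m (by omega) rfl h, hs, Units.neg_smul]
  exact add_neg_cancel_right _ _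

/-- The chain map `Hom(P, f)` for a chain map `f`. -/
noncomputable def homCxMap (P : CochainComplex (ModuleCat.{u} R) ℤ) (f : X ⟶ Y) :
    homCx P X ⟶ homCx P Y :=
  Cocycle.homOf (Cocycle.mk (homCochain P (Cochain.ofHom f)) 1 rfl (by
    rw [homCochain_δ _ (by omega), δ_ofHom, homCochain_zero]))

lemma ofHom_homCxMap (f : X ⟶ Y) :
    Cochain.ofHom (homCxMap P f) = homCochain P (Cochain.ofHom f) :=
  congrArg Subtype.val (Cocycle.ofHom_homOf_eq_self (Cocycle.mk (homCochain P
    (Cochain.ofHom f)) 1 rfl _))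

lemma homCxMap_apply (f : X ⟶ Y) (n : ℤ) (z : Cochain P X n) :
    (homCxMap P f).f n z = z.comp (Cochain.ofHom f) (add_zero n) := rfl

lemma homCxMap_comp (f : X ⟶ Y) (g : Y ⟶ Z) :
    homCxMap P (f ≫ g) = homCxMap P f ≫ homCxMap P g := by
  ext1 n
  refine homCx_hom_ext fun z => ?_
  change z.comp (Cochain.ofHom (f ≫ g)) (add_zero n) = (z.comp (Cochain.ofHom f)
    (add_zero n)).comp (Cochain.ofHom g) (add_zero n)
  rw [Cochain.ofHom_comp, Cochain.comp_assoc_of_second_is_zero_cochain]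

lemma homCochain_id : homCochain P (Cochain.ofHom (𝟙 X)) = Cochain.ofHom (𝟙 _) := by
  rw [← ofHom_homCxMap]
  congr 1
  ext1 n
  refine homCx_hom_ext fun z => ?_
  rw [homCxMap_apply, Cochain.comp_id]
  rfl

/-- Applying `Hom(P, -)` to a cone of multiplication by `b`. -/
noncomputable def MulCone.hom {b : R} (c : MulCone b X Y)
    (P : CochainComplex (ModuleCat.{u} R) ℤ) : MulCone b (homCx P X) (homCx P Y) where
  incl := homCxMap P c.incl
  proj := homCochain P c.proj
  sec := homCochain P c.sec
  ret := homCochain P c.ret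
  sec_proj := by rw [← homCochain_comp, c.sec_proj, homCochain_id]
  incl_ret := by rw [ofHom_homCxMap, ← homCochain_comp, c.incl_ret, homCochain_id]
  incl_proj := by rw [ofHom_homCxMap, ← homCochain_comp, c.incl_proj, homCochain_zero]
  decomp := by
    rw [ofHom_homCxMap, ← homCochain_comp, ← homCochain_comp, ← homCochain_add,
      c.decomp, homCochain_id]
  δ_sec := by rw [homCochain_δ _ (by omega), c.δ_sec, homCochain_smul, ofHom_homCxMap]

lemma mem_cocyc_homCx {n m : ℤ} (h : n + 1 = m) {z : Cochain P X n} :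
    (z : (homCx P X).X n) ∈ cocyc (homCx P X) n ↔ δ n m z = 0 := mem_cocyc h

lemma mem_cobdry_homCx {k n : ℤ} (h : k + 1 = n) {z : Cochain P X n} :
    (z : (homCx P X).X n) ∈ cobdry (homCx P X) n ↔ ∃ y : Cochain P X k, δ k n y = z :=
  mem_cobdry h

/-- If `P` is K-projective and `X` is acyclic, then `Hom(P, X)` is acyclic: a cocycle of degree `n`
is turned into a morphism to a shift of `X`, which is homotopic to zero. -/
lemma exists_δ_eq_of_acyclic [P.IsKProjective] (hX : X.Acyclic) (k n l : ℤ) (hk : k + 1 = n)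
    (hl : n + 1 = l) (z : Cochain P X n) (hz : δ n l z = 0) : ∃ y : Cochain P X k, δ k n y = z := by
  let γ := Cocycle.mk (z.leftShift (-n) 0 (by omega)) 1 rfl (by
    rw [Cochain.δ_leftShift z (-n) 0 1 (by omega) l (by omega), hz, Cochain.leftShift_zero,
      smul_zero])
  obtain ⟨h⟩ := CochainComplex.IsKProjective.nonempty_homotopy_zero (Cocycle.homOf γ) hX
  have hγ : δ (-1) 0 (Cochain.ofHomotopy h) = z.leftShift (-n) 0 (by omega) := by
    rw [δ_ofHomotopy, Cochain.ofHom_zero, sub_zero]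
    exact congrArg Subtype.val (Cocycle.ofHom_homOf_eq_self γ)
  have := Cochain.δ_leftUnshift (Cochain.ofHomotopy h) k (by omega) n 0 (by omega)
  rw [hγ, Cochain.leftUnshift_leftShift] at this
  refine ⟨(-n).negOnePow • (Cochain.ofHomotopy h).leftUnshift k (by omega), ?_⟩
  rw [δ_units_smul, this, smul_smul, Int.units_mul_self, one_smul]

open CochainComplex in
lemma acyclic_mappingCone (φ : X ⟶ Y) [QuasiIso φ] : (mappingCone φ).Acyclic := by
  have hφ := (quasiIso_iff_cocyc φ).1 inferInstance
  intro n
  rw [HomologicalComplex.exactAt_iff_isZero_homology, isZero_homology_iff]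
  intro w hw
  rw [mem_cocyc rfl] at hw
  have h1 := ConcreteCategory.congr_hom (mappingCone.d_fst_v φ n (n + 1) (n + 1 + 1) rfl rfl) w
  have h2 := ConcreteCategory.congr_hom (mappingCone.d_snd_v φ n (n + 1) rfl) w
  have h3 := ConcreteCategory.congr_hom (mappingCone.id_X φ n (n + 1) rfl) w
  set x := (mappingCone.fst φ).1.v n (n + 1) rfl w with hx
  set y := (mappingCone.snd φ).v n n (add_zero n) w with hy
  have hdx : X.d (n + 1) (n + 1 + 1) x = 0 := by
    rw [ModuleCat.comp_apply, hw, map_zero] at h1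
    exact neg_eq_zero.1 h1.symm
  have hdy : φ.f (n + 1) x + Y.d n (n + 1) y = 0 := by
    rw [ModuleCat.comp_apply, hw, map_zero] at h2
    exact h2.symm
  have hwxy : (mappingCone.inl φ).v (n + 1) n (by omega) x + (mappingCone.inr φ).f n y = w := h3
  have hφx : φ.f (n + 1) x ∈ cobdry Y (n + 1) := by
    rw [eq_neg_of_add_eq_zero_left hdy]
    exact neg_mem (d_mem_cobdry _ _ _)
  obtain ⟨x₁, hx₁⟩ := (mem_cobdry rfl).1 ((hφ (n + 1)).1 x ((mem_cocyc rfl).2 hdx) hφx)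
  have hyx : y + φ.f n x₁ ∈ cocyc Y n := by
    rw [mem_cocyc rfl, map_add, hom_comm_apply, hx₁]
    exact (add_comm _ _).trans hdy
  obtain ⟨x₂, hx₂, hyx₂⟩ := (hφ n).2 _ hyx
  obtain ⟨y₃, hy₃⟩ := (mem_cobdry (sub_add_cancel n 1)).1 hyx₂
  rw [mem_cocyc rfl] at hx₂
  refine (mem_cobdry (sub_add_cancel n 1)).2
    ⟨(mappingCone.inl φ).v n (n - 1) (by omega) (x₂ - x₁) + (mappingCone.inr φ).f (n - 1) y₃, ?_⟩
  have h4 := ConcreteCategory.congr_hom (mappingCone.inl_v_d φ n (n - 1) (n + 1) (by omega)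
    (by omega)) (x₂ - x₁)
  have h5 : (mappingCone φ).d (n - 1) n ((mappingCone.inl φ).v n (n - 1) (by omega) (x₂ - x₁)) =
      (mappingCone.inr φ).f n (φ.f n (x₂ - x₁)) -
        (mappingCone.inl φ).v (n + 1) n (by omega) (X.d n (n + 1) (x₂ - x₁)) := h4
  rw [map_add, h5, hom_comm_apply, hy₃, ← hwxy, map_sub (X.d n (n + 1)).hom, hx₂, hx₁, zero_sub,
    map_neg, map_sub (φ.f n).hom, map_sub, map_sub, map_add]
  abel

open CochainComplex in
/-- The functor `Hom(P, -)` preserves quasi-isomorphisms if `P` is K-projective, since `Hom(P, -)`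
of a mapping cone is acyclic. -/
lemma quasiIso_homCxMap [P.IsKProjective] (φ : X ⟶ Y) [QuasiIso φ] :
    QuasiIso (homCxMap P φ) := by
  have hW := acyclic_mappingCone φ
  rw [quasiIso_iff_cocyc]
  refine fun n => ⟨fun (z : Cochain P X n) hz hzφ => ?_, fun (z : Cochain P Y n) hz => ?_⟩
  · replace hz : δ n (n + 1) z = 0 := (mem_cocyc_homCx rfl).1 hz
    obtain ⟨v, hv⟩ := (mem_cobdry_homCx (sub_add_cancel n 1)).1 hzφ
    obtain ⟨y, hy⟩ := exists_δ_eq_of_acyclic hW (n - 1 - 1) (n - 1) n (by omega) (by omega)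
      (mappingCone.liftCochain φ z (-v) (by omega)) (by
        rw [mappingCone.δ_liftCochain φ z (-v) (by omega) (n + 1) rfl, hz, δ_neg,
          show δ (n - 1) n v = z.comp (Cochain.ofHom φ) (add_zero n) from hv, neg_add_cancel,
          Cochain.zero_comp, neg_zero, Cochain.zero_comp, add_zero])
    refine (mem_cobdry_homCx (sub_add_cancel n 1)).2
      ⟨- y.comp (mappingCone.fst φ).1 (by omega), ?_⟩
    rw [δ_neg, δ_comp y _ _ (n - 1) 2 n (by omega) (by omega) (by omega), Cocycle.δ_eq_zero,
      Cochain.comp_zero, zero_add, hy, mappingCone.liftCochain_fst, Int.negOnePow_one,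
      Units.neg_smul, one_smul, neg_neg]
  · replace hz : δ n (n + 1) z = 0 := (mem_cocyc_homCx rfl).1 hz
    obtain ⟨y, hy⟩ := exists_δ_eq_of_acyclic hW (n - 1) n (n + 1) (by omega) rfl
      (z.comp (Cochain.ofHom (mappingCone.inr φ)) (add_zero n)) (by
        rw [δ_comp_zero_cochain _ _ _ rfl, δ_ofHom, Cochain.comp_zero, hz, Cochain.zero_comp,
          add_zero])
    refine ⟨(y.comp (mappingCone.fst φ).1 (sub_add_cancel n 1) : Cochain P X n),
      (mem_cocyc_homCx rfl).2 ?_, (mem_cobdry_homCx (sub_add_cancel n 1)).2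
        ⟨y.comp (mappingCone.snd φ) (add_zero _), ?_⟩⟩
    · rw [δ_comp y _ _ n 2 (n + 1) rfl (by omega) (by omega), Cocycle.δ_eq_zero,
        Cochain.comp_zero, zero_add, hy, Cochain.comp_assoc_of_second_is_zero_cochain,
        mappingCone.inr_fst, Cochain.comp_zero, smul_zero]
    · rw [δ_comp_zero_cochain _ _ _ (sub_add_cancel n 1), hy,
        Cochain.comp_assoc_of_second_is_zero_cochain, mappingCone.inr_snd, Cochain.comp_id,
        mappingCone.δ_snd, Cochain.comp_neg]
      refine (neg_add_eq_sub _ _).trans ?_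
      change z - _ = z - (y.comp (mappingCone.fst φ).1 (sub_add_cancel n 1)).comp
        (Cochain.ofHom φ) (add_zero n)
      rw [Cochain.comp_assoc_of_third_is_zero_cochain]

end HomCx

/-! ### Towers of cones along a sequence of elements -/

section Tower

variable {R : Type u} [CommRing R]

/-- A family of complexes indexed by finite sequences in `R` in which the complex of `a₀, …, a_e`
is the cone of multiplication by `a₀` on the complex of `a₁, …, a_e`. -/
structure KoszulTower (R : Type u) [CommRing R] where
  /-- the complex of a sequence -/
  cx {e : ℕ} (a : Fin e → R) : CochainComplex (ModuleCat.{u} R) ℤ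
  /-- the cone structure -/
  cone {e : ℕ} (a : Fin (e + 1) → R) : MulCone (a 0) (cx (Fin.tail a)) (cx a)

namespace KoszulTower

variable (T T' : KoszulTower R)

/-- A morphism of towers: a family of chain maps compatible with the inclusions and projections of
the cones. -/
structure Hom where
  /-- the chain map at a sequence -/
  app {e : ℕ} (a : Fin e → R) : T.cx a ⟶ T'.cx a
  incl_app {e : ℕ} (a : Fin (e + 1) → R) :
    (T.cone a).incl ≫ app a = app (Fin.tail a) ≫ (T'.cone a).incl
  proj_app {e : ℕ} (a : Fin (e + 1) → R) (n m : ℤ) (h : n + 1 = m) :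
    (T.cone a).proj.v n m h ≫ (app (Fin.tail a)).f m =
      (app a).f n ≫ (T'.cone a).proj.v n m h

variable {T T'}

lemma finite [IsNoetherianRing R] (h0 : HomologicallyDegreewiseFinite (T.cx (![] : Fin 0 → R))) :
    ∀ {e : ℕ} (a : Fin e → R), HomologicallyDegreewiseFinite (T.cx a) := by
  intro e
  induction e with
  | zero => exact fun a => Subsingleton.elim ![] a ▸ h0
  | succ e ih =>
    intro a n
    have := ih (Fin.tail a) n
    have := ih (Fin.tail a) (n + 1)
    exact (T.cone a).finite_homology_cone rfl

lemma bounded (h0 : HomologicallyBounded (T.cx (![] : Fin 0 → R))) :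
    ∀ {e : ℕ} (a : Fin e → R), HomologicallyBounded (T.cx a) := by
  intro e
  induction e with
  | zero => exact fun a => Subsingleton.elim ![] a ▸ h0
  | succ e ih =>
    intro a
    obtain ⟨b, hb⟩ := ih (Fin.tail a)
    refine ⟨b + 1, fun n hn => (T.cone a).isZero_cone (m := n + 1) rfl (hb n (by omega))
      (hb (n + 1) ?_)⟩
    have := abs_sub_abs_le_abs_sub n (-1)
    have h2 : |n| ≤ |n + 1| + 1 := by
      have := abs_add_le (n + 1) (-1)
      simpa using this
    omega

lemma isZero_base [IsNoetherianRing R] [IsLocalRing R]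
    (h0 : HomologicallyDegreewiseFinite (T.cx (![] : Fin 0 → R))) (n : ℤ) :
    ∀ {e : ℕ} (a : Fin e → R) (_ : ∀ i, a i ∈ IsLocalRing.maximalIdeal R),
      Limits.IsZero ((T.cx a).homology n) →
      Limits.IsZero ((T.cx (![] : Fin 0 → R)).homology n) := by
  intro e
  induction e with
  | zero => exact fun a _ h => Subsingleton.elim a ![] ▸ h
  | succ e ih =>
    intro a ha h
    have := finite h0 (Fin.tail a) n
    exact ih (Fin.tail a) (fun i => ha i.succ) ((T.cone a).isZero_of_isZero (ha 0) h)

/-- If the complex of `a` has no cohomology in positive degrees, then neither have the complexes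
below it in the tower, and so every class of degree `0` comes from the bottom of the tower. -/
lemma exists_of_isZero_of_pos [IsNoetherianRing R] [IsLocalRing R]
    (h0 : HomologicallyDegreewiseFinite (T.cx (![] : Fin 0 → R)))
    {Z : CochainComplex (ModuleCat.{u} R) ℤ} (j : ∀ {e : ℕ} (a : Fin e → R), Z ⟶ T.cx a)
    (hj : ∀ {e : ℕ} (a : Fin (e + 1) → R), j a = j (Fin.tail a) ≫ (T.cone a).incl)
    (hj0 : QuasiIso (j (![] : Fin 0 → R))) :
    ∀ {e : ℕ} (a : Fin e → R) (_ : ∀ i, a i ∈ IsLocalRing.maximalIdeal R)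
      (_ : ∀ n, 0 < n → Limits.IsZero ((T.cx a).homology n)),
      ∀ y ∈ cocyc (T.cx a) 0, ∃ z ∈ cocyc Z 0, y - (j a).f 0 z ∈ cobdry (T.cx a) 0 := by
  intro e
  induction e with
  | zero =>
    intro a _ _
    obtain rfl := Subsingleton.elim ![] a
    exact ((quasiIso_iff_cocyc _).1 hj0 0).2
  | succ e ih =>
    intro a ha h y hy
    have h' : ∀ n, 0 < n → Limits.IsZero ((T.cx (Fin.tail a)).homology n) := fun n hn =>
      have := finite h0 (Fin.tail a) n
      (T.cone a).isZero_of_isZero (ha 0) (h n hn)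
    obtain ⟨x, hx, hxy⟩ := (T.cone a).exists_incl_of_isZero (zero_add 1) (h' 1 one_pos) hy
    obtain ⟨z, hz, hzx⟩ := ih (Fin.tail a) (fun i => ha i.succ) h' x hx
    refine ⟨z, hz, ?_⟩
    have := add_mem hxy (map_mem_cobdry (T.cone a).incl hzx)
    rwa [map_sub, sub_add_sub_cancel, ← ModuleCat.comp_apply, ← HomologicalComplex.comp_f,
      ← hj] at this

lemma Hom.quasiIso (φ : T.Hom T') (h0 : QuasiIso (φ.app (![] : Fin 0 → R))) :
    ∀ {e : ℕ} (a : Fin e → R), QuasiIso (φ.app a) := by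
  intro e
  induction e with
  | zero => exact fun a => Subsingleton.elim ![] a ▸ h0
  | succ e ih => exact fun a => MulCone.quasiIso_cone (φ.incl_app a) (φ.proj_app a) (ih _)

/-- A morphism of towers that is a quasi-isomorphism at some sequence in the maximal ideal is one at
the empty sequence. -/
lemma Hom.quasiIso_base [IsNoetherianRing R] [IsLocalRing R] (φ : T.Hom T')
    (h0 : HomologicallyDegreewiseFinite (T.cx (![] : Fin 0 → R)))
    (h0' : HomologicallyDegreewiseFinite (T'.cx (![] : Fin 0 → R))) :
    ∀ {e : ℕ} (a : Fin e → R) (_ : ∀ i, a i ∈ IsLocalRing.maximalIdeal R),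
      QuasiIso (φ.app a) → QuasiIso (φ.app (![] : Fin 0 → R)) := by
  intro e
  induction e with
  | zero => exact fun a _ h => Subsingleton.elim a ![] ▸ h
  | succ e ih =>
    exact fun a ha h => ih (Fin.tail a) (fun i => ha i.succ)
      (MulCone.quasiIso_of_quasiIso_cone (ha 0) (φ.incl_app a) (φ.proj_app a)
        (finite h0 _) (finite h0' _) h)

end KoszulTower

end Tower

/-! ### The Koszul towers -/

section KoszulTowers

open HomologicalComplex (tensorObj)

variable {R : Type u} [CommRing R] {K K' C C' P : CochainComplex (ModuleCat.{u} R) ℤ}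

/-- The chain map `c ↦ u ⊗ c` for a cocycle `u` of degree `0`. -/
noncomputable def tensorUnitMap (u : K.X 0) (hu : K.d 0 1 u = 0)
    (C : CochainComplex (ModuleCat.{u} R) ℤ) : C ⟶ tensorObj K C where
  f n := ModuleCat.ofHom (tmul K C 0 n n (zero_add n) u)
  comm' n m h := by
    refine ModuleCat.hom_ext (LinearMap.ext fun c => ?_)
    refine (d_tmul 0 1 n m n m (zero_add n) (zero_add 1) h h u c).trans ?_
    rw [hu, map_zero, LinearMap.zero_apply, zero_add, Int.negOnePow_zero, one_smul]
    rfl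

/-- For a morphism `π : P ⟶ C`, the morphism `K ⟶ Hom(P, K ⊗ C)` given by `x ↦ (p ↦ x ⊗ π p)`. -/
noncomputable def tensorHomothety (K : CochainComplex (ModuleCat.{u} R) ℤ) (π : P ⟶ C) :
    K ⟶ homCx P (tensorObj K C) where
  f n := ModuleCat.ofHom
    { toFun := fun x => (Cochain.mk fun p q h => π.f p ≫
        ModuleCat.ofHom (tmul K C n p q (by omega) x) : Cochain P (tensorObj K C) n)
      map_add' x y := by
        ext p q h z
        change tmul K C n p q _ (x + y) (π.f p z) = tmul K C n p q _ x (π.f p z) +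
          tmul K C n p q _ y (π.f p z)
        rw [map_add, LinearMap.add_apply]
      map_smul' r x := by
        ext p q h z
        change tmul K C n p q _ (r • x) (π.f p z) = r • tmul K C n p q _ x (π.f p z)
        rw [map_smul, LinearMap.smul_apply] }
  comm' n m hnm := by
    refine ModuleCat.hom_ext (LinearMap.ext fun x => ?_)
    refine Cochain.ext (n := m) _ _ fun p q h => ?_
    change (δ n m (Cochain.mk fun p q h => π.f p ≫
        ModuleCat.ofHom (tmul K C n p q (by omega) x) : Cochain P (tensorObj K C) n)).v p q h =
      π.f p ≫ ModuleCat.ofHom (tmul K C m p q (by omega) (K.d n m x))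
    rw [δ_v n m hnm _ p q h (p + n) (p + 1) (by have : n + 1 = m := hnm; omega) rfl,
      Cochain.mk_v, Cochain.mk_v]
    refine ModuleCat.hom_ext (LinearMap.ext fun z => ?_)
    have e1 := d_tmul n m p (p + 1) (p + n) q (by omega) hnm rfl
      (by have : n + 1 = m := hnm; omega) x (π.f p z)
    have e2 := hom_comm_apply π p (p + 1) z
    have hs : m.negOnePow = - n.negOnePow := by
      rw [← show n + 1 = m from hnm, Int.negOnePow_succ]
    change (tensorObj K C).d (p + n) q (tmul K C n p (p + n) _ x (π.f p z)) +
      m.negOnePow • tmul K C n (p + 1) q _ x (π.f (p + 1) (P.d p (p + 1) z)) =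
      tmul K C m p q _ (K.d n m x) (π.f p z)
    rw [e1, e2, hs, Units.neg_smul]
    exact add_neg_cancel_right _ _

/-- The naturality of `K ⟶ Hom(P, K ⊗ C)` in `K` holds for all cochains `K ⟶ K'`, as is needed for
the projections of the cones, which have degree `1`. -/
lemma tensorHomothety_naturality {t : ℤ} (f : Cochain K K' t) (π : P ⟶ C) (n m : ℤ)
    (h : n + t = m) : f.v n m h ≫ (tensorHomothety K' π).f m =
      (tensorHomothety K π).f n ≫ (homCochain P (tensorCochain C f)).v n m h := by
  refine ModuleCat.hom_ext (LinearMap.ext fun x => ?_)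
  refine Cochain.ext (n := m) _ _ fun p q hpq => ?_
  refine Eq.trans ?_ (Cochain.comp_v ((tensorHomothety K π).f n x : Cochain P (tensorObj K C) n)
    (tensorCochain C f) h p (p + n) q rfl (by omega)).symm
  refine ModuleCat.hom_ext (LinearMap.ext fun z => ?_)
  exact (tensorCochain_tmul f n m p (p + n) q (by omega) (by omega) h x (π.f p z)).symm

/-- The tower of Koszul complexes. -/
noncomputable def koszulTower (R : Type u) [CommRing R] : KoszulTower R where
  cx a := koszulComplex a
  cone a := koszulMulCone a

/-- The tower of the complexes `K(a) ⊗ C`. -/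
noncomputable def koszulTensorTower (C : CochainComplex (ModuleCat.{u} R) ℤ) : KoszulTower R where
  cx a := tensorObj (koszulComplex a) C
  cone a := (koszulMulCone a).tensor C

/-- The tower of the complexes `Hom(P, K(a) ⊗ C)`. -/
noncomputable def koszulHomTower (P C : CochainComplex (ModuleCat.{u} R) ℤ) : KoszulTower R where
  cx a := homCx P (tensorObj (koszulComplex a) C)
  cone a := ((koszulMulCone a).tensor C).hom P

/-- The morphism `K(a) ⊗ g` of towers. -/
noncomputable def koszulTensorTowerMap (g : C ⟶ C') :
    (koszulTensorTower C).Hom (koszulTensorTower C') where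
  app _ := tensorMapRight _ g
  incl_app _ := tensorMapLeft_tensorMapRight _ _
  proj_app _ n m h := tensorCochain_tensorMapRight _ _ n m h

/-- The morphism `x ↦ (p ↦ x ⊗ π p)` of towers, for a morphism `π : P ⟶ C`. -/
noncomputable def koszulHomothety (π : P ⟶ C) : (koszulTower R).Hom (koszulHomTower P C) where
  app _ := tensorHomothety _ π
  incl_app a := by
    ext1 n
    have := tensorHomothety_naturality (Cochain.ofHom (koszulIncl a)) π n n (add_zero n)
    rw [Cochain.ofHom_v, ← ofHom_tensorMapLeft, ← ofHom_homCxMap, Cochain.ofHom_v] at this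
    exact this
  proj_app _ n m h := tensorHomothety_naturality _ _ n m h

/-- The unit of the Koszul complex. -/
noncomputable def koszulOne {e : ℕ} (a : Fin e → R) : (koszulComplex a).X 0 := (koszul a).one

lemma koszulOne_coe {e : ℕ} (a : Fin e → R) :
    (koszulOne a : koszulComponent R e 0).1 = 1 := rfl

lemma koszulComplex_d_one {e : ℕ} (a : Fin e → R) : (koszulComplex a).d 0 1 (koszulOne a) = 0 :=
  Subtype.ext ((koszulComplex_d_coe a 0 1 (zero_add 1) (koszulOne a)).trans (by
    rw [koszulOne_coe]
    exact CliffordAlgebra.contractLeft_one (Q := (0 : QuadraticForm R (Fin e → R))) _))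

/-- The chain map `C ⟶ K(a) ⊗ C`, `c ↦ 1 ⊗ c`. -/
noncomputable def koszulUnit {e : ℕ} (a : Fin e → R) (C : CochainComplex (ModuleCat.{u} R) ℤ) :
    C ⟶ tensorObj (koszulComplex a) C :=
  tensorUnitMap (koszulOne a) (koszulComplex_d_one a) C

lemma koszulUnit_succ {e : ℕ} (a : Fin (e + 1) → R) (C : CochainComplex (ModuleCat.{u} R) ℤ) :
    koszulUnit a C = koszulUnit (Fin.tail a) C ≫ tensorMapLeft C (koszulIncl a) := by
  ext1 n
  refine ModuleCat.hom_ext (LinearMap.ext fun c => ?_)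
  change tmul _ C 0 n n _ (koszulOne a) c =
    (tensorMapLeft C (koszulIncl a)).f n (tmul _ C 0 n n _ (koszulOne (Fin.tail a)) c)
  rw [tensorMapLeft_tmul]
  congr 2
  exact Subtype.ext (map_one (ExteriorAlgebra.map (consZero R e))).symm

lemma koszulComponent_zero_eq_bot {n : ℤ} (hn : n ≠ 0) : koszulComponent R 0 n = ⊥ := by
  refine (Submodule.eq_bot_iff _).2 fun x hx => ?_
  obtain h | ⟨m, hm, hx⟩ := mem_koszulComponent.1 hx
  · exact h
  · have h1 : LinearMap.range (ExteriorAlgebra.ι R (M := Fin 0 → R)) = ⊥ := by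
      refine (Submodule.eq_bot_iff _).2 ?_
      rintro _ ⟨v, rfl⟩
      rw [Subsingleton.elim v 0, map_zero]
    rw [ExteriorAlgebra.exteriorPower, h1, ← Submodule.zero_eq_bot, zero_pow (by omega)] at hx
    exact hx

lemma eq_smul_koszulOne (a : Fin 0 → R) (x : (koszulComplex a).X 0) :
    ∃ r : R, x = r • koszulOne a := by
  obtain h | ⟨m, hm, hx⟩ := mem_koszulComponent.1 (show x.1 ∈ koszulComponent R 0 0 from x.2)
  · exact ⟨0, Subtype.ext (by rw [zero_smul]; exact h)⟩
  · obtain rfl : m = 0 := by omega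
    rw [ExteriorAlgebra.exteriorPower, pow_zero, Submodule.mem_one] at hx
    obtain ⟨r, hr⟩ := hx
    exact ⟨r, Subtype.ext (hr.symm.trans (Algebra.algebraMap_eq_smul_one r))⟩

/-- The Koszul complex on the empty sequence is `R`, so that `C ⟶ K ⊗ C` is an isomorphism. -/
lemma isIso_koszulUnit_zero (a : Fin 0 → R) (C : CochainComplex (ModuleCat.{u} R) ℤ) :
    IsIso (koszulUnit a C) := by
  have : ∀ n, IsIso ((koszulUnit a C).f n) := by
    intro n
    rw [ConcreteCategory.isIso_iff_bijective]
    constructor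
    · -- a retraction of `c ↦ 1 ⊗ c` is given by the augmentation of the exterior algebra
      let ε : ∀ p, (koszulComplex a).X p →ₗ[R] R := fun p =>
        ExteriorAlgebra.algebraMapInv.toLinearMap.comp (koszulComponent R 0 p).subtype
      let ρ : (tensorObj (koszulComplex a) C).X n ⟶ C.X n := tensorDesc fun p q h =>
        if hq : q = n then
          ((LinearMap.lsmul R (C.X q)).comp (ε p)).compr₂ (C.XIsoOfEq hq).hom.hom
        else 0
      refine Function.LeftInverse.injective (g := ρ) fun c => ?_
      refine (tensorDesc_tmul _ 0 n (zero_add n) (koszulOne a) c).trans ?_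
      rw [dif_pos rfl]
      change ExteriorAlgebra.algebraMapInv (1 : ExteriorAlgebra R (Fin 0 → R)) • c = c
      rw [map_one, one_smul]
    · let S : Submodule R ((tensorObj (koszulComplex a) C).X n) :=
        LinearMap.range ((koszulUnit a C).f n).hom
      have : ModuleCat.ofHom S.mkQ = 0 := by
        refine tmul_hom_ext fun p q h x c => ?_
        refine (Submodule.Quotient.mk_eq_zero S).2 ?_
        by_cases hp : p = 0
        · subst hp
          obtain rfl : q = n := by omega
          obtain ⟨r, rfl⟩ := eq_smul_koszulOne a x
          exact ⟨r • c, by rw [map_smul, map_smul]; rfl⟩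
        · have hx : x = 0 := Subtype.ext
            ((Submodule.eq_bot_iff _).1 (koszulComponent_zero_eq_bot hp) x.1 x.2)
          rw [hx, map_zero]
          exact Submodule.zero_mem _
      intro y
      exact (Submodule.Quotient.mk_eq_zero S).1 (ConcreteCategory.congr_hom this y)
  exact HomologicalComplex.Hom.isIso_of_components _

lemma quasiIso_koszulUnit_zero (a : Fin 0 → R) (C : CochainComplex (ModuleCat.{u} R) ℤ) :
    QuasiIso (koszulUnit a C) := by
  have := isIso_koszulUnit_zero a C
  infer_instance

/-- The comparison of `R` with the Koszul complex on the empty sequence. -/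
noncomputable def koszulZeroMap (a : Fin 0 → R) :
    (HomologicalComplex.single (ModuleCat.{u} R) (ComplexShape.up ℤ) 0).obj (ModuleCat.of R R) ⟶
      koszulComplex a :=
  HomologicalComplex.mkHomFromSingle
    (ModuleCat.ofHom (LinearMap.toSpanSingleton R ((koszulComplex a).X 0) (koszulOne a)))
    (fun j hj => by
      obtain rfl : (1 : ℤ) = j := (zero_add 1).symm.trans hj
      refine ModuleCat.hom_ext (LinearMap.ext fun r => ?_)
      change (koszulComplex a).d 0 1 (r • koszulOne a) = 0
      rw [map_smul, koszulComplex_d_one, smul_zero])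

lemma koszulZeroMap_f_zero (a : Fin 0 → R) : (koszulZeroMap a).f 0 =
    (HomologicalComplex.singleObjXSelf _ _ _).hom ≫
      (ModuleCat.ofHom (LinearMap.toSpanSingleton R ((koszulComplex a).X 0) (koszulOne a)) :
        ModuleCat.of R R ⟶ (koszulComplex a).X 0) :=
  HomologicalComplex.mkHomFromSingle_f _ _

lemma quasiIso_koszulZeroMap (a : Fin 0 → R) : QuasiIso (koszulZeroMap a) := by
  have : ∀ n, IsIso ((koszulZeroMap a).f n) := by
    intro n
    by_cases hn : n = 0
    · subst hn
      have : IsIso (ModuleCat.ofHom (LinearMap.toSpanSingleton R ((koszulComplex a).X 0)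
          (koszulOne a)) : ModuleCat.of R R ⟶ (koszulComplex a).X 0) := by
        rw [ConcreteCategory.isIso_iff_bijective]
        refine ⟨Function.LeftInverse.injective
          (g := fun x : koszulComponent R 0 0 => ExteriorAlgebra.algebraMapInv x.1) fun r => ?_,
          fun x => ?_⟩
        · change ExteriorAlgebra.algebraMapInv (r • (1 : ExteriorAlgebra R (Fin 0 → R))) = r
          rw [map_smul, map_one, smul_eq_mul, mul_one]
        · obtain ⟨r, rfl⟩ := eq_smul_koszulOne a x
          exact ⟨r, rfl⟩
      rw [koszulZeroMap_f_zero]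
      exact IsIso.comp_isIso' inferInstance this
    · have h1 : Limits.IsZero ((koszulComplex a).X n) :=
        ModuleCat.isZero_iff_subsingleton.2 (by
          change Subsingleton (koszulComponent R 0 n)
          rw [koszulComponent_zero_eq_bot hn]
          infer_instance)
      have h2 := HomologicalComplex.isZero_single_obj_X (ComplexShape.up ℤ) (0 : ℤ)
        (ModuleCat.of R R) n hn
      exact ⟨0, h2.eq_of_src _ _, h1.eq_of_src _ _⟩
  have : IsIso (koszulZeroMap a) := HomologicalComplex.Hom.isIso_of_components _
  infer_instance

lemma homothetyCx_comp_koszulUnit (π : P ⟶ C) (a : Fin 0 → R) :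
    homothetyCx π ≫ homCxMap P (koszulUnit a C) =
      koszulZeroMap a ≫ tensorHomothety (koszulComplex a) π := by
  refine HomologicalComplex.from_single_hom_ext ?_
  have e1 : (homothetyCx π).f 0 = (HomologicalComplex.singleObjXSelf _ _ _).hom ≫
      (ModuleCat.ofHom (LinearMap.toSpanSingleton R (Cochain P C 0) (Cochain.ofHom π)) :
        ModuleCat.of R R ⟶ (homCx P C).X 0) := HomologicalComplex.mkHomFromSingle_f _ _
  rw [HomologicalComplex.comp_f, HomologicalComplex.comp_f, e1, koszulZeroMap_f_zero]
  refine (Category.assoc _ _ _).trans (Eq.trans (congrArg _ ?_) (Category.assoc _ _ _).symm)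
  refine ModuleCat.hom_ext (LinearMap.ext fun r => ?_)
  refine Cochain.ext (n := 0) _ _ fun p q h => ?_
  obtain rfl : q = p := by omega
  change ((r • Cochain.ofHom π).comp (Cochain.ofHom (koszulUnit a C)) (add_zero 0)).v q q h =
    π.f q ≫ ModuleCat.ofHom (tmul _ C 0 q q _ (r • koszulOne a))
  rw [Cochain.comp_zero_cochain_v, Cochain.ofHom_v, Cochain.smul_v, Cochain.ofHom_v]
  refine ModuleCat.hom_ext (LinearMap.ext fun z => ?_)
  change (koszulUnit a C).f q (r • π.f q z) = tmul _ C 0 q q _ (r • koszulOne a) (π.f q z)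
  rw [map_smul, map_smul, LinearMap.smul_apply]
  rfl

/-- At the bottom of the tower, `x ↦ (p ↦ x ⊗ π p)` is the homothety morphism `R ⟶ Hom(P, C)`. -/
lemma quasiIso_tensorHomothety_zero_iff [P.IsKProjective] (π : P ⟶ C) (a : Fin 0 → R) :
    QuasiIso (tensorHomothety (koszulComplex a) π) ↔ QuasiIso (homothetyCx π) := by
  have := quasiIso_koszulUnit_zero a C
  have := quasiIso_homCxMap (P := P) (koszulUnit a C)
  have := quasiIso_koszulZeroMap a
  rw [← quasiIso_iff_comp_right (homothetyCx π) (homCxMap P (koszulUnit a C)),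
    homothetyCx_comp_koszulUnit, quasiIso_iff_comp_left]

end KoszulTowers

/-! ### The DG module `A ⊗ P` is free on `P` -/

namespace DGModule

section TensorHom

open MonoidalCategory hiding tensorObj
open HomologicalComplex (tensorObj)

variable {R : Type u} [CommRing R] {A : DGAlgebra.{u} R}
  {P C C' : CochainComplex (ModuleCat.{u} R) ℤ}

lemma quasiIso_iff {M N : DGModule A} (f : M ⟶ N) : quasiIso A f ↔ QuasiIso f.hom := Iff.rfl

/-- The element `x ⊗ c` of the DG module `A ⊗ C`, as a bilinear map. -/
noncomputable def tens (A : DGAlgebra.{u} R) (C : CochainComplex (ModuleCat.{u} R) ℤ) (p q n : ℤ)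
    (h : p + q = n) : A.cx.X p →ₗ[R] C.X q →ₗ[R] (tensor A C).cx.X n :=
  tmul A.cx C p q n h

lemma smul_tens (i p q r j k : ℤ) (hr : i + p = r) (hj : p + q = j) (hk : i + j = k)
    (x : A.cx.X i) (y : A.cx.X p) (c : C.X q) :
    (tensor A C).smul i j k hk x (tens A C p q j hj y c) =
      tens A C r q k (by omega) (A.mul i p r hr x y) c :=
  ConcreteCategory.congr_hom (ι_tensorAct A C i j k hk x p q r hj hr) (y ⊗ₜ[R] c)

lemma tensor_ext {j : ℤ} {V : ModuleCat.{u} R} (f g : (tensor A C).cx.X j ⟶ V)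
    (h : ∀ p q hpq x c, f (tens A C p q j hpq x c) = g (tens A C p q j hpq x c))
    (m : (tensor A C).cx.X j) : f m = g m :=
  ConcreteCategory.congr_hom (tmul_hom_ext h) m

lemma d_one : A.cx.d 0 1 A.one = 0 := by
  have h := A.leibniz 0 0 0 (zero_add 0) A.one A.one
  have h1 : A.mul (0 + 1) 0 (0 + 1) (add_zero _) (A.cx.d 0 (0 + 1) A.one) A.one =
    A.cx.d 0 (0 + 1) A.one := A.mul_one _ _
  have h2 : A.mul 0 (0 + 1) (0 + 1) (zero_add _) A.one (A.cx.d 0 (0 + 1) A.one) =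
    A.cx.d 0 (0 + 1) A.one := A.one_mul _ _
  rw [A.one_mul, h1, h2, Int.negOnePow_zero, MulAction.one_smul] at h
  exact left_eq_add.1 h

/-- The chain map `P ⟶ A ⊗ P`, `p ↦ 1 ⊗ p`. -/
noncomputable def tensorUnit (A : DGAlgebra.{u} R) (P : CochainComplex (ModuleCat.{u} R) ℤ) :
    P ⟶ (tensor A P).cx := tensorUnitMap A.one d_one P

lemma tensorUnit_apply (q : ℤ) (z : P.X q) :
    (tensorUnit A P).f q z = tens A P 0 q q (zero_add q) A.one z := rfl

lemma smul_tensorUnit (p q n : ℤ) (h : p + q = n) (x : A.cx.X p) (z : P.X q) :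
    (tensor A P).smul p q n h x ((tensorUnit A P).f q z) = tens A P p q n h x z := by
  rw [tensorUnit_apply]
  refine (smul_tens p 0 q p q n (add_zero p) (zero_add q) h x A.one z).trans ?_
  rw [A.mul_one]

variable (P) in
/-- The restriction `Hom_A(A ⊗ P, N) ⟶ Hom(P, N)` along `p ↦ 1 ⊗ p`. -/
noncomputable def restrictHom (N : DGModule A) : (homDG (tensor A P) N).cx ⟶ homCx P N.cx where
  f n := ModuleCat.ofHom
    { toFun := fun z : linearCochains (tensor A P) N n =>
        ((Cochain.ofHom (tensorUnit A P)).comp z.1 (zero_add n) : Cochain P N.cx n)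
      map_add' z w := Cochain.comp_add _ z.1 w.1 (zero_add n)
      map_smul' r z := Cochain.comp_smul _ r z.1 (zero_add n) }
  comm' n m _ := ModuleCat.hom_ext (LinearMap.ext
    fun z : linearCochains (tensor A P) N n => δ_ofHom_comp _ z.1 m)

lemma restrictHom_apply (N : DGModule A) (n : ℤ) (z : linearCochains (tensor A P) N n) (p q : ℤ)
    (h : p + n = q) (x : P.X p) :
    (((restrictHom P N).f n z : Cochain P N.cx n)).v p q h x =
      z.1.v p q h ((tensorUnit A P).f p x) := by
  change ((Cochain.ofHom (tensorUnit A P)).comp z.1 (zero_add n)).v p q h x = _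
  rw [Cochain.zero_cochain_comp_v, Cochain.ofHom_v, ModuleCat.comp_apply]

/-- A linear cochain on `A ⊗ P` is determined by its restriction to `P`. -/
lemma linear_tens (N : DGModule A) (n : ℤ) (z : linearCochains (tensor A P) N n)
    (p q j q' j' : ℤ) (hj : p + q = j) (hq : q + n = q') (h : j + n = j') (x : A.cx.X p)
    (y : P.X q) : z.1.v j j' h (tens A P p q j hj x y) = (n * p).negOnePow •
      N.smul p q' j' (by omega) x (((restrictHom P N).f n z : Cochain P N.cx n).v q q' hq y) := by
  rw [restrictHom_apply, ← smul_tensorUnit, z.2 p q j q' j' hj hq h]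

/-- The `A`-linear cochain on `A ⊗ P` that extends a cochain on `P`. -/
noncomputable def extendCochain (N : DGModule A) (n : ℤ) (w : Cochain P N.cx n) :
    Cochain (tensor A P).cx N.cx n :=
  Cochain.mk fun _ j _ => tensorDesc fun p q _ => (n * p).negOnePow •
    (N.smul p (q + n) j (by omega)).compl₂ (w.v q (q + n) rfl).hom

lemma extendCochain_tens (N : DGModule A) (n : ℤ) (w : Cochain P N.cx n) (p q j q' j' : ℤ)
    (hj : p + q = j) (hq : q + n = q') (h : j + n = j') (x : A.cx.X p) (y : P.X q) :
    (extendCochain N n w).v j j' h (tens A P p q j hj x y) =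
      (n * p).negOnePow • N.smul p q' j' (by omega) x (w.v q q' hq y) := by
  subst hq
  exact (tensorDesc_tmul (n := j) (V := N.cx.X j') (fun p q _ => (n * p).negOnePow •
    (N.smul p (q + n) j' (by omega)).compl₂ (w.v q (q + n) rfl).hom) p q hj x y).trans rfl

lemma extendCochain_mem (N : DGModule A) (n : ℤ) (w : Cochain P N.cx n) :
    extendCochain N n w ∈ linearCochains (tensor A P) N n := by
  intro i j k j' k' h hj hk x m
  refine tensor_ext (V := N.cx.X k')
    (ModuleCat.ofHom ((tensor A P).smul i j k h x) ≫ (extendCochain N n w).v k k' hk)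
    ((n * i).negOnePow • ((extendCochain N n w).v j j' hj ≫
      ModuleCat.ofHom (N.smul i j' k' (by omega) x))) (fun p q hpq y c => ?_) m
  refine (congrArg ((extendCochain N n w).v k k' hk)
    (smul_tens i p q (i + p) j k rfl hpq h x y c)).trans ?_
  refine (extendCochain_tens N n w (i + p) q k (q + n) k' (by omega) rfl hk _ c).trans ?_
  refine Eq.trans ?_ (congrArg (fun z => (n * i).negOnePow • N.smul i j' k' (by omega) x z)
    (extendCochain_tens N n w p q j (q + n) j' hpq rfl hj y c).symm)
  rw [N.mul_smul i p (q + n) (i + p) j' k' rfl (by omega) (by omega) (by omega),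
    Units.smul_def (n * p).negOnePow, map_zsmul, ← Units.smul_def, smul_smul, mul_add,
    Int.negOnePow_add]

lemma restrictHom_extendCochain (N : DGModule A) (n : ℤ) (w : Cochain P N.cx n) :
    (restrictHom P N).f n (⟨_, extendCochain_mem N n w⟩ : linearCochains (tensor A P) N n) = w := by
  refine Cochain.ext (n := n) _ _ fun p q h => ?_
  subst h
  refine ModuleCat.hom_ext (LinearMap.ext fun x => ?_)
  refine (restrictHom_apply N n _ p _ rfl x).trans ?_
  refine (extendCochain_tens N n w 0 p p (p + n) (p + n) (zero_add p) rfl rfl A.one x).trans ?_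
  rw [N.one_smul, mul_zero, Int.negOnePow_zero, MulAction.one_smul]

instance (N : DGModule A) : IsIso (restrictHom P N) := by
  have : ∀ n, IsIso ((restrictHom P N).f n) := by
    intro n
    rw [ConcreteCategory.isIso_iff_bijective]
    refine ⟨fun (z z' : linearCochains (tensor A P) N n) h => Subtype.ext ?_,
      fun w => ⟨_, restrictHom_extendCochain N n w⟩⟩
    refine Cochain.ext _ _ fun j j' hj => ModuleCat.hom_ext (LinearMap.ext
      (tensor_ext _ _ fun p q hpq x y => ?_))
    rw [linear_tens N n z p q j (q + n) j' hpq rfl hj,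
      linear_tens N n z' p q j (q + n) j' hpq rfl hj, h]
  exact HomologicalComplex.Hom.isIso_of_components _

lemma homDGMap_restrictHom {M N : DGModule A} (g : M ⟶ N) :
    (homDGMap (tensor A P) g).hom ≫ restrictHom P N = restrictHom P M ≫ homCxMap P g.hom := by
  ext1 n
  refine ModuleCat.hom_ext (LinearMap.ext fun z : linearCochains (tensor A P) M n => ?_)
  exact (Cochain.comp_assoc_of_third_is_zero_cochain _ z.1 (Cochain.ofHom g.hom) (zero_add n)).symm

/-- `A ⊗ P` is K-projective if `P` is, as `Hom_A(A ⊗ P, -) ≅ Hom(P, -)`. -/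
lemma isKProjective_tensor [P.IsKProjective] : (tensor A P).IsKProjective := by
  intro M N g hg
  rw [quasiIso_iff] at hg ⊢
  have := quasiIso_homCxMap (P := P) g.hom
  rw [← quasiIso_iff_comp_right _ (restrictHom P N), homDGMap_restrictHom]
  infer_instance

/-- The morphism `A ⊗ g` of DG modules for a chain map `g`. -/
noncomputable def tensorMap (A : DGAlgebra.{u} R) (g : C ⟶ C') : tensor A C ⟶ tensor A C' where
  hom := tensorMapRight A.cx g
  map_smul i j k h x m := by
    refine tensor_ext (V := (tensor A C').cx.X k)
      (ModuleCat.ofHom ((tensor A C).smul i j k h x) ≫ (tensorMapRight A.cx g).f k)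
      ((tensorMapRight A.cx g).f j ≫ ModuleCat.ofHom ((tensor A C').smul i j k h x))
      (fun p q hpq y c => ?_) m
    refine (congrArg ((tensorMapRight A.cx g).f k)
      (smul_tens i p q (i + p) j k rfl hpq h x y c)).trans ?_
    refine (tensorMapRight_tmul g (i + p) q k _ _ c).trans ?_
    refine (smul_tens i p q (i + p) j k rfl hpq h x y (g.f q c)).symm.trans ?_
    exact congrArg ((tensor A C').smul i j k h x) (tensorMapRight_tmul g p q j hpq y c).symm

lemma tensorUnit_tensorMap (g : C ⟶ C') :
    tensorUnit A C ≫ (tensorMap A g).hom = g ≫ tensorUnit A C' := by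
  ext1 n
  refine ModuleCat.hom_ext (LinearMap.ext fun c => ?_)
  exact tensorMapRight_tmul g 0 n n (zero_add n) A.one c

lemma homothety_restrictHom (π : P ⟶ C) :
    (homothety (tensorMap A π)).hom ≫ restrictHom P (tensor A C) = tensorHomothety A.cx π := by
  ext1 n
  refine ModuleCat.hom_ext (LinearMap.ext fun x => ?_)
  refine Cochain.ext (n := n) _ _ fun p q h => ?_
  refine ModuleCat.hom_ext (LinearMap.ext fun z => ?_)
  refine (restrictHom_apply (tensor A C) n ((homothety (tensorMap A π)).hom.f n x) p q h z).trans ?_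
  refine (smulCochain_apply (tensor A C) n 0 n (add_zero n) x (Cochain.ofHom (tensorMap A π).hom)
    p p q h (add_zero p) _).trans ?_
  rw [Cochain.ofHom_v]
  refine (congrArg _ (ConcreteCategory.congr_hom (congrArg (fun φ => φ.f p)
    (tensorUnit_tensorMap (A := A) π)) z)).trans ?_
  exact smul_tensorUnit n p q (by omega) x (π.f p z)

lemma quasiIso_homothety_iff (π : P ⟶ C) :
    QuasiIso (homothety (tensorMap A π)).hom ↔ QuasiIso (tensorHomothety A.cx π) := by
  have := quasiIso_iff_comp_right (homothety (tensorMap A π)).hom (restrictHom P (tensor A C))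
  rw [homothety_restrictHom] at this
  exact this.symm

end TensorHom

end DGModule

/-! ### Chain maps that agree on homology -/

section HomotopicMaps

variable {R : Type u} [CommRing R] {X Y : CochainComplex (ModuleCat.{u} R) ℤ} {φ ψ : X ⟶ Y}

lemma homologyMap_eq_of_sub_mem {n : ℤ} (h : ∀ x ∈ cocyc X n, φ.f n x - ψ.f n x ∈ cobdry Y n) :
    HomologicalComplex.homologyMap φ n = HomologicalComplex.homologyMap ψ n := by
  refine ModuleCat.hom_ext (LinearMap.ext fun z => ?_)
  obtain ⟨x, rfl⟩ := homologyClass_surjective X n z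
  refine (homologyClass_map φ n x).trans (Eq.trans ?_ (homologyClass_map ψ n x).symm)
  rw [← sub_eq_zero, ← map_sub, homologyClass_eq_zero_iff]
  exact h x x.2

lemma quasiIso_of_homologyMap_eq
    (h : ∀ n, HomologicalComplex.homologyMap φ n = HomologicalComplex.homologyMap ψ n)
    (hφ : QuasiIso φ) : QuasiIso ψ := by
  rw [quasiIso_iff] at hφ ⊢
  intro n
  have := hφ n
  rw [quasiIsoAt_iff_isIso_homologyMap] at this ⊢
  rwa [← h n]

lemma quasiIso_of_sub_mem (h : ∀ n, ∀ x ∈ cocyc X n, φ.f n x - ψ.f n x ∈ cobdry Y n)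
    (hφ : QuasiIso φ) : QuasiIso ψ :=
  quasiIso_of_homologyMap_eq (fun n => homologyMap_eq_of_sub_mem (h n)) hφ

lemma sub_mem_cobdry_of_δ_eq {k : Cochain X Y (-1)}
    (hk : δ (-1) 0 k = Cochain.ofHom φ - Cochain.ofHom ψ) (n : ℤ) {x : X.X n}
    (hx : x ∈ cocyc X n) : φ.f n x - ψ.f n x ∈ cobdry Y n := by
  have h := ConcreteCategory.congr_hom (Cochain.congr_v hk n n (add_zero n)) x
  rw [δ_v (-1) 0 (neg_add_cancel 1) k n n (add_zero n) (n - 1) (n + 1) rfl rfl] at h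
  rw [mem_cocyc rfl] at hx
  have h' : Y.d (n - 1) n (k.v n (n - 1) rfl x) + (0 : ℤ).negOnePow •
    k.v (n + 1) n (by omega) (X.d n (n + 1) x) = φ.f n x - ψ.f n x := by
      rw [Cochain.sub_v, Cochain.ofHom_v, Cochain.ofHom_v] at h
      exact h
  rw [hx, map_zero, smul_zero, add_zero] at h'
  rw [← h']
  exact d_mem_cobdry _ _ _

end HomotopicMaps

/-! ### Homotopies of DG modules and comparison of resolutions -/

namespace DGModule

section Comparison

variable {R : Type u} [CommRing R] {A : DGAlgebra.{u} R} {L M N P P' : DGModule A}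

lemma comp_mem {n m k : ℤ} {f : Cochain M.cx N.cx n} {g : Cochain N.cx L.cx m}
    (hf : f ∈ linearCochains M N n) (hg : g ∈ linearCochains N L m) (h : n + m = k) :
    f.comp g h ∈ linearCochains M L k := by
  subst h
  intro a b c b' c' habc hb hc x y
  rw [Cochain.comp_v f g rfl c (c + n) c' rfl (by omega),
    Cochain.comp_v f g rfl b (b + n) b' rfl (by omega), ModuleCat.comp_apply, ModuleCat.comp_apply,
    hf a b c (b + n) (c + n) habc rfl rfl, Units.smul_def, map_zsmul,
    hg a (b + n) (c + n) b' c' (by omega) (by omega) (by omega), ← Units.smul_def, smul_smul,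
    add_mul, Int.negOnePow_add]

lemma mem_cocyc_homDG {n m : ℤ} (h : n + 1 = m) {z : linearCochains M N n} :
    (z : (homDG M N).cx.X n) ∈ cocyc (homDG M N).cx n ↔ δ n m z.1 = 0 :=
  (mem_cocyc h).trans Subtype.ext_iff

lemma mem_cobdry_homDG {k n : ℤ} (h : k + 1 = n) {z : linearCochains M N n} :
    (z : (homDG M N).cx.X n) ∈ cobdry (homDG M N).cx n ↔
      ∃ y ∈ linearCochains M N k, δ k n y = z.1 := by
  refine (mem_cobdry h).trans ⟨?_, ?_⟩
  · rintro ⟨y, hy⟩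
    exact ⟨y.1, y.2, Subtype.ext_iff.1 hy⟩
  · rintro ⟨y, hy, hyz⟩
    exact ⟨(⟨y, hy⟩ : linearCochains M N k), Subtype.ext hyz⟩

lemma IsKProjective.exists_lift (hP : P.IsKProjective) {w : M ⟶ N} (hw : quasiIso A w)
    (y : Cochain P.cx N.cx 0) (hy : y ∈ linearCochains P N 0) (hδ : δ 0 1 y = 0) :
    ∃ x ∈ linearCochains P M 0, δ 0 1 x = 0 ∧ ∃ u ∈ linearCochains P N (-1),
      δ (-1) 0 u = y - x.comp (Cochain.ofHom w.hom) (add_zero 0) := by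
  obtain ⟨x, hx, hxy⟩ := ((quasiIso_iff_cocyc _).1 ((quasiIso_iff _).1 (hP w hw)) 0).2
    (⟨y, hy⟩ : linearCochains P N 0) ((mem_cocyc_homDG (zero_add 1)).2 hδ)
  obtain ⟨u, hu, hu'⟩ := (mem_cobdry_homDG (neg_add_cancel 1)).1 hxy
  exact ⟨x.1, x.2, (mem_cocyc_homDG (zero_add 1)).1 hx, u, hu, hu'⟩

lemma IsKProjective.exists_δ_eq (hP : P.IsKProjective) {w : M ⟶ N} (hw : quasiIso A w)
    (x : Cochain P.cx M.cx 0) (hx : x ∈ linearCochains P M 0) (hδ : δ 0 1 x = 0)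
    (v : Cochain P.cx N.cx (-1)) (hv : v ∈ linearCochains P N (-1))
    (h : δ (-1) 0 v = x.comp (Cochain.ofHom w.hom) (add_zero 0)) :
    ∃ u ∈ linearCochains P M (-1), δ (-1) 0 u = x :=
  (mem_cobdry_homDG (neg_add_cancel 1)).1 <|
    ((quasiIso_iff_cocyc _).1 ((quasiIso_iff _).1 (hP w hw)) 0).1
      (⟨x, hx⟩ : linearCochains P M 0) ((mem_cocyc_homDG (zero_add 1)).2 hδ)
      ((mem_cobdry_homDG (neg_add_cancel 1)).2 ⟨v, hv, h⟩)

lemma exists_hom_of_δ_eq_zero (z : Cochain M.cx N.cx 0) (hz : z ∈ linearCochains M N 0)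
    (hδ : δ 0 1 z = 0) : ∃ f : M ⟶ N, Cochain.ofHom f.hom = z := by
  have h : Cochain.ofHom (Cocycle.homOf (Cocycle.mk z 1 rfl hδ)) = z :=
    congrArg Subtype.val (Cocycle.ofHom_homOf_eq_self (Cocycle.mk z 1 rfl hδ))
  refine ⟨⟨Cocycle.homOf (Cocycle.mk z 1 rfl hδ), fun i j k hijk x m => ?_⟩, h⟩
  have := hz i j k j k hijk (add_zero j) (add_zero k) x m
  rwa [← h, Cochain.ofHom_v, Cochain.ofHom_v, zero_mul, Int.negOnePow_zero,
    MulAction.one_smul] at this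

/-- Up to homotopy, a morphism from a K-projective DG module lifts along a quasi-isomorphism. -/
lemma IsKProjective.exists_hom (hP : P.IsKProjective) {w : M ⟶ N} (hw : quasiIso A w)
    (f : P ⟶ N) : ∃ g : P ⟶ M, ∃ u ∈ linearCochains P N (-1),
      δ (-1) 0 u = Cochain.ofHom f.hom - Cochain.ofHom (g ≫ w).hom := by
  obtain ⟨x, hx, hδ, u, hu, hu'⟩ := hP.exists_lift hw (Cochain.ofHom f.hom) (ofHom_mem f)
    (δ_ofHom f.hom)
  obtain ⟨g, rfl⟩ := exists_hom_of_δ_eq_zero x hx hδ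
  exact ⟨g, u, hu, hu'.trans (congrArg _ (Cochain.ofHom_comp g.hom w.hom).symm)⟩

/-- The chain map `Hom_A(P', M) ⟶ Hom_A(P, M)` induced by a morphism `P ⟶ P'`. -/
noncomputable def homDGPre (g : P ⟶ P') (M : DGModule A) :
    (homDG P' M).cx ⟶ (homDG P M).cx where
  f n := ModuleCat.ofHom
    { toFun := fun z : linearCochains P' M n =>
        (⟨(Cochain.ofHom g.hom).comp z.1 (zero_add n), comp_mem (ofHom_mem g) z.2 (zero_add n)⟩ :
          linearCochains P M n)
      map_add' z w := Subtype.ext (Cochain.comp_add _ z.1 w.1 (zero_add n))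
      map_smul' r z := Subtype.ext (Cochain.comp_smul _ r z.1 (zero_add n)) }
  comm' n m _ := ModuleCat.hom_ext (LinearMap.ext
    fun z : linearCochains P' M n => Subtype.ext (δ_ofHom_comp g.hom z.1 m))

lemma δ_comp_of_δ_eq_zero {X Y Z : CochainComplex (ModuleCat.{u} R) ℤ} {n m : ℤ} (h : -1 + n = m)
    (h' : m + 1 = n) (k : Cochain X Y (-1)) (y : Cochain Y Z n) (hy : δ n (n + 1) y = 0) :
    δ m n (n.negOnePow • k.comp y h) = (δ (-1) 0 k).comp y (zero_add n) := by
  rw [δ_units_smul, δ_comp k y h 0 (n + 1) n h' rfl rfl, hy, Cochain.comp_zero, zero_add,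
    smul_smul, Int.units_mul_self, MulAction.one_smul]

lemma units_smul_mem {n : ℤ} {f : Cochain M.cx N.cx n} (ε : ℤˣ) (hf : f ∈ linearCochains M N n) :
    ε • f ∈ linearCochains M N n := by
  rw [Units.smul_def]
  exact zsmul_mem hf _

/-- A quasi-isomorphism between K-projective DG modules has a homotopy inverse. -/
lemma exists_homotopyInverse (hP : P.IsKProjective) (hP' : P'.IsKProjective) {g : P ⟶ P'}
    (hg : quasiIso A g) : ∃ g' : P' ⟶ P,
      (∃ k ∈ linearCochains P P (-1),
        δ (-1) 0 k = Cochain.ofHom (𝟙 P.cx) - Cochain.ofHom (g.hom ≫ g'.hom)) ∧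
      ∃ k ∈ linearCochains P' P' (-1),
        δ (-1) 0 k = Cochain.ofHom (𝟙 P'.cx) - Cochain.ofHom (g'.hom ≫ g.hom) := by
  obtain ⟨g', k', hk', e'⟩ := hP'.exists_hom hg (𝟙 P')
  have e' : δ (-1) 0 k' = Cochain.ofHom (𝟙 P'.cx) - Cochain.ofHom (g'.hom ≫ g.hom) := e'
  have hid : Cochain.ofHom (𝟙 P.cx) - Cochain.ofHom (g.hom ≫ g'.hom) ∈ linearCochains P P 0 :=
    sub_mem (ofHom_mem (𝟙 P)) (ofHom_mem (g ≫ g'))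
  obtain ⟨k, hk, e⟩ := hP.exists_δ_eq hg _ hid (by rw [δ_sub, δ_ofHom, δ_ofHom, sub_zero])
    ((Cochain.ofHom g.hom).comp k' (zero_add (-1))) (comp_mem (ofHom_mem g) hk' _) (by
      rw [δ_ofHom_comp, e', Cochain.comp_sub, Cochain.sub_comp, ← Cochain.ofHom_comp,
        ← Cochain.ofHom_comp, ← Cochain.ofHom_comp, ← Cochain.ofHom_comp, Category.id_comp,
        Category.comp_id, Category.assoc])
  exact ⟨g', ⟨k, hk, e⟩, k', hk', e'⟩

lemma quasiIso_homDGPre (hP : P.IsKProjective) (hP' : P'.IsKProjective) {g : P ⟶ P'}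
    (hg : quasiIso A g) (M : DGModule A) : QuasiIso (homDGPre g M) := by
  obtain ⟨g', ⟨k, hk, e⟩, k', hk', e'⟩ := exists_homotopyInverse hP hP' hg
  rw [quasiIso_iff_cocyc]
  refine fun n => ⟨fun (z : linearCochains P' M n) hz hgz => ?_,
    fun (z : linearCochains P M n) hz => ?_⟩
  · replace hz : δ n (n + 1) z.1 = 0 := (mem_cocyc_homDG rfl).1 hz
    obtain ⟨v, hv, hv'⟩ := (mem_cobdry_homDG (sub_add_cancel n 1)).1 hgz
    have h1 := δ_comp_of_δ_eq_zero (m := n - 1) (by omega) (by omega) k' z.1 hz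
    have hv'' : δ (n - 1) n v = (Cochain.ofHom g.hom).comp z.1 (zero_add n) := hv'
    refine (mem_cobdry_homDG (sub_add_cancel n 1)).2
      ⟨n.negOnePow • k'.comp z.1 (by omega) + (Cochain.ofHom g'.hom).comp v (zero_add _),
        add_mem (units_smul_mem _ (comp_mem hk' z.2 _)) (comp_mem (ofHom_mem g') hv _), ?_⟩
    rw [δ_add, h1, δ_ofHom_comp, hv'', e', Cochain.sub_comp, Cochain.ofHom_comp,
      Cochain.comp_assoc_of_first_is_zero_cochain, Cochain.id_comp, sub_add_cancel]
  · replace hz : δ n (n + 1) z.1 = 0 := (mem_cocyc_homDG rfl).1 hz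
    have h1 := δ_comp_of_δ_eq_zero (m := n - 1) (by omega) (by omega) k z.1 hz
    refine ⟨(⟨(Cochain.ofHom g'.hom).comp z.1 (zero_add n), comp_mem (ofHom_mem g') z.2 _⟩ :
      linearCochains P' M n), (mem_cocyc_homDG rfl).2 ?_,
      (mem_cobdry_homDG (sub_add_cancel n 1)).2
      ⟨n.negOnePow • k.comp z.1 (by omega), units_smul_mem _ (comp_mem hk z.2 _), ?_⟩⟩
    · rw [δ_ofHom_comp, hz, Cochain.comp_zero]
    · rw [h1, e, Cochain.sub_comp, Cochain.ofHom_comp,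
        Cochain.comp_assoc_of_first_is_zero_cochain, Cochain.id_comp]
      rfl

lemma homothety_homDGPre (g : P ⟶ P') (π : P' ⟶ M) :
    (homothety π).hom ≫ homDGPre g M = (homothety (g ≫ π)).hom := by
  ext1 n
  refine ModuleCat.hom_ext (LinearMap.ext fun x => Subtype.ext ?_)
  refine Cochain.ext _ _ fun p q h => ModuleCat.hom_ext (LinearMap.ext fun z => ?_)
  change ((Cochain.ofHom g.hom).comp (smulCochain M n 0 n (add_zero n) x (Cochain.ofHom π.hom))
    (zero_add n)).v p q h z =
      (smulCochain M n 0 n (add_zero n) x (Cochain.ofHom (g ≫ π).hom)).v p q h z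
  rw [Cochain.zero_cochain_comp_v, ModuleCat.comp_apply,
    smulCochain_apply M n 0 n (add_zero n) x _ p p q h (add_zero p),
    smulCochain_apply M n 0 n (add_zero n) x _ p p q h (add_zero p), Cochain.ofHom_v,
    Cochain.ofHom_v, Cochain.ofHom_v]
  rfl

lemma δ_smulCochain_of_d_eq_zero {X : CochainComplex (ModuleCat.{u} R) ℤ} (N : DGModule A)
    {i j k j' k' : ℤ} (h : i + j = k) (h' : i + j' = k') (hj : j + 1 = j') (hk : k + 1 = k')
    {x : A.cx.X i} (hx : A.cx.d i (i + 1) x = 0) (f : Cochain X N.cx j) :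
    δ k k' (smulCochain N i j k h x f) =
      i.negOnePow • smulCochain N i j' k' h' x (δ j j' f) := by
  subst hj hk
  have h0 : smulCochain N (i + 1) j (k + 1) (by omega) (A.cx.d i (i + 1) x) f = 0 := by
    rw [hx]
    ext
    simp [smulCochain]
  rw [δ_smulCochain N i j k h x f, h0, zero_add]

/-- Homotopic morphisms have homotopic homothety morphisms. -/
lemma homothety_sub_mem {π π' : P ⟶ M} {k : Cochain P.cx M.cx (-1)}
    (hk : k ∈ linearCochains P M (-1))
    (e : δ (-1) 0 k = Cochain.ofHom π.hom - Cochain.ofHom π'.hom) (n : ℤ) {x : A.cx.X n}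
    (hx : x ∈ cocyc A.cx n) :
    (homothety π).hom.f n x - (homothety π').hom.f n x ∈ cobdry (homDG P M).cx n := by
  rw [mem_cocyc rfl] at hx
  refine (mem_cobdry_homDG (z := (homothety π).hom.f n x - (homothety π').hom.f n x)
    (sub_add_cancel n 1)).2 ⟨n.negOnePow • smulCochain M n (-1) (n - 1) (by omega) x k,
    units_smul_mem _ (smulCochain_mem P M n (-1) (n - 1) (by omega) x k hk), ?_⟩
  rw [δ_units_smul, δ_smulCochain_of_d_eq_zero M _ (add_zero n) (neg_add_cancel 1)
    (sub_add_cancel n 1) hx, smul_smul, Int.units_mul_self, MulAction.one_smul, e]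
  refine Cochain.ext _ _ fun p q h => ModuleCat.hom_ext (LinearMap.ext fun z => ?_)
  change M.smul n (p + 0) q _ x ((Cochain.ofHom π.hom - Cochain.ofHom π'.hom).v p (p + 0) rfl z) =
    M.smul n (p + 0) q _ x ((Cochain.ofHom π.hom).v p (p + 0) rfl z) -
      M.smul n (p + 0) q _ x ((Cochain.ofHom π'.hom).v p (p + 0) rfl z)
  rw [← map_sub]
  rfl

/-- Whether the homothety morphism `A ⟶ RHom_A(M, M)` is a quasi-isomorphism does not depend on
the K-projective resolution used to compute it. -/
lemma quasiIso_homothety_of_quasiIso (hP : P.IsKProjective) (hP' : P'.IsKProjective) {π : P ⟶ M}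
    {π' : P' ⟶ M} (hπ : quasiIso A π) (hπ' : quasiIso A π')
    (h : QuasiIso (homothety π').hom) : QuasiIso (homothety π).hom := by
  obtain ⟨g, u, hu, e⟩ := hP.exists_hom hπ' π
  have hgπ : QuasiIso (g.hom ≫ π'.hom) :=
    quasiIso_of_sub_mem (fun n x hx => sub_mem_cobdry_of_δ_eq e n hx) hπ
  have hg : QuasiIso g.hom := by
    have : QuasiIso π'.hom := hπ'
    exact (quasiIso_iff_comp_right g.hom π'.hom).1 hgπ
  have h1 := quasiIso_homDGPre hP hP' hg M
  have h2 : QuasiIso (homothety (g ≫ π')).hom := by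
    rw [← homothety_homDGPre]
    infer_instance
  refine quasiIso_of_sub_mem (φ := (homothety (g ≫ π')).hom) (fun n x hx => ?_) h2
  have := homothety_sub_mem hu e n hx
  rw [← neg_sub]
  exact neg_mem this

end Comparison

/-! ### Morphisms in the derived category of DG modules -/

section Derived

open Localization.Construction

variable {R : Type u} [CommRing R] {A : DGAlgebra.{u} R} {M N P : DGModule A}

/-- The homology functors on DG modules. -/
noncomputable def homologyFunctor (A : DGAlgebra.{u} R) (n : ℤ) : DGModule A ⥤ ModuleCat.{u} R :=
  forget A ⋙ HomologicalComplex.homologyFunctor _ _ n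

lemma quasiIso_isInvertedBy_homologyFunctor (n : ℤ) :
    (quasiIso A).IsInvertedBy (homologyFunctor A n) := fun _ _ f hf => by
  rw [quasiIso_iff, _root_.quasiIso_iff] at hf
  exact (quasiIsoAt_iff_isIso_homologyMap _ _).1 (hf n)

/-- The homology functors on the derived category of DG modules. -/
noncomputable def derivedHomology (A : DGAlgebra.{u} R) (n : ℤ) : Derived A ⥤ ModuleCat.{u} R :=
  lift (homologyFunctor A n) (quasiIso_isInvertedBy_homologyFunctor n)

lemma derivedHomology_map (n : ℤ) (f : M ⟶ N) : (derivedHomology A n).map ((Q A).map f) =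
    HomologicalComplex.homologyMap f.hom n :=
  (Functor.congr_hom (fac (homologyFunctor A n) (quasiIso_isInvertedBy_homologyFunctor n))
    f).trans (by simp; rfl)

lemma isIso_Q_map_iff (f : M ⟶ N) : IsIso ((Q A).map f) ↔ QuasiIso f.hom := by
  constructor
  · intro h
    rw [_root_.quasiIso_iff]
    intro n
    rw [quasiIsoAt_iff_isIso_homologyMap, ← derivedHomology_map]
    exact Functor.map_isIso (derivedHomology A n) ((Q A).map f)
  · exact fun h => (quasiIso A).Q_inverts f h

/-- On homology, a morphism from a K-projective DG module in the derived category is induced by a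
morphism of DG modules. -/
lemma IsKProjective.exists_homologyMap_eq (hP : P.IsKProjective)
    (ψ : (Q A).obj P ⟶ (Q A).obj N) : ∃ f : P ⟶ N, ∀ n,
      HomologicalComplex.homologyMap f.hom n = (derivedHomology A n).map ψ := by
  -- The morphisms `X ⟶ Y` that send maps `H(P) ⟶ H(X)` induced by DG morphisms to such maps.
  -- The localization is generated by morphisms of DG modules and inverses of quasi-isomorphisms.
  let T : MorphismProperty (Derived A) := fun X Y ψ =>
    ∀ f : P ⟶ (objEquiv (quasiIso A)).symm X, ∃ g : P ⟶ (objEquiv (quasiIso A)).symm Y, ∀ n,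
      (HomologicalComplex.homologyMap g.hom n : P.cx.homology n ⟶ (derivedHomology A n).obj Y) =
        (HomologicalComplex.homologyMap f.hom n : P.cx.homology n ⟶
          (derivedHomology A n).obj X) ≫ (derivedHomology A n).map ψ
  have : T.IsStableUnderComposition := ⟨fun {X Y Z} φ ψ hφ hψ f => by
    obtain ⟨g, hg⟩ := hφ f
    obtain ⟨k, hk⟩ := hψ g
    refine ⟨k, fun n => (hk n).trans ?_⟩
    refine (congrArg (· ≫ (derivedHomology A n).map ψ) (hg n)).trans
      ((Category.assoc _ _ _).trans (congrArg _ ?_))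
    exact ((derivedHomology A n).map_comp φ ψ).symm⟩
  have hT : T = ⊤ := by
    refine morphismProperty_eq_top T (fun X Y w f => ⟨f ≫ w, fun n => ?_⟩) fun X Y w hw f => ?_
    · rw [derivedHomology_map]
      exact HomologicalComplex.homologyMap_comp _ _ _
    · obtain ⟨g, u, hu, e⟩ := hP.exists_hom hw f
      refine ⟨g, fun n => ?_⟩
      have h1 : HomologicalComplex.homologyMap f.hom n =
          HomologicalComplex.homologyMap g.hom n ≫ HomologicalComplex.homologyMap w.hom n :=
        (homologyMap_eq_of_sub_mem fun x hx => sub_mem_cobdry_of_δ_eq e n hx).trans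
          (HomologicalComplex.homologyMap_comp _ _ _)
      have h2 : HomologicalComplex.homologyMap w.hom n ≫
          (derivedHomology A n).map (wInv w hw) = 𝟙 _ := by
        rw [← derivedHomology_map]
        refine ((derivedHomology A n).map_comp ((Q A).map w) (wInv w hw)).symm.trans ?_
        exact (congrArg _ (wIso w hw).hom_inv_id).trans ((derivedHomology A n).map_id _)
      refine Eq.symm ((congrArg (· ≫ (derivedHomology A n).map (wInv w hw)) h1).trans ?_)
      exact (Category.assoc _ _ _).trans ((congrArg _ h2).trans (Category.comp_id _))
  have hψ : T ψ := hT ▸ MorphismProperty.top_apply ψ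
  obtain ⟨g, hg⟩ := hψ (𝟙 P)
  refine ⟨g, fun n => (hg n).trans ?_⟩
  refine (congrArg (· ≫ (derivedHomology A n).map ψ)
    (HomologicalComplex.homologyMap_id P.cx n)).trans (Category.id_comp _)

/-- An isomorphism in the derived category is represented by a quasi-isomorphism out of a
K-projective resolution of its source. -/
lemma IsKProjective.exists_quasiIso (hP : P.IsKProjective) {κ : P ⟶ M} (hκ : QuasiIso κ.hom)
    (ψ : (Q A).obj M ≅ (Q A).obj N) : ∃ f : P ⟶ N, QuasiIso f.hom := by
  have := (isIso_Q_map_iff κ).2 hκ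
  obtain ⟨f, hf⟩ := hP.exists_homologyMap_eq ((Q A).map κ ≫ ψ.hom)
  refine ⟨f, (_root_.quasiIso_iff _).2 fun n => ?_⟩
  rw [quasiIsoAt_iff_isIso_homologyMap, hf]
  exact Functor.map_isIso (derivedHomology A n) ((Q A).map κ ≫ ψ.hom)

end Derived

end DGModule

/-! ### Resolutions by finitely generated free modules -/

section Resolution

variable {R : Type u} [CommRing R]

/-- A step in the construction of a free resolution of `C`, from the top degree downwards: the
module `V` in degree `n`, the submodule `Z` of its cocycles, and the map `φ` to `C`, such that `Z`
generates the cocycles of `C` modulo coboundaries. -/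
structure ResolutionStep (C : CochainComplex (ModuleCat.{u} R) ℤ) (n : ℤ) where
  /-- the module in degree `n` -/
  V : ModuleCat.{u} R
  free : Module.Free R V
  finite : Module.Finite R V
  /-- the cocycles -/
  Z : Submodule R V
  /-- the map to `C` -/
  φ : V →ₗ[R] C.X n
  le_sup : cocyc C n ≤ Z.map φ ⊔ cobdry C n

namespace ResolutionStep

attribute [instance] ResolutionStep.free ResolutionStep.finite

variable {C : CochainComplex (ModuleCat.{u} R) ℤ}

/-- The differential `d` connects two consecutive steps of a resolution. -/
structure IsDifferential {m n : ℤ} (s : ResolutionStep C m) (t : ResolutionStep C n)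
    (d : s.V →ₗ[R] t.V) : Prop where
  ker_eq : LinearMap.ker d = s.Z
  range_eq : LinearMap.range d = t.Z ⊓ (cobdry C n).comap t.φ
  comm (v : s.V) : C.d m n (s.φ v) = t.φ (d v)

/-- A step can be extended to the next lower degree: the new module has generators that kill the
cocycles with image a coboundary in `C`, and generators that map onto the homology of `C`. -/
lemma exists_isDifferential [IsNoetherianRing R] (hC : HomologicallyDegreewiseFinite C) {m n : ℤ}
    (h : m + 1 = n) (t : ResolutionStep C n) :
    ∃ (s : ResolutionStep C m) (d : s.V →ₗ[R] t.V), IsDifferential s t d := by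
  obtain ⟨r, g, hg⟩ := Module.Finite.exists_fin' R (t.Z ⊓ (cobdry C n).comap t.φ : Submodule R t.V)
  have := hC m
  obtain ⟨q, f, hf⟩ := Module.Finite.exists_fin' R (C.homology m)
  have h1 : ∀ i, ∃ c : C.X m, C.d m n c = t.φ (g (Pi.single i 1)).1 := fun i =>
    (mem_cobdry h).1 (g (Pi.single i 1)).2.2
  choose c hc using h1
  have h2 : ∀ i, ∃ x : cocyc C m, homologyClass C m x = f (Pi.single i 1) := fun i =>
    homologyClass_surjective C m _
  choose x hx using h2
  let γ : (Fin r → R) →ₗ[R] C.X m := Fintype.linearCombination R c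
  let ξ : (Fin q → R) →ₗ[R] cocyc C m := Fintype.linearCombination R x
  have hγ : ∀ v, C.d m n (γ v) = t.φ (g v).1 := by
    have : (C.d m n).hom ∘ₗ γ = t.φ ∘ₗ (Submodule.subtype _) ∘ₗ g := by
      refine LinearMap.pi_ext' fun i => LinearMap.ext_ring ?_
      change C.d m n (γ (Pi.single i 1)) = t.φ (g (Pi.single i 1)).1
      rw [← hc, Fintype.linearCombination_apply_single, one_smul]
    exact LinearMap.congr_fun this
  have hξ : ∀ v, homologyClass C m (ξ v) = f v := by
    have : homologyClass C m ∘ₗ ξ = f := by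
      refine LinearMap.pi_ext' fun i => LinearMap.ext_ring ?_
      change homologyClass C m (ξ (Pi.single i 1)) = f (Pi.single i 1)
      rw [← hx, Fintype.linearCombination_apply_single, one_smul]
    exact LinearMap.congr_fun this
  let d : ((Fin r → R) × (Fin q → R)) →ₗ[R] t.V :=
    (Submodule.subtype _ ∘ₗ g) ∘ₗ LinearMap.fst R _ _
  let φ : ((Fin r → R) × (Fin q → R)) →ₗ[R] C.X m :=
    γ ∘ₗ LinearMap.fst R _ _ + ((cocyc C m).subtype ∘ₗ ξ) ∘ₗ LinearMap.snd R _ _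
  have hd : ∀ v, C.d m n (φ v) = t.φ (d v) := fun v => by
    change C.d m n (γ v.1 + (ξ v.2).1) = t.φ (g v.1).1
    rw [map_add, hγ, (mem_cocyc h).1 (ξ v.2).2, add_zero]
  refine ⟨⟨ModuleCat.of R ((Fin r → R) × (Fin q → R)), inferInstanceAs
    (Module.Free R ((Fin r → R) × (Fin q → R))), inferInstanceAs
    (Module.Finite R ((Fin r → R) × (Fin q → R))), LinearMap.ker d, φ, ?_⟩, d, rfl, ?_, hd⟩
  · intro y hy
    obtain ⟨v, hv⟩ := hf (homologyClass C m ⟨y, hy⟩)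
    rw [← hξ, ← sub_eq_zero, ← map_sub, homologyClass_eq_zero_iff] at hv
    refine Submodule.mem_sup.2 ⟨(ξ v).1, ⟨(0, v), ?_, ?_⟩, y - (ξ v).1, ?_, add_sub_cancel _ _⟩
    · change (g 0).1 = 0
      rw [map_zero]
      rfl
    · change γ 0 + (ξ v).1 = _
      rw [map_zero, zero_add]
    · rw [← neg_sub]
      exact neg_mem hv
  · change LinearMap.range ((Submodule.subtype _ ∘ₗ g) ∘ₗ LinearMap.fst R _ _) = _
    rw [LinearMap.range_comp, LinearMap.range_eq_top.2 LinearMap.fst_surjective,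
      Submodule.map_top, LinearMap.range_comp, LinearMap.range_eq_top.2 hg, Submodule.map_top,
      Submodule.range_subtype]

/-- The zero module as a step, in a degree in which `C` is exact. -/
noncomputable def trivial (C : CochainComplex (ModuleCat.{u} R) ℤ) (n : ℤ)
    (h : Limits.IsZero (C.homology n)) : ResolutionStep C n where
  V := ModuleCat.of R PUnit.{u + 1}
  free := inferInstanceAs (Module.Free R PUnit.{u + 1})
  finite := inferInstanceAs (Module.Finite R PUnit.{u + 1})
  Z := ⊤
  φ := 0
  le_sup := ((isZero_homology_iff n).1 h).trans le_sup_right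

lemma exists_steps [IsNoetherianRing R] (hC : HomologicallyDegreewiseFinite C) (N : ℤ)
    (hN : ∀ n, N < n → Limits.IsZero (C.homology n)) :
    ∃ S : ∀ n, ResolutionStep C n, (∀ n, N < n → Subsingleton (S n).V) ∧
      ∀ m n, m + 1 = n → ∃ d, IsDifferential (S m) (S n) d := by
  choose next hnext using fun (n : ℤ) (t : ResolutionStep C n) =>
    exists_isDifferential hC (sub_add_cancel n 1) t
  let S (n : ℤ) : ResolutionStep C n := n.inductionOn' (N + 1)
    (trivial C (N + 1) (hN _ (by omega))) (fun k hk _ => trivial C (k + 1) (hN _ (by omega)))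
    fun k _ t => next k t
  have hS : ∀ n (hn : N < n), S n = trivial C n (hN n hn) := by
    intro n hn
    obtain rfl | h := eq_or_lt_of_le (show N + 1 ≤ n by omega)
    · exact Int.inductionOn'_self
    · obtain ⟨m, rfl⟩ : ∃ m, n = m + 1 := ⟨n - 1, by omega⟩
      exact Int.inductionOn'_add_one (by omega)
  have hsub : ∀ n, N < n → Subsingleton (S n).V := fun n hn => by
    rw [hS n hn]
    exact inferInstanceAs (Subsingleton PUnit.{u + 1})
  refine ⟨S, hsub, fun m n h => ?_⟩
  obtain rfl : m = n - 1 := by omega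
  by_cases hn : n ≤ N + 1
  · have : S (n - 1) = next n (S n) := Int.inductionOn'_sub_one hn
    rw [this]
    exact hnext n (S n)
  · have := hsub (n - 1) (by omega)
    have := hsub n (by omega)
    refine ⟨0, ?_, ?_, fun v => ?_⟩
    · rw [hS (n - 1) (by omega), LinearMap.ker_zero]
      rfl
    · exact Subsingleton.elim _ _
    · rw [Subsingleton.elim v 0, map_zero, map_zero, map_zero, map_zero]

end ResolutionStep

open ResolutionStep in
/-- A complex with finitely generated homology that vanishes in large degrees has a resolution by
finitely generated free modules that vanish in large degrees. -/
lemma exists_free_resolution [IsNoetherianRing R] {C : CochainComplex (ModuleCat.{u} R) ℤ}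
    (hC : HomologicallyDegreewiseFinite C) (N : ℤ)
    (hN : ∀ n, N < n → Limits.IsZero (C.homology n)) :
    ∃ (L : CochainComplex (ModuleCat.{u} R) ℤ) (π : L ⟶ C), (∀ n, Module.Free R (L.X n)) ∧
      (∀ n, Module.Finite R (L.X n)) ∧ (∀ n, N < n → Limits.IsZero (L.X n)) ∧ QuasiIso π := by
  obtain ⟨S, hS, hd⟩ := exists_steps hC N hN
  choose d hd using hd
  have hdd : ∀ i j k (hij : i + 1 = j) (hjk : j + 1 = k) (v : (S i).V),
      d j k hjk (d i j hij v) = 0 := fun i j k hij hjk v => by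
    have : d i j hij v ∈ LinearMap.range (d i j hij) := ⟨v, rfl⟩
    rw [(hd i j hij).range_eq, ← (hd j k hjk).ker_eq] at this
    exact this.1
  let L : CochainComplex (ModuleCat.{u} R) ℤ :=
    { X n := (S n).V
      d i j := if h : i + 1 = j then ModuleCat.ofHom (d i j h) else 0
      shape i j h := dif_neg h
      d_comp_d' i j k hij hjk := by
        rw [dif_pos (show i + 1 = j from hij), dif_pos (show j + 1 = k from hjk)]
        exact ModuleCat.hom_ext (LinearMap.ext (hdd i j k hij hjk)) }
  have hL : ∀ i j (h : i + 1 = j) (v : (S i).V), L.d i j v = d i j h v := fun i j h v =>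
    ConcreteCategory.congr_hom (show L.d i j = ModuleCat.ofHom (d i j h) from dif_pos h) v
  let π : L ⟶ C :=
    { f n := ModuleCat.ofHom (S n).φ
      comm' i j h := by
        refine ModuleCat.hom_ext (LinearMap.ext fun v => ((hd i j h).comm v).trans ?_)
        exact congrArg (S j).φ (hL i j h v).symm }
  have hZ : ∀ n (v : (S n).V), (v : L.X n) ∈ cocyc L n ↔ v ∈ (S n).Z := fun n v => by
    rw [← (hd n (n + 1) rfl).ker_eq, LinearMap.mem_ker, ← hL]
    exact mem_cocyc rfl
  have hB : ∀ n (v : (S n).V), (v : L.X n) ∈ cobdry L n ↔ v ∈ (S n).Z ∧ (S n).φ v ∈ cobdry C n :=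
    fun n v => by
      refine (mem_cobdry (sub_add_cancel n 1)).trans ?_
      refine Iff.trans ?_ (SetLike.ext_iff.1 (hd (n - 1) n (sub_add_cancel n 1)).range_eq v)
      exact exists_congr fun w => by rw [← hL]
  refine ⟨L, π, fun n => (S n).free, fun n => (S n).finite,
    fun n hn => ModuleCat.isZero_iff_subsingleton.2 (hS n hn), ?_⟩
  rw [quasiIso_iff_cocyc]
  refine fun n => ⟨fun v hv hv' => (hB n v).2 ⟨(hZ n v).1 hv, hv'⟩, fun y hy => ?_⟩
  obtain ⟨_, ⟨v, hv, rfl⟩, b, hb, rfl⟩ := Submodule.mem_sup.1 ((S n).le_sup hy)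
  refine ⟨v, (hZ n v).2 hv, ?_⟩
  change (S n).φ v + b - (S n).φ v ∈ _
  rwa [add_sub_cancel_left]

lemma isKProjective_of_free {L : CochainComplex (ModuleCat.{u} R) ℤ}
    (hL : ∀ n, Module.Free R (L.X n)) {N : ℤ} (hN : ∀ n, N < n → Limits.IsZero (L.X n)) :
    L.IsKProjective := by
  have : L.IsStrictlyLE N := (CochainComplex.isStrictlyLE_iff L N).2 hN
  have : ∀ n, Projective (L.X n) := fun n =>
    (IsProjective.iff_projective (R := R) (L.X n)).1 inferInstance
  exact CochainComplex.isKProjective_of_projective L N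

/-- Only finitely many components of a cochain of a given degree can be nonzero. -/
lemma finite_cochain [IsNoetherianRing R] {L T : CochainComplex (ModuleCat.{u} R) ℤ}
    (hL' : ∀ n, Module.Finite R (L.X n)) {N : ℤ}
    (hN : ∀ n, N < n → Limits.IsZero (L.X n)) (hT : ∀ n, Module.Finite R (T.X n)) {b : ℤ}
    (hb : ∀ n, n < b → Limits.IsZero (T.X n)) (n : ℤ) : Module.Finite R (Cochain L T n) := by
  let ρ : Cochain L T n →ₗ[R] ∀ p : Finset.Icc (b - n) N, L.X p.1 →ₗ[R] T.X (p.1 + n) :=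
    { toFun z p := (z.v p.1 (p.1 + n) rfl).hom
      map_add' _ _ := rfl
      map_smul' _ _ := rfl }
  refine Module.Finite.of_injective ρ fun z z' h => Cochain.ext _ _ fun p q hpq => ?_
  subst hpq
  by_cases hp : p ∈ Finset.Icc (b - n) N
  · exact ModuleCat.hom_ext (congrFun h ⟨p, hp⟩)
  · rw [Finset.mem_Icc, not_and_or] at hp
    obtain hp | hp := hp
    · exact (hb _ (by omega)).eq_of_tgt _ _
    · exact (hN _ (by omega)).eq_of_src _ _

/-- The homology of `RHom(C, C')` is degreewise finitely generated if `C` has a resolution by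
finitely generated free modules that vanish in large degrees, and `C'` is homologically finite. -/
lemma finite_homology_homCx [IsNoetherianRing R] {L C : CochainComplex (ModuleCat.{u} R) ℤ}
    (hL : ∀ n, Module.Free R (L.X n)) (hL' : ∀ n, Module.Finite R (L.X n)) {N : ℤ}
    (hN : ∀ n, N < n → Limits.IsZero (L.X n)) (hC : HomologicallyFinite C) :
    HomologicallyDegreewiseFinite (homCx L C) := by
  obtain ⟨⟨b, hb⟩, hfin⟩ := hC
  obtain ⟨L', π, -, hf, -, hπ⟩ := exists_free_resolution hfin b
    fun n hn => hb n (hn.trans_le (le_abs_self n))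
  have : L.IsKProjective := isKProjective_of_free hL hN
  have hGE : L'.IsGE (-b) := by
    rw [CochainComplex.isGE_iff]
    intro i hi
    rw [HomologicalComplex.exactAt_iff_isZero_homology]
    exact (hb i ((neg_le_abs i).trans_lt' (by omega))).of_iso
      (asIso (HomologicalComplex.homologyMap π i))
  have hT : ∀ n, Module.Finite R ((L'.truncGE (-b)).X n) := fun n =>
    Module.Finite.of_surjective ((L'.πTruncGE (-b)).f n).hom
      ((ModuleCat.epi_iff_surjective _).1
        (inferInstanceAs (Epi ((HomologicalComplex.πTruncGE L' _).f n))))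
  -- `C` is replaced by a bounded complex of finitely generated modules
  have h1 := quasiIso_homCxMap (P := L) π
  have h2 := quasiIso_homCxMap (P := L) (L'.πTruncGE (-b))
  intro n
  have : Module.Finite R ((homCx L (L'.truncGE (-b))).X n) := finite_cochain hL' hN hT
    (fun i hi => CochainComplex.isZero_of_isStrictlyGE _ (-b) i hi) n
  have := finite_homology_of_finite (X := homCx L (L'.truncGE (-b))) n
  have := finite_homology_of_quasiIso' (homCxMap L (L'.πTruncGE (-b))) n
  exact finite_homology_of_quasiIso (homCxMap L π) n

end Resolution

/-! ### Semidualizing complexes and semidualizing DG modules -/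

section Semidualizing

open HomologicalComplex (tensorObj)
open DGModule (tensorMap tensorUnit restrictHom homDG homDGMap homothety)

variable {R : Type u} [CommRing R] {C C' : CochainComplex (ModuleCat.{u} R) ℤ}

lemma isZero_homology_iff_of_quasiIso {X Y : CochainComplex (ModuleCat.{u} R) ℤ} (φ : X ⟶ Y)
    [QuasiIso φ] (n : ℤ) : Limits.IsZero (X.homology n) ↔ Limits.IsZero (Y.homology n) :=
  (asIso (HomologicalComplex.homologyMap φ n)).isZero_iff

lemma koszulTensorTower_finite (hC : HomologicallyDegreewiseFinite C) :
    HomologicallyDegreewiseFinite ((koszulTensorTower C).cx (![] : Fin 0 → R)) := fun n =>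
  have := quasiIso_koszulUnit_zero (![] : Fin 0 → R) C
  have := hC n
  finite_homology_of_quasiIso (koszulUnit (![] : Fin 0 → R) C) n

lemma koszulTensorTower_bounded (hC : HomologicallyBounded C) :
    HomologicallyBounded ((koszulTensorTower C).cx (![] : Fin 0 → R)) := by
  have := quasiIso_koszulUnit_zero (![] : Fin 0 → R) C
  obtain ⟨b, hb⟩ := hC
  exact ⟨b, fun n hn =>
    (isZero_homology_iff_of_quasiIso (koszulUnit (![] : Fin 0 → R) C) n).1 (hb n hn)⟩

lemma quasiIso_koszulTensorTowerMap_zero_iff (g : C ⟶ C') :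
    QuasiIso ((koszulTensorTowerMap g).app (![] : Fin 0 → R)) ↔ QuasiIso g := by
  have h1 := quasiIso_koszulUnit_zero (![] : Fin 0 → R) C
  have h2 := quasiIso_koszulUnit_zero (![] : Fin 0 → R) C'
  have e : koszulUnit (![] : Fin 0 → R) C ≫ (koszulTensorTowerMap g).app ![] =
      g ≫ koszulUnit (![] : Fin 0 → R) C' :=
    DGModule.tensorUnit_tensorMap (A := koszul (![] : Fin 0 → R)) g
  have h3 := quasiIso_iff_comp_left (koszulUnit (![] : Fin 0 → R) C)
    ((koszulTensorTowerMap g).app (![] : Fin 0 → R))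
  rw [e] at h3
  exact h3.symm.trans (quasiIso_iff_comp_right g (koszulUnit (![] : Fin 0 → R) C'))

variable {e : ℕ} (a : Fin e → R)

lemma quasiIso_tensorMap (g : C ⟶ C') (hg : QuasiIso g) :
    QuasiIso (tensorMap (koszul a) g).hom :=
  (koszulTensorTowerMap g).quasiIso ((quasiIso_koszulTensorTowerMap_zero_iff g).2 hg) a

lemma quasiIso_of_quasiIso_tensorMap [IsNoetherianRing R] [IsLocalRing R]
    (ha : ∀ i, a i ∈ IsLocalRing.maximalIdeal R) (hC : HomologicallyDegreewiseFinite C)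
    (hC' : HomologicallyDegreewiseFinite C') (g : C ⟶ C')
    (hg : QuasiIso (tensorMap (koszul a) g).hom) : QuasiIso g :=
  (quasiIso_koszulTensorTowerMap_zero_iff g).1 <|
    (koszulTensorTowerMap g).quasiIso_base (koszulTensorTower_finite hC)
      (koszulTensorTower_finite hC') a ha hg

lemma HomologicallyFinite.tensor [IsNoetherianRing R] (hC : HomologicallyFinite C) :
    HomologicallyFinite (DGModule.tensor (koszul a) C).cx :=
  ⟨(koszulTensorTower C).bounded (koszulTensorTower_bounded hC.1) a,
    (koszulTensorTower C).finite (koszulTensorTower_finite hC.2) a⟩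

lemma isSemidualizing_tensor [IsNoetherianRing R] [HasDerivedCategory.{w} (ModuleCat.{u} R)]
    (hC : IsSemidualizing C) : DGModule.IsSemidualizing (DGModule.tensor (koszul a) C) := by
  obtain ⟨hfin, P, π, hP, hπ, hiso⟩ := hC
  refine ⟨hfin.tensor a, DGModule.tensor (koszul a) P, tensorMap (koszul a) π,
    DGModule.isKProjective_tensor, quasiIso_tensorMap a π hπ, ?_⟩
  rw [DerivedCategory.isIso_Q_map_iff_quasiIso] at hiso
  rw [DGModule.isIso_Q_map_iff, DGModule.quasiIso_homothety_iff]
  exact (koszulHomothety π).quasiIso ((quasiIso_tensorHomothety_zero_iff π _).2 hiso) a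

/-- If `K ⊗ C` is semidualizing, then `C` is homologically finite, and the homothety morphism of
`K ⊗ C` can be computed with the resolution `K ⊗ L` for a free resolution `L` of `C`. -/
lemma exists_resolution_of_isSemidualizing_tensor [IsNoetherianRing R] [IsLocalRing R]
    (ha : ∀ i, a i ∈ IsLocalRing.maximalIdeal R) (hC : HomologicallyDegreewiseFinite C)
    (hK : DGModule.IsSemidualizing (DGModule.tensor (koszul a) C)) :
    HomologicallyBounded C ∧ ∃ (L : CochainComplex (ModuleCat.{u} R) ℤ) (π : L ⟶ C) (N : ℤ),
      (∀ n, Module.Free R (L.X n)) ∧ (∀ n, Module.Finite R (L.X n)) ∧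
      (∀ n, N < n → Limits.IsZero (L.X n)) ∧ QuasiIso π ∧
      QuasiIso (homothety (tensorMap (koszul a) π)).hom := by
  obtain ⟨⟨⟨b, hb⟩, -⟩, P, κ, hP, hκ, hiso⟩ := hK
  have hb' : ∀ n, b < |n| → Limits.IsZero (C.homology n) := fun n hn => by
    have := quasiIso_koszulUnit_zero (![] : Fin 0 → R) C
    exact (isZero_homology_iff_of_quasiIso (koszulUnit (![] : Fin 0 → R) C) n).2
      ((koszulTensorTower C).isZero_base (koszulTensorTower_finite hC) n a ha (hb n hn))
  obtain ⟨L, π, hL, hL', hN, hπ⟩ := exists_free_resolution hC b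
    fun n hn => hb' n (hn.trans_le (le_abs_self n))
  have := isKProjective_of_free hL hN
  exact ⟨⟨b, hb'⟩, L, π, b, hL, hL', hN, hπ, DGModule.quasiIso_homothety_of_quasiIso
    DGModule.isKProjective_tensor hP (quasiIso_tensorMap a π hπ) hκ
    ((DGModule.isIso_Q_map_iff _).1 hiso)⟩

lemma homologicallyDegreewiseFinite_koszulTower_zero [IsNoetherianRing R] :
    HomologicallyDegreewiseFinite ((koszulTower R).cx (![] : Fin 0 → R)) := fun n => by
  have : Module.Finite R ((koszulComplex (![] : Fin 0 → R)).X n) := by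
    by_cases hn : n = 0
    · subst hn
      refine Module.Finite.of_surjective (LinearMap.toSpanSingleton R
        ((koszulComplex (![] : Fin 0 → R)).X 0) (koszulOne _)) fun x => ?_
      obtain ⟨r, rfl⟩ := eq_smul_koszulOne _ x
      exact ⟨r, rfl⟩
    · change Module.Finite R (koszulComponent R 0 n)
      rw [koszulComponent_zero_eq_bot hn]
      infer_instance
  exact finite_homology_of_finite (X := koszulComplex (![] : Fin 0 → R)) n

lemma isSemidualizing_of_tensor [IsNoetherianRing R] [IsLocalRing R]
    [HasDerivedCategory.{w} (ModuleCat.{u} R)]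
    (ha : ∀ i, a i ∈ IsLocalRing.maximalIdeal R) (hC : HomologicallyDegreewiseFinite C)
    (hK : DGModule.IsSemidualizing (DGModule.tensor (koszul a) C)) : IsSemidualizing C := by
  obtain ⟨hb, L, π, N, hL, hL', hN, hπ, hh⟩ :=
    exists_resolution_of_isSemidualizing_tensor a ha hC hK
  have := isKProjective_of_free hL hN
  refine ⟨⟨hb, hC⟩, L, π, this, hπ, ?_⟩
  rw [DGModule.quasiIso_homothety_iff] at hh
  rw [DerivedCategory.isIso_Q_map_iff_quasiIso, ← quasiIso_tensorHomothety_zero_iff π ![]]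
  exact (koszulHomothety π).quasiIso_base homologicallyDegreewiseFinite_koszulTower_zero
    (finite_homology_homCx hL hL' hN
      ⟨koszulTensorTower_bounded hb, koszulTensorTower_finite hC⟩) a ha hh

lemma isZero_koszulComplex_homology {n : ℤ} (hn : 0 < n) :
    Limits.IsZero ((koszulComplex a).homology n) := by
  rw [isZero_homology_iff]
  intro x _
  have hx : x = 0 := Subtype.ext ((Submodule.eq_bot_iff (koszulComponent R e n)).1
    (if_neg (by omega)) x.1 x.2)
  rw [hx]
  exact Submodule.zero_mem _

/-- If the homothety morphism of `K ⊗ C` is an isomorphism and `K ⊗ C ≃ K ⊗ C'`, then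
`RHom(C, K ⊗ C') ≃ RHom_K(K ⊗ C, K ⊗ C') ≃ K` has no cohomology in positive degrees. -/
lemma isZero_homCx_homology {L : CochainComplex (ModuleCat.{u} R) ℤ} [L.IsKProjective] {π : L ⟶ C}
    (hπ : QuasiIso π) (hh : QuasiIso (homothety (tensorMap (koszul a) π)).hom)
    {f : DGModule.tensor (koszul a) L ⟶ DGModule.tensor (koszul a) C'} (hf : QuasiIso f.hom)
    {n : ℤ} (hn : 0 < n) :
    Limits.IsZero ((homCx L (DGModule.tensor (koszul a) C').cx).homology n) := by
  have hκ := quasiIso_tensorMap a π hπ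
  have h1 : QuasiIso (homDGMap (DGModule.tensor (koszul a) L) (tensorMap (koszul a) π)).hom :=
    DGModule.isKProjective_tensor _ hκ
  have h2 : QuasiIso (homDGMap (DGModule.tensor (koszul a) L) f).hom :=
    DGModule.isKProjective_tensor _ hf
  rw [← isZero_homology_iff_of_quasiIso (restrictHom L (DGModule.tensor (koszul a) C')),
    ← isZero_homology_iff_of_quasiIso (homDGMap (DGModule.tensor (koszul a) L) f).hom,
    isZero_homology_iff_of_quasiIso
      (homDGMap (DGModule.tensor (koszul a) L) (tensorMap (koszul a) π)).hom,
    ← isZero_homology_iff_of_quasiIso (homothety (tensorMap (koszul a) π)).hom]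
  exact isZero_koszulComplex_homology a hn

/-- A morphism `K ⊗ L ⟶ K ⊗ C'` of DG modules is homotopic to `K ⊗ φ` for some `φ : L ⟶ C'` if
`RHom(L, K ⊗ C')` has no cohomology in positive degrees. -/
lemma exists_tensorMap_homotopic [IsNoetherianRing R] [IsLocalRing R]
    (ha : ∀ i, a i ∈ IsLocalRing.maximalIdeal R) {L : CochainComplex (ModuleCat.{u} R) ℤ}
    [L.IsKProjective]
    (h0 : HomologicallyDegreewiseFinite ((koszulHomTower L C').cx (![] : Fin 0 → R)))
    (h : ∀ n, 0 < n →
      Limits.IsZero ((homCx L (DGModule.tensor (koszul a) C').cx).homology n))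
    (f : DGModule.tensor (koszul a) L ⟶ DGModule.tensor (koszul a) C') :
    ∃ φ : L ⟶ C', ∃ k : Cochain (DGModule.tensor (koszul a) L).cx
      (DGModule.tensor (koszul a) C').cx (-1),
      δ (-1) 0 k = Cochain.ofHom f.hom - Cochain.ofHom (tensorMap (koszul a) φ).hom := by
  let T := DGModule.tensor (koszul a) C'
  let H := (homDG (DGModule.tensor (koszul a) L) T).cx
  let F : H.X 0 := (⟨Cochain.ofHom f.hom, DGModule.ofHom_mem f⟩ :
    DGModule.linearCochains (DGModule.tensor (koszul a) L) T 0)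
  have hF : F ∈ cocyc H 0 := (DGModule.mem_cocyc_homDG (zero_add 1)).2 (δ_ofHom f.hom)
  have hj0 : QuasiIso (homCxMap L (koszulUnit (![] : Fin 0 → R) C')) := by
    have := quasiIso_koszulUnit_zero (![] : Fin 0 → R) C'
    exact quasiIso_homCxMap _
  obtain ⟨z, hz, hzF⟩ := (koszulHomTower L C').exists_of_isZero_of_pos h0
    (fun a => homCxMap L (koszulUnit a C'))
    (fun a => (congrArg (homCxMap L) (koszulUnit_succ a C')).trans (homCxMap_comp _ _)) hj0 a ha h
    ((restrictHom L T).f 0 F) (map_mem_cocyc _ hF)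
  have hz' : δ 0 1 (z : Cochain L C' 0) = 0 := (mem_cocyc_homCx (zero_add 1)).1 hz
  let φ : L ⟶ C' := Cocycle.homOf (Cocycle.mk z 1 rfl hz')
  have hφ : Cochain.ofHom φ = z :=
    congrArg Subtype.val (Cocycle.ofHom_homOf_eq_self (Cocycle.mk z 1 rfl hz'))
  let G : H.X 0 := (⟨Cochain.ofHom (tensorMap (koszul a) φ).hom, DGModule.ofHom_mem _⟩ :
    DGModule.linearCochains (DGModule.tensor (koszul a) L) T 0)
  have hG : G ∈ cocyc H 0 :=
    (DGModule.mem_cocyc_homDG (zero_add 1)).2 (δ_ofHom (tensorMap (koszul a) φ).hom)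
  have hGz : (restrictHom L T).f 0 G = (homCxMap L (koszulUnit a C')).f 0 z := by
    change (Cochain.ofHom (tensorUnit (koszul a) L)).comp
      (Cochain.ofHom (tensorMap (koszul a) φ).hom) (zero_add 0) =
        Cochain.comp z (Cochain.ofHom (tensorUnit (koszul a) C')) (add_zero 0)
    rw [← hφ, ← Cochain.ofHom_comp, ← Cochain.ofHom_comp, DGModule.tensorUnit_tensorMap]
  have hFG : (restrictHom L T).f 0 (F - G) ∈ cobdry (homCx L T.cx) 0 := by
    have e : (restrictHom L T).f 0 (F - G) = (restrictHom L T).f 0 F - (restrictHom L T).f 0 G :=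
      map_sub ((restrictHom L T).f 0).hom F G
    rw [e, hGz]
    exact hzF
  obtain ⟨k, -, hk⟩ := (DGModule.mem_cobdry_homDG (z := F - G) (neg_add_cancel 1)).1 <|
    ((quasiIso_iff_cocyc (restrictHom L T)).1 inferInstance 0).1 _ (sub_mem hF hG) hFG
  exact ⟨φ, k, hk⟩

lemma nonempty_iso_of_tensor [IsNoetherianRing R] [IsLocalRing R]
    [HasDerivedCategory.{w} (ModuleCat.{u} R)]
    (ha : ∀ i, a i ∈ IsLocalRing.maximalIdeal R) (hC : IsSemidualizing C)
    (hC' : HomologicallyFinite C')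
    (ψ : (DGModule.Q (koszul a)).obj (DGModule.tensor (koszul a) C) ≅
      (DGModule.Q (koszul a)).obj (DGModule.tensor (koszul a) C')) :
    Nonempty (DerivedCategory.Q.obj C ≅ DerivedCategory.Q.obj C') := by
  obtain ⟨-, L, π, N, hL, hL', hN, hπ, hh⟩ :=
    exists_resolution_of_isSemidualizing_tensor a ha hC.1.2 (isSemidualizing_tensor a hC)
  have := isKProjective_of_free hL hN
  obtain ⟨f, hf⟩ := DGModule.isKProjective_tensor.exists_quasiIso (quasiIso_tensorMap a π hπ) ψ
  obtain ⟨φ, k, hk⟩ := exists_tensorMap_homotopic a ha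
    (finite_homology_homCx hL hL' hN
      ⟨koszulTensorTower_bounded hC'.1, koszulTensorTower_finite hC'.2⟩)
    (fun n hn => isZero_homCx_homology a hπ hh hf hn) f
  have hLfin : HomologicallyDegreewiseFinite L := fun n => by
    have := hL' n
    exact finite_homology_of_finite n
  have hφ : QuasiIso φ := quasiIso_of_quasiIso_tensorMap a ha hLfin hC'.2 φ <|
    quasiIso_of_sub_mem (fun n x hx => sub_mem_cobdry_of_δ_eq hk n hx) hf
  exact ⟨(asIso (DerivedCategory.Q.map π)).symm ≪≫ asIso (DerivedCategory.Q.map φ)⟩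

end Semidualizing

theorem lemmaA3 {R : Type u} [CommRing R] [IsNoetherianRing R] [IsLocalRing R]
    [HasDerivedCategory.{w} (ModuleCat.{u} R)]
    {e : ℕ} (a : Fin e → R) (ha : ∀ i, a i ∈ IsLocalRing.maximalIdeal R)
    (C C' : CochainComplex (ModuleCat.{u} R) ℤ)
    (hC : HomologicallyDegreewiseFinite C) (hC' : HomologicallyDegreewiseFinite C') :
    (DGModule.IsSemidualizing (DGModule.tensor (koszul a) C) ↔ IsSemidualizing C) ∧
    (IsSemidualizing C → IsSemidualizing C' →
      Nonempty ((DGModule.Q (koszul a)).obj (DGModule.tensor (koszul a) C) ≅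
        (DGModule.Q (koszul a)).obj (DGModule.tensor (koszul a) C')) →
      Nonempty (DerivedCategory.Q.obj C ≅ DerivedCategory.Q.obj C')) :=
  ⟨⟨isSemidualizing_of_tensor a ha hC, isSemidualizing_tensor a⟩,
    fun hs hs' ⟨ψ⟩ => nonempty_iso_of_tensor a ha hs hs'.1 ψ⟩
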